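/- Let $\mathbb H=\{z=x+iy\in\mathbb C: y>0\}$ and $\Delta_0=y^2\left(\frac{\partial^2}{\partial x^2}+\frac{\partial^2}{\partial y^2}\right)$. For an integer $m\ge 1$ let $V_0^m(0)$ be the complex vector space of weight $0$ $m$-harmonic Maass forms of moderate growth for $\mathrm{PSL}(2,\mathbb Z)$, that is, of smooth functions $f:\mathbb H\to\mathbb C$ such that 1. $f\left(\frac{az+b}{cz+d}\right)=f(z)$ for all $z\in\mathbb H$ and all $\begin{pmatrix}a&b\\c&d\end{pmatrix}\in \mathrm{SL}(2,\mathbb Z)$; 2. $\Delta_0^m f=0$; 3. there is $\alpha\in\mathbb R$ with $f(x+iy)=O(y^\alpha)$ as $y\to\infty$, uniformly in $x\in\mathbb R$. Let $V_0^{m-1/2}(0)$ be the space of smooth functions $f:\mathbb H\to\mathbb C$ that satisfy 1 and 3 and for which $\Delta_0^{m-1}f$ is a (possibly zero) holomorphic modular form of weight $0$ for $\mathrm{SL}(2,\mathbb Z)$. For $z\in\mathbb H$ and $\operatorname{Re}(s)>1$ put $$E_0(z,s)=\frac12\sum_{(m,n)\in\mathbb Z^2\setminus\{(0,0)\}}\frac{y^s}{|mz+n|^{2s}},\qquad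 \widehat{\widehat E}_0(z,s)=s(s-1)\pi^{-s}\Gamma(s)E_0(z,s).$$ **Theorem.** For each $z\in\mathbb H$ the function $s\mapsto\widehat{\widehat E}_0(z,s)$ continues analytically to an entire function of $s$; let $F_n(z)$ be its Taylor coefficients at $s=0$, so that $\widehat{\widehat E}_0(z,s)=\sum_{n\ge0}F_n(z)s^n$. For every integer $m\ge1$ one has $V_0^m(0)=V_0^{m-1/2}(0)$, this space has dimension $m$ over $\mathbb C$, and the functions $F_0,\dots,F_{m-1}$ form a basis of it. -/

import Mathlib

open scoped UpperHalfPlane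

noncomputable section

namespace PolyharmonicMaass

open UpperHalfPlane Filter Asymptotics
open scoped MatrixGroups ContDiff Topology Laplacian

/-- `f : ℍ → ℂ` is smooth (in the real sense). -/
def IsSmooth (f : ℍ → ℂ) : Prop :=
  ContDiffOn ℝ ∞ (f ∘ ofComplex) {z : ℂ | 0 < z.im}

/-- The weight `0` hyperbolic Laplacian `Δ₀ = y² (∂²/∂x² + ∂²/∂y²)`. -/
def hypLaplacian (f : ℍ → ℂ) : ℍ → ℂ :=
  fun z ↦ (z.im : ℂ) ^ 2 * (Δ (f ∘ ofComplex)) (z : ℂ)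

/-- Moderate growth at the cusp: `f(x+iy) = O(y^α)` as `y → ∞`, uniformly in `x`. -/
def ModerateGrowth (f : ℍ → ℂ) : Prop :=
  ∃ α : ℝ, f =O[atImInfty] fun z : ℍ ↦ z.im ^ α

theorem IsSmooth.contDiffAt {f : ℍ → ℂ} (hf : IsSmooth f) (z : ℍ) :
    ContDiffAt ℝ ∞ (f ∘ ofComplex) (z : ℂ) :=
  ContDiffOn.contDiffAt hf (isOpen_upperHalfPlaneSet.mem_nhds z.im_pos)

theorem IsSmooth.add {f g : ℍ → ℂ} (hf : IsSmooth f) (hg : IsSmooth g) : IsSmooth (f + g) :=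
  ContDiffOn.add hf hg

theorem IsSmooth.smul {f : ℍ → ℂ} (c : ℂ) (hf : IsSmooth f) : IsSmooth (c • f) :=
  ContDiffOn.const_smul c hf

theorem IsSmooth.hypLaplacian {f : ℍ → ℂ} (hf : IsSmooth f) :
    IsSmooth (hypLaplacian f) := by
  have ho : IsOpen {z : ℂ | 0 < z.im} := isOpen_upperHalfPlaneSet
  have h1 : ContDiffOn ℝ ∞ (iteratedFDeriv ℝ 2 (f ∘ ofComplex)) {z : ℂ | 0 < z.im} := by
    intro z hz
    exact ((hf.contDiffAt ⟨z, hz⟩).iteratedFDeriv_right (i := 2) (m := ∞)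
      (WithTop.coe_le_coe.2 (le_top : (⊤ : ℕ∞) + 2 ≤ ⊤))).contDiffWithinAt
  have h3 (v : Fin 2 → ℂ) :
      ContDiffOn ℝ ∞ (fun z ↦ iteratedFDeriv ℝ 2 (f ∘ ofComplex) z v) {z : ℂ | 0 < z.im} :=
    (ContinuousMultilinearMap.apply ℝ (fun _ : Fin 2 ↦ ℂ) ℂ v).contDiff.comp_contDiffOn h1
  have h4 : ContDiff ℝ ∞ (fun z : ℂ ↦ ((z.im : ℂ)) ^ 2) :=
    (Complex.ofRealCLM.contDiff.comp Complex.imCLM.contDiff).pow 2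
  refine (h4.contDiffOn.mul ((h3 ![1, 1]).add (h3 ![Complex.I, Complex.I]))).congr ?_
  intro z hz
  have : ofComplex z = ⟨z, hz⟩ := ofComplex_apply_of_im_pos hz
  simp only [Function.comp_apply, this, PolyharmonicMaass.hypLaplacian,
    InnerProductSpace.laplacian_eq_iteratedFDeriv_complexPlane]
  rfl

theorem hypLaplacian_add {f g : ℍ → ℂ} (hf : IsSmooth f) (hg : IsSmooth g) :
    hypLaplacian (f + g) = hypLaplacian f + hypLaplacian g := by
  funext z
  have h := ContDiffAt.laplacian_add ((hf.contDiffAt z).of_le (m := 2) (WithTop.coe_le_coe.2 (le_top : (2 : ℕ∞) ≤ ⊤)))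
    ((hg.contDiffAt z).of_le (m := 2) (WithTop.coe_le_coe.2 (le_top : (2 : ℕ∞) ≤ ⊤)))
  change _ * Δ (f ∘ ofComplex + g ∘ ofComplex) (z : ℂ) = _ * _ + _ * _
  rw [h, mul_add]

theorem hypLaplacian_smul {f : ℍ → ℂ} (c : ℂ) (hf : IsSmooth f) :
    hypLaplacian (c • f) = c • hypLaplacian f := by
  funext z
  have h := InnerProductSpace.laplacian_smul c
    ((hf.contDiffAt z).of_le (m := 2) (WithTop.coe_le_coe.2 (le_top : (2 : ℕ∞) ≤ ⊤)))
  change _ * Δ (c • (f ∘ ofComplex)) (z : ℂ) = c * (_ * _)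
  rw [h, smul_eq_mul]
  ring

theorem iterate_hypLaplacian_add (m : ℕ) {f g : ℍ → ℂ} (hf : IsSmooth f) (hg : IsSmooth g) :
    hypLaplacian^[m] (f + g) = hypLaplacian^[m] f + hypLaplacian^[m] g := by
  induction m generalizing f g with
  | zero => rfl
  | succ m ih =>
    simp only [Function.iterate_succ_apply, hypLaplacian_add hf hg]
    exact ih hf.hypLaplacian hg.hypLaplacian

theorem iterate_hypLaplacian_smul (m : ℕ) {f : ℍ → ℂ} (c : ℂ) (hf : IsSmooth f) :
    hypLaplacian^[m] (c • f) = c • hypLaplacian^[m] f := by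
  induction m generalizing f with
  | zero => rfl
  | succ m ih =>
    simp only [Function.iterate_succ_apply, hypLaplacian_smul c hf]
    exact ih hf.hypLaplacian

theorem ModerateGrowth.add {f g : ℍ → ℂ} (hf : ModerateGrowth f) (hg : ModerateGrowth g) :
    ModerateGrowth (f + g) := by
  obtain ⟨α, hα⟩ := hf
  obtain ⟨β, hβ⟩ := hg
  have key {γ : ℝ} (h : γ ≤ max α β) :
      (fun z : ℍ ↦ z.im ^ γ) =O[atImInfty] fun z : ℍ ↦ z.im ^ max α β := by
    refine IsBigO.of_bound 1 ?_
    filter_upwards [(atImInfty_mem {z | 1 ≤ z.im}).2 ⟨1, fun _ h ↦ h⟩] with z hz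
    rw [one_mul, Real.norm_of_nonneg (by positivity), Real.norm_of_nonneg (by positivity)]
    exact Real.rpow_le_rpow_of_exponent_le hz h
  exact ⟨max α β, (hα.trans (key (le_max_left _ _))).add (hβ.trans (key (le_max_right _ _)))⟩

/-- The smooth functions on `ℍ` that are invariant under the modular group (weight `0`) and have
moderate growth at the cusp. -/
def automorphicFunctions : Submodule ℂ (ℍ → ℂ) where
  carrier := {f | IsSmooth f ∧ (∀ (γ : SL(2, ℤ)) (z : ℍ), f (γ • z) = f z) ∧ ModerateGrowth f}
  zero_mem' := ⟨contDiffOn_const (c := (0 : ℂ)), fun _ _ ↦ rfl, 0, isBigO_zero _ _⟩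
  add_mem' := by
    rintro f g ⟨hf, hf', hf''⟩ ⟨hg, hg', hg''⟩
    exact ⟨hf.add hg, fun γ z ↦ by rw [Pi.add_apply, Pi.add_apply, hf', hg'], hf''.add hg''⟩
  smul_mem' := by
    rintro c f ⟨hf, hf', α, hα⟩
    exact ⟨hf.smul c, fun γ z ↦ by rw [Pi.smul_apply, Pi.smul_apply, hf'], α, hα.const_smul_left c⟩

/-- The space `V₀^m(0)`, for an integer `m`, of weight `0` `m`-harmonic Maass forms: the functions
in `automorphicFunctions` that satisfy `Δ₀^m f = 0`. -/
def V (m : ℕ) : Submodule ℂ (ℍ → ℂ) where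
  carrier := {f | f ∈ automorphicFunctions ∧ hypLaplacian^[m] f = 0}
  zero_mem' := by
    refine ⟨zero_mem _, ?_⟩
    have h := iterate_hypLaplacian_smul m (f := 0) 0 (zero_mem automorphicFunctions).1
    simpa using h
  add_mem' := by
    rintro f g ⟨hf, hf'⟩ ⟨hg, hg'⟩
    exact ⟨add_mem hf hg, by rw [iterate_hypLaplacian_add m hf.1 hg.1, hf', hg', add_zero]⟩
  smul_mem' := by
    rintro c f ⟨hf, hf'⟩
    exact ⟨Submodule.smul_mem _ c hf, by rw [iterate_hypLaplacian_smul m c hf.1, hf', smul_zero]⟩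

/-- The space `V₀^{n+1/2}(0)`: the functions `f` in `automorphicFunctions` such that `Δ₀^n f` is a
holomorphic modular form of weight `0` for the full modular group (possibly zero). -/
def VHalf (n : ℕ) : Submodule ℂ (ℍ → ℂ) where
  carrier := {f | f ∈ automorphicFunctions ∧ ∃ g : ModularForm 𝒮ℒ 0, hypLaplacian^[n] f = ⇑g}
  zero_mem' := by
    refine ⟨zero_mem _, 0, ?_⟩
    have h := iterate_hypLaplacian_smul n (f := 0) 0 (zero_mem automorphicFunctions).1
    rw [FunLike.coe_zero]
    simpa using h
  add_mem' := by
    rintro f₁ f₂ ⟨hf, g₁, hg₁⟩ ⟨hf', g₂, hg₂⟩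
    exact ⟨add_mem hf hf', g₁ + g₂, by
      rw [iterate_hypLaplacian_add n hf.1 hf'.1, hg₁, hg₂, FunLike.coe_add]⟩
  smul_mem' := by
    rintro c f ⟨hf, g, hg⟩
    exact ⟨Submodule.smul_mem _ c hf, c • g, by
      rw [iterate_hypLaplacian_smul n c hf.1, hg]; rfl⟩

/-- The non-holomorphic Eisenstein series
`E₀(z,s) = ½ ∑_{(m,n) ≠ (0,0)} y^s / |mz+n|^{2s}`, meaningful for `Re s > 1`. -/
def eisenstein (z : ℍ) (s : ℂ) : ℂ :=
  1 / 2 * ∑' p : {p : ℤ × ℤ // p ≠ 0},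
    (z.im : ℂ) ^ s / ((‖(p.1.1 : ℂ) * z + p.1.2‖ : ℝ) : ℂ) ^ (2 * s)

/-- `f` is the analytic continuation to all of `ℂ` of `s ↦ s(s-1) π^{-s} Γ(s) E₀(z,s)`, which is
given by the series for `Re s > 1`. -/
def IsDoublyCompleted (z : ℍ) (f : ℂ → ℂ) : Prop :=
  Differentiable ℂ f ∧
    ∀ s : ℂ, 1 < s.re → f s = s * (s - 1) * (Real.pi : ℂ) ^ (-s) * Complex.Gamma s * eisenstein z s

theorem IsDoublyCompleted.unique {z : ℍ} {f g : ℂ → ℂ} (hf : IsDoublyCompleted z f)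
    (hg : IsDoublyCompleted z g) : f = g := by
  refine AnalyticOnNhd.eq_of_eventuallyEq (𝕜 := ℂ) (z₀ := 2)
    (fun s _ ↦ hf.1.analyticAt s) (fun s _ ↦ hg.1.analyticAt s) ?_
  have : {s : ℂ | 1 < s.re} ∈ 𝓝 (2 : ℂ) :=
    (isOpen_lt continuous_const Complex.continuous_re).mem_nhds (by simp)
  filter_upwards [this] with s hs
  rw [hf.2 s hs, hg.2 s hs]

/-- The doubly-completed Eisenstein series: the entire function of `s` that continues
`s(s-1) π^{-s} Γ(s) E₀(z,s)` (unique by `IsDoublyCompleted.unique`). -/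
def doublyCompletedEisenstein (z : ℍ) : ℂ → ℂ :=
  Classical.epsilon (IsDoublyCompleted z)

/-- The `n`-th Taylor coefficient `F_n(z)` at `s = 0` of the doubly-completed Eisenstein series. -/
def F (n : ℕ) (z : ℍ) : ℂ :=
  iteratedDeriv n (doublyCompletedEisenstein z) 0 / (n.factorial : ℂ)

end PolyharmonicMaass

end

open scoped UpperHalfPlane

noncomputable section

namespace PolyharmonicMaass

open UpperHalfPlane Filter Asymptotics
open scoped MatrixGroups ContDiff Topology Laplacian

/-! ### The Laplacian and holomorphic changes of variable -/

/-! The upper bound for the dimension comes from weight two. If `f` lies in `V (k+1)`, then `g =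
Δ₀^k f` is harmonic and invariant, so `u_x - i u_y` with `u = Re g` is holomorphic and transforms
with weight 2. Moderate growth is assumed for `f` only, not for its derivatives. An interior
estimate, rescaled by the isometries `z ↦ x + yz`, passes it on to this gradient
(`isBigO_complexGrad`). A periodic holomorphic function of polynomial growth is bounded at the cusp,
and there is no nonzero level one form of weight 2, so the gradient vanishes. The same argument for
`-i f` treats the imaginary part, and `g` is constant (`exists_iterate_hypLaplacian_eq_const`).
Hence `V m` has codimension at most one in `V (m+1)`. Since weight 0 forms of level one are
constants, the half-integral spaces coincide with the integral ones.

The lower bound comes from the Eisenstein series. Write `Q = |mz+n|²/y`, and let `ψ(t)` be the theta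
series `∑ exp(-π t Q)` over nonzero `(m,n)`. Riemann's method gives `½ (1 + s(s-1) ∫₁^∞ (t^{s-1} +
t^{-s}) ψ(t) dt)` for the doubly completed series, which is entire in `s`. Let `e_n` be the Taylor
coefficients of the integral; then `2 F_n = δ_{n0} + e_{n-2} - e_{n-1}`. The eigenvalue equation
with eigenvalue `s(s-1)` becomes `Δ₀ e_n = 2 F_n` (`hypLaplacian_eisensteinCoeff`). It is proved
termwise: the Laplacian of a function of `Q` is an ordinary differential operator in `Q`, and two
integrations by parts in `t` move it to the weight `t^{s-1} + t^{-s}`. The boundary terms at `t = 1`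
sum to `δ_{n0}` by the derivative of the theta functional equation (`tsum_two_mul_sub_one_mul_exp`).

Therefore `Δ₀ F_{n+2} = F_n - F_{n+1}`, so `Δ₀^n F_n` is the nonzero constant `(-1)^n / 2`. Each
`F_n` lies in `V (n+1)` and not in `V n`, and the basis follows by induction. -/

theorem laplacian_eq_fderiv_fderiv {F : Type*} [NormedAddCommGroup F] [NormedSpace ℝ F]
    (U : ℂ → F) (z : ℂ) :
    Δ U z = fderiv ℝ (fderiv ℝ U) z 1 1 + fderiv ℝ (fderiv ℝ U) z Complex.I Complex.I := by
  simp [InnerProductSpace.laplacian_eq_iteratedFDeriv_complexPlane, iteratedFDeriv_two_apply]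

/-- The value on the diagonal of the second derivative of `U ∘ g`, with `g` holomorphic. -/
theorem fderiv_fderiv_comp_holomorphic {F : Type*} [NormedAddCommGroup F] [NormedSpace ℝ F]
    {U : ℂ → F} {g : ℂ → ℂ} {z : ℂ} (hU : ContDiffAt ℝ 2 U (g z)) (hg : AnalyticAt ℂ g z) (v : ℂ) :
    fderiv ℝ (fderiv ℝ (U ∘ g)) z v v =
      fderiv ℝ (fderiv ℝ U) (g z) (deriv g z * v) (deriv g z * v) +
        fderiv ℝ U (g z) (deriv (deriv g) z * v * v) := by
  -- With the direction `v` frozen, the second derivative is a first derivative of `w ↦ D(U ∘ g)(w)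
  -- v`, which the chain rule rewrites near `z`.
  have hev : ∀ᶠ w in 𝓝 z, fderiv ℝ (U ∘ g) w v = fderiv ℝ U (g w) (deriv g w * v) := by
    have h1 : ∀ᶠ w in 𝓝 z, DifferentiableAt ℝ U (g w) := by
      have h1 := (hU.eventually (by simp)).mono fun w hw ↦ hw.differentiableAt (by simp)
      exact hg.continuousAt.eventually h1
    filter_upwards [h1, hg.eventually_analyticAt] with w hw1 hw2
    have h3 := hw2.differentiableAt.hasDerivAt.hasFDerivAt.restrictScalars ℝ
    rw [(hw1.hasFDerivAt.comp w h3).fderiv]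
    simp [mul_comm]
  have hd2 : DifferentiableAt ℝ (fderiv ℝ U) (g z) :=
    (hU.fderiv_right (m := 1) (by norm_num)).differentiableAt (by simp)
  have hgd := hg.differentiableAt.hasDerivAt.hasFDerivAt.restrictScalars ℝ
  have hgdd := hg.deriv.differentiableAt.hasDerivAt.hasFDerivAt.restrictScalars ℝ
  have h4 := (hd2.hasFDerivAt.comp z hgd).clm_apply (hgdd.mul_const v)
  have hL : DifferentiableAt ℝ (fderiv ℝ (U ∘ g)) z := by
    have : ContDiffAt ℝ 2 (U ∘ g) z := hU.comp z (hg.contDiffAt.restrict_scalars ℝ)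
    exact (this.fderiv_right (m := 1) (by norm_num)).differentiableAt (by simp)
  have h5 : fderiv ℝ (fun w ↦ fderiv ℝ (U ∘ g) w v) z v = fderiv ℝ (fderiv ℝ (U ∘ g)) z v v := by
    rw [fderiv_clm_apply hL (by fun_prop)]
    simp
  rw [← h5, Filter.EventuallyEq.fderiv_eq hev]
  erw [h4.fderiv]
  simp
  rw [add_comm]
  congr 2 <;> ring_nf

/-- The directions `1` and `i` are sent to `g'` and `i g'`, an orthogonal frame scaled by `|g'|`.
The terms with `g''` cancel because `1² + i² = 0`, and the mixed second derivatives cancel by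
symmetry. -/
theorem laplacian_comp_holomorphic {F : Type*} [NormedAddCommGroup F] [NormedSpace ℝ F]
    {U : ℂ → F} {g : ℂ → ℂ} {z : ℂ} (hU : ContDiffAt ℝ 2 U (g z)) (hg : AnalyticAt ℂ g z) :
    Δ (U ∘ g) z = (‖deriv g z‖ ^ 2 : ℝ) • Δ U (g z) := by
  rw [laplacian_eq_fderiv_fderiv, laplacian_eq_fderiv_fderiv, fderiv_fderiv_comp_holomorphic hU hg,
    fderiv_fderiv_comp_holomorphic hU hg]
  have hsymm : IsSymmSndFDerivAt ℝ U (g z) := hU.isSymmSndFDerivAt (by simp)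
  set B := fderiv ℝ (fderiv ℝ U) (g z) with hB
  set a := deriv g z
  have h1 : a * 1 = a.re • (1 : ℂ) + a.im • Complex.I := by
    apply Complex.ext <;> simp
  have h2 : a * Complex.I = (-a.im) • (1 : ℂ) + a.re • Complex.I := by
    apply Complex.ext <;> simp
  have h3 : deriv (deriv g) z * Complex.I * Complex.I = -(deriv (deriv g) z * 1 * 1) := by
    rw [mul_assoc, Complex.I_mul_I]; ring
  rw [h3, map_neg, h1, h2, Complex.sq_norm, Complex.normSq_apply]
  have h4 : B Complex.I 1 = B 1 Complex.I := hsymm.eq Complex.I 1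
  simp only [map_add, map_smul, add_apply, smul_apply, h4]
  module

/-! ### Isometries of the upper half-plane -/

theorem eventually_im_pos (z : ℍ) : ∀ᶠ w : ℂ in 𝓝 (z : ℂ), 0 < w.im :=
  isOpen_upperHalfPlaneSet.mem_nhds z.im_pos

theorem IsSmooth.iterate_hypLaplacian {f : ℍ → ℂ} (hf : IsSmooth f) (k : ℕ) :
    IsSmooth (PolyharmonicMaass.hypLaplacian^[k] f) := by
  induction k with
  | zero => exact hf
  | succ k ih => rw [Function.iterate_succ_apply']; exact ih.hypLaplacian

/-- `τ : ℍ → ℍ` is given by a holomorphic function `G` and multiplies the hyperbolic metric by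
`1`. -/
structure IsHolomorphicIsometry (τ : ℍ → ℍ) (G : ℂ → ℂ) : Prop where
  coe_eq : ∀ z : ℍ, (τ z : ℂ) = G z
  differentiableOn : DifferentiableOn ℂ G {z : ℂ | 0 < z.im}
  im_eq : ∀ z : ℍ, (τ z).im = ‖deriv G z‖ * z.im

namespace IsHolomorphicIsometry

variable {τ : ℍ → ℍ} {G : ℂ → ℂ}

theorem analyticAt (h : IsHolomorphicIsometry τ G) (z : ℍ) : AnalyticAt ℂ G z :=
  h.differentiableOn.analyticAt (isOpen_upperHalfPlaneSet.mem_nhds z.im_pos)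

theorem comp_ofComplex_eventuallyEq (h : IsHolomorphicIsometry τ G) {α : Type*} (f : ℍ → α) (z : ℍ) :
    (f ∘ τ) ∘ ofComplex =ᶠ[𝓝 (z : ℂ)] (f ∘ ofComplex) ∘ G := by
  filter_upwards [eventually_im_pos z] with w hw
  simp only [Function.comp_apply]
  rw [ofComplex_apply_of_im_pos hw]
  have := h.coe_eq ⟨w, hw⟩
  simp only at this
  rw [← this, ofComplex_apply]

theorem isSmooth_comp (h : IsHolomorphicIsometry τ G) {f : ℍ → ℂ} (hf : IsSmooth f) : IsSmooth (f ∘ τ) := by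
  intro z hz
  refine ContDiffAt.contDiffWithinAt ?_
  refine ContDiffAt.congr_of_eventuallyEq ?_ (h.comp_ofComplex_eventuallyEq f ⟨z, hz⟩)
  refine ContDiffAt.comp z ?_ ((h.analyticAt ⟨z, hz⟩).contDiffAt.restrict_scalars ℝ)
  have := h.coe_eq ⟨z, hz⟩
  simp only at this
  rw [← this]
  exact hf.contDiffAt _

/-- The factor `|G'|²` produced by the Euclidean Laplacian is exactly the one by which `y²` changes.
-/
theorem hypLaplacian_comp (h : IsHolomorphicIsometry τ G) {f : ℍ → ℂ} (hf : IsSmooth f) :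
    hypLaplacian (f ∘ τ) = hypLaplacian f ∘ τ := by
  funext z
  simp only [hypLaplacian, Function.comp_apply]
  rw [(InnerProductSpace.laplacian_congr_nhds (h.comp_ofComplex_eventuallyEq f z)).eq_of_nhds,
    laplacian_comp_holomorphic, h.im_eq, ← h.coe_eq]
  · rw [Complex.real_smul]
    push_cast
    ring
  · rw [← h.coe_eq]
    exact (hf.contDiffAt _).of_le (WithTop.coe_le_coe.2 le_top)
  · exact h.analyticAt z

theorem iterate_hypLaplacian_comp (h : IsHolomorphicIsometry τ G) {f : ℍ → ℂ} (hf : IsSmooth f) (k : ℕ) :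
    hypLaplacian^[k] (f ∘ τ) = hypLaplacian^[k] f ∘ τ := by
  induction k with
  | zero => rfl
  | succ k ih =>
    rw [Function.iterate_succ_apply', ih, Function.iterate_succ_apply', h.hypLaplacian_comp]
    exact hf.iterate_hypLaplacian k

end IsHolomorphicIsometry

/-- The Möbius transformation of `ℂ` given by an integral matrix. -/
def moebius (γ : SL(2, ℤ)) (z : ℂ) : ℂ := (γ 0 0 * z + γ 0 1) / (γ 1 0 * z + γ 1 1)

theorem denom_ne_zero_of_im_pos (γ : SL(2, ℤ)) {z : ℂ} (hz : 0 < z.im) :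
    (γ 1 0 * z + γ 1 1 : ℂ) ≠ 0 := by
  have := UpperHalfPlane.denom_ne_zero (γ : GL (Fin 2) ℝ) ⟨z, hz⟩
  simpa [UpperHalfPlane.denom] using this

theorem hasDerivAt_moebius (γ : SL(2, ℤ)) {z : ℂ} (hz : 0 < z.im) :
    HasDerivAt (moebius γ) (1 / (γ 1 0 * z + γ 1 1) ^ 2) z := by
  have h0 := denom_ne_zero_of_im_pos γ hz
  have h1 : HasDerivAt (fun z : ℂ ↦ (γ 0 0 * z + γ 0 1 : ℂ)) (γ 0 0) z := by
    simpa using ((hasDerivAt_id z).const_mul (γ 0 0 : ℂ)).add_const (γ 0 1 : ℂ)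
  have h2 : HasDerivAt (fun z : ℂ ↦ (γ 1 0 * z + γ 1 1 : ℂ)) (γ 1 0) z := by
    simpa using ((hasDerivAt_id z).const_mul (γ 1 0 : ℂ)).add_const (γ 1 1 : ℂ)
  refine (h1.div h2 h0).congr_deriv ?_
  rw [div_left_inj' (pow_ne_zero 2 h0)]
  have hdet : (γ 0 0 * γ 1 1 - γ 0 1 * γ 1 0 : ℂ) = 1 := by
    have := γ.det_coe
    rw [Matrix.det_fin_two] at this
    exact_mod_cast this
  linear_combination hdet

theorem coe_smul_eq_moebius (γ : SL(2, ℤ)) (z : ℍ) : ((γ • z : ℍ) : ℂ) = moebius γ z := by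
  rw [moebius, UpperHalfPlane.coe_specialLinearGroup_apply]
  simp

theorem isHolomorphicIsometry_smul (γ : SL(2, ℤ)) :
    IsHolomorphicIsometry (fun z ↦ γ • z) (moebius γ) where
  coe_eq := coe_smul_eq_moebius γ
  differentiableOn z hz := (hasDerivAt_moebius γ hz).differentiableAt.differentiableWithinAt
  im_eq z := by
    rw [(hasDerivAt_moebius γ z.im_pos).deriv, ModularGroup.im_smul_eq_div_normSq,
      ModularGroup.denom_apply, norm_div, norm_one, norm_pow, Complex.sq_norm]
    ring

/-- The map `z ↦ x + y z` of the upper half-plane, where `w = x + i y`. -/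
def affineMap (w z : ℍ) : ℍ :=
  ⟨w.re + w.im * z, by simp [w.im_pos, z.im_pos]⟩

theorem coe_affineMap (w z : ℍ) : (affineMap w z : ℂ) = w.re + w.im * z := rfl

/-- These isometries carry `i` to `w`, so that one estimate at `i` yields an estimate at every point
with explicit dependence on the height. -/
theorem isHolomorphicIsometry_affineMap (w : ℍ) :
    IsHolomorphicIsometry (affineMap w) (fun z ↦ w.re + w.im * z) where
  coe_eq z := rfl
  differentiableOn := by fun_prop
  im_eq z := by
    have : deriv (fun z : ℂ ↦ (w.re + w.im * z : ℂ)) z = w.im := by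
      simp
    rw [this, Complex.norm_real, Real.norm_of_nonneg w.im_pos.le, ← UpperHalfPlane.coe_im,
      coe_affineMap]
    simp

open MeasureTheory

/-! ### Integration by parts against test functions -/

/-- `H` may be arbitrary off `U`. This permits functions `h ∘ ofComplex`, whose values off the upper
half-plane are meaningless. -/
theorem continuous_mul_of_tsupport_subset {U : Set ℂ} (hU : IsOpen U) {ψ H : ℂ → ℂ}
    (hψ : Continuous ψ) (hs : tsupport ψ ⊆ U) (hH : ContinuousOn H U) :
    Continuous (fun z ↦ ψ z * H z) := by
  refine continuous_of_tsupport fun z hz ↦ ?_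
  have hz' : z ∈ U := hs (tsupport_mul_subset_left hz)
  exact hψ.continuousAt.mul (hH.continuousAt (hU.mem_nhds hz'))

theorem integrable_mul_of_tsupport_subset {U : Set ℂ} (hU : IsOpen U) {ψ H : ℂ → ℂ}
    (hψ : Continuous ψ) (hc : HasCompactSupport ψ) (hs : tsupport ψ ⊆ U) (hH : ContinuousOn H U) :
    Integrable (fun z ↦ ψ z * H z) :=
  (continuous_mul_of_tsupport_subset hU hψ hs hH).integrable_of_hasCompactSupport hc.mul_right

theorem tsupport_fderiv_apply_subset (ψ : ℂ → ℂ) (v : ℂ) :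
    tsupport (fun z ↦ fderiv ℝ ψ z v) ⊆ tsupport ψ := by
  refine (closure_mono ?_).trans (tsupport_fderiv_subset ℝ (f := ψ))
  intro z hz h
  apply hz
  simp [h]

theorem integral_mul_fderiv_of_tsupport_subset {U : Set ℂ} (hU : IsOpen U) {ψ H : ℂ → ℂ}
    (hψ : ContDiff ℝ 1 ψ) (hc : HasCompactSupport ψ) (hs : tsupport ψ ⊆ U)
    (hH : ContDiffOn ℝ 1 H U) (v : ℂ) :
    ∫ z, ψ z * fderiv ℝ H z v = -∫ z, fderiv ℝ ψ z v * H z := by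
  have h1 : Continuous (fun z ↦ fderiv ℝ ψ z v) :=
    (hψ.continuous_fderiv one_ne_zero).clm_apply continuous_const
  have h2 : ContinuousOn (fun z ↦ fderiv ℝ H z v) U :=
    (hH.continuousOn_fderiv_of_isOpen hU le_rfl).clm_apply continuousOn_const
  have h3 := tsupport_fderiv_apply_subset ψ v
  refine integral_mul_fderiv_eq_neg_fderiv_mul_of_integrable ?_ ?_ ?_ ?_ ?_
  · exact integrable_mul_of_tsupport_subset hU h1 (hc.mono' (subset_closure.trans h3))
      (h3.trans hs) hH.continuousOn
  · exact integrable_mul_of_tsupport_subset hU hψ.continuous hc hs h2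
  · exact integrable_mul_of_tsupport_subset hU hψ.continuous hc hs hH.continuousOn
  · exact fun z _ ↦ hψ.differentiable one_ne_zero z
  · exact fun z hz ↦ (hH.differentiableOn one_ne_zero).differentiableAt (hU.mem_nhds (hs hz))

theorem contDiff_laplacian {ψ : ℂ → ℂ} (hψ : ContDiff ℝ ∞ ψ) : ContDiff ℝ ∞ (Δ ψ) := by
  have h1 : ContDiff ℝ ∞ (fderiv ℝ ψ) := hψ.fderiv_right (by simp)
  have h2 : ContDiff ℝ ∞ (fderiv ℝ (fderiv ℝ ψ)) := h1.fderiv_right (by simp)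
  have : Δ ψ = fun z ↦ fderiv ℝ (fderiv ℝ ψ) z 1 1 + fderiv ℝ (fderiv ℝ ψ) z Complex.I Complex.I :=
    funext (laplacian_eq_fderiv_fderiv ψ)
  rw [this]
  exact ((h2.clm_apply contDiff_const).clm_apply contDiff_const).add
    ((h2.clm_apply contDiff_const).clm_apply contDiff_const)

theorem tsupport_laplacian_subset (ψ : ℂ → ℂ) : tsupport (Δ ψ) ⊆ tsupport ψ := by
  refine closure_minimal ?_ (isClosed_tsupport ψ)
  intro z hz
  by_contra h
  apply hz
  have h1 : fderiv ℝ (fderiv ℝ ψ) z = 0 := by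
    have h2 : z ∉ tsupport (fderiv ℝ (fderiv ℝ ψ)) := fun h3 ↦
      h (tsupport_fderiv_subset ℝ (f := ψ) (tsupport_fderiv_subset ℝ (f := fderiv ℝ ψ) h3))
    exact image_eq_zero_of_notMem_tsupport h2
  rw [laplacian_eq_fderiv_fderiv, h1]
  simp

/-- Green's formula against a test function. -/
theorem integral_mul_laplacian {U : Set ℂ} (hU : IsOpen U) {ψ H : ℂ → ℂ}
    (hψ : ContDiff ℝ ∞ ψ) (hc : HasCompactSupport ψ) (hs : tsupport ψ ⊆ U)
    (hH : ContDiffOn ℝ ∞ H U) :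
    ∫ z, ψ z * Δ H z = ∫ z, Δ ψ z * H z := by
  have hH1 : ContDiffOn ℝ ∞ (fderiv ℝ H) U := hH.fderiv_of_isOpen hU (by simp)
  have hH1' (v : ℂ) : ContDiffOn ℝ ∞ (fun z ↦ fderiv ℝ H z v) U := hH1.clm_apply contDiffOn_const
  have hψ1 (v : ℂ) : ContDiff ℝ ∞ (fun z ↦ fderiv ℝ ψ z v) :=
    (hψ.fderiv_right (m := ∞) (by simp)).clm_apply contDiff_const
  have hψs (v : ℂ) := tsupport_fderiv_apply_subset ψ v
  have hψc (v : ℂ) : HasCompactSupport (fun z ↦ fderiv ℝ ψ z v) :=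
    hc.mono' (subset_closure.trans (hψs v))
  have hψs2 (v : ℂ) := tsupport_fderiv_apply_subset (fun z ↦ fderiv ℝ ψ z v) v
  have hψc2 (v : ℂ) : HasCompactSupport (fun z ↦ fderiv ℝ (fun z ↦ fderiv ℝ ψ z v) z v) :=
    (hψc v).mono' (subset_closure.trans (hψs2 v))
  have one_le : (1 : WithTop ℕ∞) ≤ ∞ := WithTop.coe_le_coe.2 le_top
  have key (v : ℂ) : ∫ z, ψ z * fderiv ℝ (fun w ↦ fderiv ℝ H w v) z v =
      ∫ z, fderiv ℝ (fun w ↦ fderiv ℝ ψ w v) z v * H z := by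
    rw [integral_mul_fderiv_of_tsupport_subset hU (hψ.of_le one_le) hc hs ((hH1' v).of_le one_le),
      integral_mul_fderiv_of_tsupport_subset hU ((hψ1 v).of_le one_le) (hψc v) ((hψs v).trans hs)
      (hH.of_le one_le), neg_neg]
  have e1 (v : ℂ) {z : ℂ} (hz : z ∈ U) :
      fderiv ℝ (fun w ↦ fderiv ℝ H w v) z v = fderiv ℝ (fderiv ℝ H) z v v := by
    rw [fderiv_clm_apply ((hH1.differentiableOn (by simp)).differentiableAt (hU.mem_nhds hz))
      (by fun_prop)]
    simp
  have e2 (v z : ℂ) :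
      fderiv ℝ (fun w ↦ fderiv ℝ ψ w v) z v = fderiv ℝ (fderiv ℝ ψ) z v v := by
    have h := (hψ.fderiv_right (m := 1) (WithTop.coe_le_coe.2 le_top)).differentiable one_ne_zero z
    rw [fderiv_clm_apply h (by fun_prop)]
    simp
  have e3 (z : ℂ) : ψ z * Δ H z = ψ z * fderiv ℝ (fun w ↦ fderiv ℝ H w 1) z 1 +
      ψ z * fderiv ℝ (fun w ↦ fderiv ℝ H w Complex.I) z Complex.I := by
    by_cases hz : z ∈ U
    · rw [e1 _ hz, e1 _ hz, laplacian_eq_fderiv_fderiv, mul_add]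
    · have : ψ z = 0 := by
        by_contra h
        exact hz (hs (subset_closure h))
      simp [this]
  have e4 (z : ℂ) : Δ ψ z * H z = fderiv ℝ (fun w ↦ fderiv ℝ ψ w 1) z 1 * H z +
      fderiv ℝ (fun w ↦ fderiv ℝ ψ w Complex.I) z Complex.I * H z := by
    rw [e2, e2, laplacian_eq_fderiv_fderiv, add_mul]
  have i1 (v : ℂ) : Integrable fun z ↦ ψ z * fderiv ℝ (fun w ↦ fderiv ℝ H w v) z v :=
    integrable_mul_of_tsupport_subset hU hψ.continuous hc hs
      (((hH1' v).continuousOn_fderiv_of_isOpen hU one_le).clm_apply continuousOn_const)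
  have i2 (v : ℂ) : Integrable fun z ↦ fderiv ℝ (fun w ↦ fderiv ℝ ψ w v) z v * H z :=
    integrable_mul_of_tsupport_subset hU
      (((hψ1 v).continuous_fderiv (by simp)).clm_apply continuous_const) (hψc2 v)
      ((hψs2 v).trans ((hψs v).trans hs)) hH.continuousOn
  simp_rw [e3, e4]
  rw [integral_add (i1 _) (i1 _), integral_add (i2 _) (i2 _), key, key]

/-- Iterated Laplacians are controlled, in the weak sense, by the function itself. -/
theorem exists_norm_integral_mul_iterate_hypLaplacian_le (k : ℕ) (K : Set ℂ) (hK : IsCompact K)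
    (hKU : K ⊆ {z : ℂ | 0 < z.im}) {ψ : ℂ → ℂ} (hψ : ContDiff ℝ ∞ ψ) (hs : tsupport ψ ⊆ K) :
    ∃ C : ℝ, 0 ≤ C ∧ ∀ (h : ℍ → ℂ) (M : ℝ), IsSmooth h → (∀ z : ℍ, (z : ℂ) ∈ K → ‖h z‖ ≤ M) →
      ‖∫ z : ℂ, ψ z * hypLaplacian^[k] h (ofComplex z)‖ ≤ C * M := by
  have hc {ψ : ℂ → ℂ} (hs : tsupport ψ ⊆ K) : HasCompactSupport ψ :=
    hK.of_isClosed_subset (isClosed_tsupport ψ) hs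
  induction k generalizing ψ with
  | zero =>
    refine ⟨∫ z, ‖ψ z‖, integral_nonneg fun _ ↦ norm_nonneg _, fun h M hh hM ↦ ?_⟩
    refine (norm_integral_le_integral_norm _).trans ?_
    rw [← integral_mul_const]
    refine integral_mono_of_nonneg (ae_of_all _ fun _ ↦ norm_nonneg _) ?_ (ae_of_all _ fun z ↦ ?_)
    · exact ((hψ.continuous.integrable_of_hasCompactSupport (hc hs)).norm).mul_const _
    · simp only [Function.iterate_zero, id, norm_mul]
      by_cases hz : z ∈ K
      · have hz' : 0 < z.im := hKU hz
        refine mul_le_mul_of_nonneg_left (hM _ ?_) (norm_nonneg _)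
        rwa [ofComplex_apply_of_im_pos hz']
      · have : ψ z = 0 := by
          by_contra h
          exact hz (hs (subset_closure h))
        simp [this]
  | succ k ih =>
    -- The factor `y²` is absorbed into the test function, and Green's formula turns `ψ` into `Δ (y²
    -- ψ)`. This is why the induction runs over all test functions supported in `K`.
    set χ : ℂ → ℂ := fun z ↦ (z.im : ℂ) ^ 2 * ψ z with hχ
    have hχ' : ContDiff ℝ ∞ χ :=
      ((Complex.ofRealCLM.contDiff.comp Complex.imCLM.contDiff).pow 2).mul hψ
    have hχs : tsupport χ ⊆ K := tsupport_mul_subset_right.trans hs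
    obtain ⟨C, hC0, hC⟩ := ih (contDiff_laplacian hχ') ((tsupport_laplacian_subset χ).trans hχs)
    refine ⟨C, hC0, fun h M hh hM ↦ ?_⟩
    have hk := hh.iterate_hypLaplacian k
    convert hC h M hh hM using 2
    have := integral_mul_laplacian isOpen_upperHalfPlaneSet hχ' (hc hχs) (hχs.trans hKU) hk
    refine Eq.trans (integral_congr_ae (ae_of_all _ fun z ↦ ?_)) this
    simp only [hχ, Function.iterate_succ_apply']
    by_cases hz : z ∈ K
    · have hz' : 0 < z.im := hKU hz
      rw [hypLaplacian, ofComplex_apply_of_im_pos hz']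
      simp only [← UpperHalfPlane.coe_im]
      ring
    · have : ψ z = 0 := by
        by_contra h
        exact hz (hs (subset_closure h))
      simp [this]

/-! ### The mean value property with a radial weight -/

/-- A smooth nonnegative function of `‖z - i‖` supported in the closed ball of radius `1/2`. -/
def radialBump (z : ℂ) : ℝ := Real.smoothTransition (1 / 4 - ‖z - Complex.I‖ ^ 2)

theorem contDiff_radialBump : ContDiff ℝ ∞ radialBump :=
  Real.smoothTransition.contDiff.comp
    (contDiff_const.sub ((contDiff_id.sub contDiff_const).norm_sq ℝ))

theorem tsupport_radialBump_subset : tsupport radialBump ⊆ Metric.closedBall Complex.I (1 / 2) := by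
  refine closure_minimal (fun z hz ↦ ?_) Metric.isClosed_closedBall
  by_contra h
  rw [Metric.mem_closedBall, dist_eq_norm, not_le] at h
  exact hz (Real.smoothTransition.zero_of_nonpos (by nlinarith))

theorem radialBump_eq_zero {z : ℂ} (hz : 1 / 2 < ‖z - Complex.I‖) : radialBump z = 0 :=
  Real.smoothTransition.zero_of_nonpos (by nlinarith)

theorem closedBall_I_subset :
    Metric.closedBall Complex.I (1 / 2) ⊆ {z : ℂ | 0 < z.im} := by
  intro z hz
  rw [Metric.mem_closedBall, dist_eq_norm] at hz
  have := (abs_le.1 ((Complex.abs_im_le_norm _).trans hz)).1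
  simp only [Complex.sub_im, Complex.I_im] at this
  simp only [Set.mem_ofPred_eq]
  linarith

theorem integral_radialBump_pos : 0 < ∫ z, radialBump z := by
  refine Continuous.integral_pos_of_hasCompactSupport_nonneg_nonzero
    contDiff_radialBump.continuous ?_ (fun z ↦ Real.smoothTransition.nonneg _) (x := Complex.I) ?_
  · exact (isCompact_closedBall _ _).of_isClosed_subset (isClosed_tsupport _)
      tsupport_radialBump_subset
  · simp [radialBump]

/-- The weight is constant on circles about `i`, so the mean value property applies on each of them.
The radial constant is left unevaluated; `integral_radialBump_mul` identifies it by taking `φ = 1`.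
-/
theorem integral_radialBump_mul_eq_polar {φ : ℂ → ℂ}
    (hφ : DifferentiableOn ℂ φ {z : ℂ | 0 < z.im}) :
    ∫ z, (radialBump z : ℂ) * φ z =
      (∫ r in Set.Ioi (0 : ℝ), (r * radialBump (Complex.I + r) * (2 * Real.pi) : ℂ)) *
        φ Complex.I := by
  have hrad (r θ : ℝ) (hr : 0 < r) : radialBump (circleMap Complex.I r θ) =
      radialBump (Complex.I + r) := by
    simp [radialBump, circleMap, abs_of_pos hr]
  have hcont : Continuous (fun z ↦ (radialBump z : ℂ) * φ z) := by
    refine continuous_mul_of_tsupport_subset isOpen_upperHalfPlaneSet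
      (Complex.continuous_ofReal.comp contDiff_radialBump.continuous) ?_ hφ.continuousOn
    refine (closure_mono ?_).trans (tsupport_radialBump_subset.trans closedBall_I_subset)
    intro z hz h
    exact hz (by simp [h])
  rw [← integral_add_left_eq_self (μ := volume) _ Complex.I, ← Complex.integral_comp_polarCoord_symm]
  have e1 (p : ℝ × ℝ) : Complex.I + Complex.polarCoord.symm p = circleMap Complex.I p.1 p.2 := by
    rw [Complex.polarCoord_symm_apply, circleMap, Complex.exp_mul_I, Complex.ofReal_cos, Complex.ofReal_sin]
  simp_rw [e1]
  have hcirc : Continuous fun p : ℝ × ℝ ↦ circleMap Complex.I p.1 p.2 := by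
    unfold circleMap; fun_prop
  rw [polarCoord_target, Measure.volume_eq_prod, setIntegral_prod]
  · rw [← integral_mul_const]
    refine setIntegral_congr_fun measurableSet_Ioi fun r hr ↦ ?_
    simp only [Set.mem_Ioi] at hr
    simp_rw [hrad r _ hr]
    rw [integral_smul, integral_const_mul]
    -- For `r ≤ 1/2` the closed disc stays in the upper half-plane; for larger `r` the weight
    -- vanishes.
    rcases le_or_gt r (1 / 2) with h | h
    · have hd : DiffContOnCl ℂ φ (Metric.ball Complex.I |r|) := by
        refine DifferentiableOn.diffContOnCl (hφ.mono ?_)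
        rw [abs_of_pos hr, closure_ball _ hr.ne']
        exact (Metric.closedBall_subset_closedBall h).trans closedBall_I_subset
      have hm := hd.circleAverage
      rw [Real.circleAverage_def] at hm
      -- Polar coordinates use angles in `(-π, π)`, circle averages use `(0, 2π)`; periodicity
      -- reconciles them.
      have hp : Function.Periodic (fun θ ↦ φ (circleMap Complex.I r θ)) (2 * Real.pi) := fun θ ↦ by
        simp only [(periodic_circleMap Complex.I r) θ]
      have h2 := hp.intervalIntegral_add_eq (-Real.pi) 0
      rw [zero_add, show -Real.pi + 2 * Real.pi = Real.pi by ring] at h2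
      rw [← integral_Ioc_eq_integral_Ioo,
        ← intervalIntegral.integral_of_le (by linarith [Real.pi_pos]), h2, ← hm]
      simp only [Complex.real_smul]
      push_cast
      have : (Real.pi : ℂ) ≠ 0 := by exact_mod_cast Real.pi_ne_zero
      field_simp
    · rw [radialBump_eq_zero (by simpa [abs_of_pos hr] using h)]
      simp
  · have h1 : IntegrableOn (fun p : ℝ × ℝ ↦ p.1 • ((radialBump (circleMap Complex.I p.1 p.2) : ℂ) *
        φ (circleMap Complex.I p.1 p.2))) (Set.Icc 0 (1 / 2) ×ˢ Set.Icc (-Real.pi) Real.pi)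
        (volume.prod volume) := by
      refine ContinuousOn.integrableOn_compact (isCompact_Icc.prod isCompact_Icc) ?_
      exact (continuous_fst.smul (hcont.comp hcirc)).continuousOn
    refine IntegrableOn.of_forall_sdiff_eq_zero h1 (measurableSet_Ioi.prod measurableSet_Ioo) ?_
    rintro ⟨r, θ⟩ ⟨⟨hr, hθ⟩, hp⟩
    simp only [Set.mem_Ioi] at hr
    have hr2 : 1 / 2 < r := by
      by_contra h
      exact hp ⟨⟨hr.le, not_lt.1 h⟩, Set.Ioo_subset_Icc_self hθ⟩
    simp only
    rw [hrad r θ hr, radialBump_eq_zero (by simpa [abs_of_pos hr] using hr2)]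
    simp

theorem integral_radialBump_mul {φ : ℂ → ℂ} (hφ : DifferentiableOn ℂ φ {z : ℂ | 0 < z.im}) :
    ∫ z, (radialBump z : ℂ) * φ z = (∫ z, radialBump z : ℝ) * φ Complex.I := by
  have h := integral_radialBump_mul_eq_polar (φ := fun _ ↦ 1) (differentiableOn_const _)
  simp only [mul_one] at h
  rw [integral_radialBump_mul_eq_polar hφ, ← h, integral_complex_ofReal]

open scoped ModularForm Manifold

/-! ### Forms of weight two -/

/-- In the variable `q = e^{2πiz}`, a power of `y` is a power of `log (1/|q|)`, hence `o(1/q)`. The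
singularity at `q = 0` is removable, so `φ` has a limit at the cusp. -/
theorem isBoundedAtImInfty_of_isBigO_rpow {φ : ℍ → ℂ} (hol : MDiff φ)
    (hper : ∀ z : ℍ, φ (ModularGroup.T • z) = φ z) {β : ℝ}
    (hO : φ =O[atImInfty] fun z ↦ z.im ^ β) : IsBoundedAtImInfty φ := by
  set P : ℂ → ℂ := φ ∘ ofComplex with hP
  have hPper : Function.Periodic P ((1 : ℝ) : ℂ) := by
    intro z
    by_cases hz : 0 < z.im
    · have hz1 : 0 < (z + (1 : ℝ)).im := by simpa using hz
      simp only [hP, Function.comp_apply]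
      rw [ofComplex_apply_of_im_pos hz, ofComplex_apply_of_im_pos hz1, ← hper ⟨z, hz⟩]
      congr 1
      rw [modular_T_smul]
      ext
      simp [add_comm]
    · have hz1 : (z + (1 : ℝ)).im ≤ 0 := by simpa using hz
      simp only [hP, Function.comp_apply]
      rw [ofComplex_apply_eq_of_im_nonpos hz1 (not_lt.1 hz)]
  have hPhol : ∀ᶠ z in comap Complex.im atTop, DifferentiableAt ℂ P z := by
    have : ∀ᶠ z in comap Complex.im atTop, 0 < z.im := tendsto_comap.eventually (eventually_gt_atTop 0)
    filter_upwards [this] with z hz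
    exact (UpperHalfPlane.mdifferentiable_iff.1 hol).differentiableAt (isOpen_upperHalfPlaneSet.mem_nhds hz)
  have hPo : P =o[comap Complex.im atTop] fun z ↦ (Function.Periodic.qParam 1 z)⁻¹ := by
    have h1 : P =O[comap Complex.im atTop] fun z ↦ z.im ^ β := by
      refine (hO.comp_tendsto tendsto_comap_im_ofComplex).congr' (EventuallyEq.refl _ _) ?_
      filter_upwards [tendsto_comap.eventually (eventually_gt_atTop (0 : ℝ))] with z hz
      simp [ofComplex_apply_of_im_pos hz, ← UpperHalfPlane.coe_im]
    have h2 := (isLittleO_rpow_exp_pos_mul_atTop β (b := 2 * Real.pi) (by positivity)).comp_tendsto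
      (tendsto_comap (f := Complex.im) (x := atTop))
    refine (h1.trans_isLittleO h2).trans_isBigO (isBigO_of_le _ fun z ↦ ?_)
    rw [norm_inv, Function.Periodic.norm_qParam, ← Real.exp_neg, Function.comp_apply,
      Real.norm_of_nonneg (Real.exp_pos _).le]
    apply le_of_eq
    congr 1
    ring
  set c := Function.Periodic.cuspFunction 1 P with hc
  have hco : c =o[𝓝[≠] 0] fun q ↦ q⁻¹ := by
    refine (hPo.comp_tendsto (Function.Periodic.invQParam_tendsto one_pos)).congr' ?_ ?_
    · refine eventually_nhdsWithin_of_forall fun q hq ↦ ?_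
      rw [hc, Function.Periodic.cuspFunction_eq_of_nonzero _ _ hq, Function.comp_def]
    · refine eventually_nhdsWithin_of_forall fun q hq ↦ ?_
      simp only [Function.comp_apply]
      rw [Function.Periodic.qParam_right_inv one_ne_zero hq]
  have hlim := Complex.tendsto_limUnder_of_differentiable_on_punctured_nhds_of_isLittleO (f := c)
    (c := 0) (Function.Periodic.eventually_differentiableAt_cuspFunction_nhds_ne_zero one_pos
      hPper hPhol) (by
        simp only [sub_zero]
        refine hco.sub ?_
        refine isLittleO_const_left.2 (Or.inr ?_)
        exact tendsto_norm_atTop_iff_cobounded.2 tendsto_inv₀_nhdsNE_zero)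
  have hPlim := (hlim.comp (Function.Periodic.qParam_tendsto one_pos)).comp tendsto_coe_atImInfty
  have heq : (c ∘ Function.Periodic.qParam 1) ∘ ((↑) : ℍ → ℂ) = φ := by
    funext z
    simp only [Function.comp_apply, hc]
    rw [Function.Periodic.eq_cuspFunction one_ne_zero hPper]
    simp [hP]
  rw [heq] at hPlim
  exact hPlim.isBigO_one ℝ

/-- Polynomial growth already makes `φ` a modular form of weight 2 and level one, and that space is
zero. -/
theorem eq_zero_of_slash_two {φ : ℍ → ℂ} (hol : MDiff φ) (hinv : ∀ γ : SL(2, ℤ), φ ∣[(2 : ℤ)] γ = φ)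
    {β : ℝ} (hO : φ =O[atImInfty] fun z ↦ z.im ^ β) : φ = 0 := by
  have hbdd : IsBoundedAtImInfty φ := by
    refine isBoundedAtImInfty_of_isBigO_rpow hol (fun z ↦ ?_) hO
    have := congr_fun (hinv ModularGroup.T) z
    rw [ModularForm.SL_slash_apply, ModularGroup.denom_apply] at this
    simpa [ModularGroup.coe_T] using this
  let f : ModularForm 𝒮ℒ 2 :=
    { toFun := φ
      slash_action_eq' := by
        rintro _ ⟨γ, rfl⟩
        exact hinv γ
      holo' := hol
      bdd_at_cusps' := by
        intro c hc
        rw [OnePoint.isBoundedAt_iff_forall_SL2Z hc]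
        intro γ _
        rw [hinv]
        exact hbdd }
  have := rank_zero_iff_forall_zero.1 ModularForm.levelOne_weight_two_rank_zero f
  have h2 : (f : ℍ → ℂ) = 0 := by rw [this]; rfl
  exact h2

/-! ### The holomorphic gradient of a harmonic function -/

/-- The function `u_x - i u_y`. -/
def complexGrad (u : ℂ → ℝ) (z : ℂ) : ℂ := fderiv ℝ u z 1 - Complex.I * fderiv ℝ u z Complex.I

theorem complexGrad_congr {u v : ℂ → ℝ} {z : ℂ} (h : u =ᶠ[𝓝 z] v) :
    complexGrad u z = complexGrad v z := by
  rw [complexGrad, h.fderiv_eq, complexGrad]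

/-- Up to a factor 2, `complexGrad` is `∂/∂z`; for holomorphic `G` the chain rule for `∂/∂z` has a
single term. -/
theorem complexGrad_comp {u : ℂ → ℝ} {G : ℂ → ℂ} {z : ℂ} (hu : DifferentiableAt ℝ u (G z))
    (hG : DifferentiableAt ℂ G z) :
    complexGrad (u ∘ G) z = deriv G z * complexGrad u (G z) := by
  have h := hu.hasFDerivAt.comp z (hG.hasDerivAt.hasFDerivAt.restrictScalars ℝ)
  rw [complexGrad, complexGrad, h.fderiv]
  set a := deriv G z
  have h1 : a = a.re • (1 : ℂ) + a.im • Complex.I := by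
    apply Complex.ext <;> simp
  have h2 : Complex.I * a = (-a.im) • (1 : ℂ) + a.re • Complex.I := by
    apply Complex.ext <;> simp
  simp only [ContinuousLinearMap.comp_apply, ContinuousLinearMap.coe_restrictScalars',
    ContinuousLinearMap.toSpanSingleton_apply, smul_eq_mul, one_mul]
  rw [h2]
  nth_rw 1 [h1]
  simp only [map_add, map_smul, smul_eq_mul]
  push_cast
  nth_rw 5 [← Complex.re_add_im a]
  linear_combination (fderiv ℝ u (G z) Complex.I * a.im : ℂ) * Complex.I_sq

/-- The real part of a function on the upper half-plane, as a function of a complex variable. -/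
def realPart (g : ℍ → ℂ) (z : ℂ) : ℝ := (g (ofComplex z)).re

theorem IsSmooth.contDiffAt_realPart {g : ℍ → ℂ} (hg : IsSmooth g) {z : ℂ} (hz : 0 < z.im) :
    ContDiffAt ℝ ∞ (realPart g) z :=
  Complex.reCLM.contDiff.contDiffAt.comp z (hg.contDiffAt ⟨z, hz⟩)

theorem IsSmooth.harmonicAt_realPart {g : ℍ → ℂ} (hg : IsSmooth g) (h0 : PolyharmonicMaass.hypLaplacian g = 0)
    {z : ℂ} (hz : 0 < z.im) : InnerProductSpace.HarmonicAt (realPart g) z := by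
  have h : InnerProductSpace.HarmonicAt (g ∘ ofComplex) z := by
    refine ⟨(hg.contDiffAt ⟨z, hz⟩).of_le (WithTop.coe_le_coe.2 le_top), ?_⟩
    filter_upwards [eventually_im_pos ⟨z, hz⟩] with w hw
    have := congr_fun h0 ⟨w, hw⟩
    simp only [PolyharmonicMaass.hypLaplacian, Pi.zero_apply, mul_eq_zero] at this
    refine this.resolve_left (pow_ne_zero 2 ?_)
    exact_mod_cast hw.ne'
  exact h.comp_CLM Complex.reCLM

theorem differentiableOn_complexGrad_realPart {g : ℍ → ℂ} (hg : IsSmooth g)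
    (h0 : hypLaplacian g = 0) :
    DifferentiableOn ℂ (complexGrad (realPart g)) {z : ℂ | 0 < z.im} := fun _ hz ↦
  (HarmonicAt.differentiableAt_complex_partial
    (hg.harmonicAt_realPart h0 hz)).differentiableWithinAt

/-- Interior gradient estimate for polyharmonic functions. -/
theorem exists_norm_complexGrad_le (k : ℕ) :
    ∃ C : ℝ, 0 ≤ C ∧ ∀ (h : ℍ → ℂ) (M : ℝ), IsSmooth h → hypLaplacian^[k + 1] h = 0 →
      (∀ z : ℍ, (z : ℂ) ∈ Metric.closedBall Complex.I (1 / 2) → ‖h z‖ ≤ M) →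
      ‖complexGrad (realPart (hypLaplacian^[k] h)) Complex.I‖ ≤ C * M := by
  set χ : ℂ → ℂ := fun z ↦ (radialBump z : ℂ) with hχ
  have hχ1 : ContDiff ℝ ∞ χ := Complex.ofRealCLM.contDiff.comp contDiff_radialBump
  have hχs : tsupport χ ⊆ Metric.closedBall Complex.I (1 / 2) := by
    refine (closure_mono ?_).trans tsupport_radialBump_subset
    intro z hz h
    exact hz (by simp [hχ, h])
  have hχc : HasCompactSupport χ :=
    (isCompact_closedBall _ _).of_isClosed_subset (isClosed_tsupport _) hχs
  have hχ2 (v : ℂ) : ContDiff ℝ ∞ (fun z ↦ fderiv ℝ χ z v) :=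
    (hχ1.fderiv_right (m := ∞) (by simp)).clm_apply contDiff_const
  have hχr (v z : ℂ) : fderiv ℝ χ z v = (fderiv ℝ radialBump z v : ℝ) := by
    have := (Complex.ofRealCLM.hasFDerivAt (x := radialBump z)).comp z
      (contDiff_radialBump.differentiable (by simp) z).hasFDerivAt
    have h2 : fderiv ℝ χ z = _ := this.fderiv
    rw [h2]
    simp
  -- The test functions are the partial derivatives of the bump: they receive the derivative in the
  -- gradient, and then the `k` Laplacians as well.
  have key (v : ℂ) := exists_norm_integral_mul_iterate_hypLaplacian_le k _
    (isCompact_closedBall _ _) closedBall_I_subset (hχ2 v)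
    ((tsupport_fderiv_apply_subset χ v).trans hχs)
  obtain ⟨C₁, hC₁, h₁⟩ := key 1
  obtain ⟨C₂, hC₂, h₂⟩ := key Complex.I
  set c := ∫ z, radialBump z with hc
  have hc0 : 0 < c := integral_radialBump_pos
  refine ⟨(C₁ + C₂) / c, by positivity, fun h M hh h0 hM ↦ ?_⟩
  specialize h₁ h M hh hM
  specialize h₂ h M hh hM
  set g := hypLaplacian^[k] h with hg
  have hgs : IsSmooth g := hh.iterate_hypLaplacian k
  rw [Function.iterate_succ_apply'] at h0
  have hUo : IsOpen {z : ℂ | 0 < z.im} := isOpen_upperHalfPlaneSet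
  set U : ℂ → ℂ := fun z ↦ (realPart g z : ℂ) with hU
  have hU1 : ContDiffOn ℝ ∞ U {z : ℂ | 0 < z.im} := fun z hz ↦
    (Complex.ofRealCLM.contDiff.contDiffAt.comp z (hgs.contDiffAt_realPart hz)).contDiffWithinAt
  have hUr (v : ℂ) {z : ℂ} (hz : 0 < z.im) : fderiv ℝ U z v = (fderiv ℝ (realPart g) z v : ℝ) := by
    have := (Complex.ofRealCLM.hasFDerivAt (x := realPart g z)).comp z
      ((hgs.contDiffAt_realPart hz).differentiableAt (by simp)).hasFDerivAt
    have h2 : fderiv ℝ U z = _ := this.fderiv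
    rw [h2]
    simp
  have one_le : (1 : WithTop ℕ∞) ≤ ∞ := WithTop.coe_le_coe.2 le_top
  have ibp (v : ℂ) := integral_mul_fderiv_of_tsupport_subset hUo (hχ1.of_le one_le) hχc
    (hχs.trans closedBall_I_subset) (hU1.of_le one_le) v
  have hInt (v : ℂ) : Integrable fun z ↦ χ z * fderiv ℝ U z v :=
    integrable_mul_of_tsupport_subset hUo hχ1.continuous hχc (hχs.trans closedBall_I_subset)
      ((hU1.continuousOn_fderiv_of_isOpen hUo one_le).clm_apply continuousOn_const)
  -- The derivatives of the bump are real, so pairing them with `Re g` gives the real part of the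
  -- pairing with `g`.
  have hbound (v : ℂ) : ‖∫ z, fderiv ℝ χ z v * U z‖ ≤
      ‖∫ z, fderiv ℝ χ z v * g (ofComplex z)‖ := by
    have hi : Integrable fun z ↦ fderiv ℝ χ z v * g (ofComplex z) :=
      integrable_mul_of_tsupport_subset hUo (hχ2 v).continuous
        (hχc.mono' (subset_closure.trans (tsupport_fderiv_apply_subset χ v)))
        ((tsupport_fderiv_apply_subset χ v).trans (hχs.trans closedBall_I_subset))
        (ContDiffOn.continuousOn hgs)
    have e : ∫ z, fderiv ℝ χ z v * U z =
        ((∫ z, fderiv ℝ χ z v * g (ofComplex z)).re : ℂ) := by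
      rw [← Complex.reCLM_apply, ← ContinuousLinearMap.integral_comp_comm _ hi,
        ← integral_complex_ofReal]
      refine integral_congr_ae (ae_of_all _ fun z ↦ ?_)
      simp [hχr, hU, realPart]
    rw [e, Complex.norm_real]
    exact Complex.abs_re_le_norm _
  -- The gradient is holomorphic, so its value at `i` is a weighted mean. Integrating by parts in
  -- this mean leaves only integrals controlled by `h₁` and `h₂`.
  have hmv := integral_radialBump_mul (differentiableOn_complexGrad_realPart hgs h0)
  have e2 (z : ℂ) : (radialBump z : ℂ) * complexGrad (realPart g) z =
      χ z * fderiv ℝ U z 1 - Complex.I * (χ z * fderiv ℝ U z Complex.I) := by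
    by_cases hz : 0 < z.im
    · rw [hUr _ hz, hUr _ hz, complexGrad]
      ring
    · have : radialBump z = 0 := by
        by_contra h
        exact hz (closedBall_I_subset (tsupport_radialBump_subset (subset_closure h)))
      simp [hχ, this]
  simp_rw [e2] at hmv
  rw [integral_sub (hInt 1) ((hInt Complex.I).const_mul _), integral_const_mul, ibp, ibp] at hmv
  rw [div_mul_eq_mul_div, le_div_iff₀ hc0]
  have e3 : ‖complexGrad (realPart g) Complex.I‖ * c =
      ‖((∫ z, radialBump z : ℝ) : ℂ) * complexGrad (realPart g) Complex.I‖ := by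
    rw [norm_mul, Complex.norm_real, Real.norm_of_nonneg hc0.le, mul_comm]
  rw [e3, ← hmv, add_mul]
  refine (norm_sub_le _ _).trans (add_le_add ?_ ?_)
  · rw [norm_neg]
    exact (hbound 1).trans h₁
  · rw [norm_mul, norm_neg, Complex.norm_I, one_mul]
    exact (hbound Complex.I).trans h₂

/-! ### Growth and modularity of the gradient. -/

theorem complexGrad_realPart_comp {τ : ℍ → ℍ} {G : ℂ → ℂ} (h : IsHolomorphicIsometry τ G)
    {g : ℍ → ℂ} (hg : IsSmooth g) (z : ℍ) :
    complexGrad (realPart (g ∘ τ)) z = deriv G z * complexGrad (realPart g) (τ z) := by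
  have e : realPart (g ∘ τ) =ᶠ[𝓝 (z : ℂ)] realPart g ∘ G := by
    filter_upwards [h.comp_ofComplex_eventuallyEq g z] with w hw
    simp only [realPart, Function.comp_apply] at hw ⊢
    rw [hw]
  rw [complexGrad_congr e, h.coe_eq, complexGrad_comp _ (h.analyticAt z).differentiableAt]
  rw [← h.coe_eq]
  exact (hg.contDiffAt_realPart (τ z).im_pos).differentiableAt (by simp)

/-- The interior estimate is applied to `f ∘ affineMap w`: its gradient at `i` is `Im w` times the
gradient at `w`, and the ball about `i` is carried to heights comparable with `Im w`. -/
theorem isBigO_complexGrad {f : ℍ → ℂ} (hf : IsSmooth f) (hgr : ModerateGrowth f) (k : ℕ)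
    (h0 : hypLaplacian^[k + 1] f = 0) :
    ∃ β : ℝ, (fun z : ℍ ↦ complexGrad (realPart (hypLaplacian^[k] f)) z) =O[atImInfty]
      fun z ↦ z.im ^ β := by
  obtain ⟨α, hα⟩ := hgr
  obtain ⟨D, hD0, hD⟩ := hα.exists_nonneg
  rw [isBigOWith_iff] at hD
  obtain ⟨A, hA⟩ := (atImInfty_mem _).1 hD
  obtain ⟨C, hC0, hC⟩ := exists_norm_complexGrad_le k
  -- On the ball `1/2 ≤ Im z ≤ 3/2`, hence `(Im z)^α ≤ 2^|α|` whatever the sign of `α`.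
  refine ⟨α, IsBigO.of_bound (C * (D * 2 ^ |α|)) ?_⟩
  -- The bound `2 * A` keeps the image of the ball above height `A`; the bound `1` allows the factor
  -- `Im w` to be dropped at the end.
  refine (atImInfty_mem _).2 ⟨max 1 (2 * A), fun w hw ↦ ?_⟩
  have hw1 : 1 ≤ w.im := (le_max_left _ _).trans hw
  have hw2 : 2 * A ≤ w.im := (le_max_right _ _).trans hw
  have hiso := isHolomorphicIsometry_affineMap w
  have hb := hC (f ∘ affineMap w) (D * 2 ^ |α| * w.im ^ α) (hiso.isSmooth_comp hf) (by
      rw [hiso.iterate_hypLaplacian_comp hf, h0]; rfl) (fun z hz ↦ by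
    have hz1 : ‖(z : ℂ) - Complex.I‖ ≤ 1 / 2 := by simpa [dist_eq_norm] using hz
    have hz2 := abs_le.1 ((Complex.abs_im_le_norm _).trans hz1)
    simp only [Complex.sub_im, Complex.I_im, UpperHalfPlane.coe_im] at hz2
    have him : (affineMap w z).im = w.im * z.im := by
      rw [← UpperHalfPlane.coe_im, coe_affineMap]
      simp
    have h1 : A ≤ (affineMap w z).im := by
      rw [him]
      nlinarith [w.im_pos]
    refine (hA _ h1).trans ?_
    rw [Real.norm_of_nonneg (Real.rpow_nonneg (affineMap w z).im_pos.le _), him, mul_assoc,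
      Real.mul_rpow w.im_pos.le z.im_pos.le, mul_comm (w.im ^ α)]
    refine mul_le_mul_of_nonneg_left (mul_le_mul_of_nonneg_right ?_
      (Real.rpow_nonneg w.im_pos.le _)) hD0
    rcases le_or_gt 0 α with ha | ha
    · rw [abs_of_nonneg ha]
      exact Real.rpow_le_rpow z.im_pos.le (by linarith) ha
    · rw [abs_of_neg ha, Real.rpow_neg (by norm_num), ← Real.inv_rpow (by norm_num)]
      exact Real.rpow_le_rpow_of_nonpos (by norm_num) (by linarith) ha.le)
  rw [hiso.iterate_hypLaplacian_comp hf] at hb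
  have e := complexGrad_realPart_comp hiso (hf.iterate_hypLaplacian k) UpperHalfPlane.I
  have hI : affineMap w UpperHalfPlane.I = w := by
    ext
    rw [coe_affineMap, UpperHalfPlane.coe_I]
    exact Complex.re_add_im (w : ℂ)
  have hd : deriv (fun z : ℂ ↦ (w.re + w.im * z : ℂ)) UpperHalfPlane.I = w.im := by simp
  rw [hI, hd, UpperHalfPlane.coe_I] at e
  rw [e, norm_mul, Complex.norm_real, Real.norm_of_nonneg w.im_pos.le] at hb
  change ‖_‖ ≤ _ * ‖_‖
  rw [Real.norm_of_nonneg (Real.rpow_nonneg w.im_pos.le _)]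
  calc _ ≤ w.im * ‖complexGrad (realPart (hypLaplacian^[k] f)) w‖ :=
        le_mul_of_one_le_left (norm_nonneg _) hw1
    _ ≤ _ := by rw [mul_assoc]; exact hb

/-- The derivative of a Möbius map is `(cz+d)^{-2}`, so the gradient of an invariant function has
weight 2. Invariance passes from `f` to `Δ₀^k f` because the action is by isometries. -/
theorem complexGrad_eq_zero {f : ℍ → ℂ} (hf : f ∈ automorphicFunctions) (k : ℕ)
    (h0 : hypLaplacian^[k + 1] f = 0) (z : ℍ) :
    complexGrad (realPart (hypLaplacian^[k] f)) z = 0 := by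
  obtain ⟨hs, hinv, hgr⟩ := hf
  obtain ⟨β, hβ⟩ := isBigO_complexGrad hs hgr k h0
  have hgs := hs.iterate_hypLaplacian k
  have h0' : hypLaplacian (hypLaplacian^[k] f) = 0 := by
    rwa [Function.iterate_succ_apply'] at h0
  refine congr_fun (eq_zero_of_slash_two (φ := fun z : ℍ ↦
    complexGrad (realPart (hypLaplacian^[k] f)) z) ?_ ?_ hβ) z
  · rw [UpperHalfPlane.mdifferentiable_iff]
    refine (differentiableOn_complexGrad_realPart hgs h0').congr fun z hz ↦ ?_
    simp [ofComplex_apply_of_im_pos hz]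
  · intro γ
    funext w
    have hiso := isHolomorphicIsometry_smul γ
    have e := complexGrad_realPart_comp hiso hgs w
    rw [← hiso.iterate_hypLaplacian_comp hs,
      show f ∘ (fun z ↦ γ • z) = f from funext (hinv γ)] at e
    rw [ModularForm.SL_slash_apply, e, (hasDerivAt_moebius γ w.im_pos).deriv,
      ModularGroup.denom_apply]
    rw [zpow_neg, mul_comm, one_div]
    rfl

/-- The top nonvanishing Laplacian of a polyharmonic automorphic function is constant. -/
theorem exists_iterate_hypLaplacian_eq_const {f : ℍ → ℂ} (hf : f ∈ automorphicFunctions) (k : ℕ)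
    (h0 : hypLaplacian^[k + 1] f = 0) : ∃ c : ℂ, hypLaplacian^[k] f = fun _ ↦ c := by
  have hgs := hf.1.iterate_hypLaplacian k
  set g := hypLaplacian^[k] f with hg
  -- The real part of `-i g` is the imaginary part of `g`, so the vanishing result also covers the
  -- latter.
  have hIf : -Complex.I • f ∈ automorphicFunctions := Submodule.smul_mem _ _ hf
  have hIg : hypLaplacian^[k] (-Complex.I • f) = -Complex.I • g :=
    iterate_hypLaplacian_smul k _ hf.1
  have hI0 : hypLaplacian^[k + 1] (-Complex.I • f) = 0 := by
    rw [iterate_hypLaplacian_smul _ _ hf.1, h0, smul_zero]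
  have hfd (u : ℂ → ℝ) (z : ℂ) (hu : complexGrad u z = 0) : fderiv ℝ u z = 0 := by
    have h1 := congr_arg Complex.re hu
    have h2 := congr_arg Complex.im hu
    simp only [complexGrad, Complex.sub_re, Complex.sub_im, Complex.mul_re, Complex.mul_im,
      Complex.ofReal_re, Complex.ofReal_im, Complex.I_re, Complex.I_im, Complex.zero_re,
      Complex.zero_im, zero_mul, one_mul, mul_zero, sub_zero, zero_add, zero_sub,
      neg_eq_zero] at h1 h2
    ext v
    have hv : v = v.re • (1 : ℂ) + v.im • Complex.I := by apply Complex.ext <;> simp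
    rw [hv, map_add, map_smul, map_smul, h1, h2]
    simp
  have hder (z : ℂ) (hz : 0 < z.im) : fderiv ℝ (g ∘ ofComplex) z = 0 := by
    have h1 := hfd _ _ (complexGrad_eq_zero hf k h0 ⟨z, hz⟩)
    have h2 := hfd _ _ (complexGrad_eq_zero hIf k hI0 ⟨z, hz⟩)
    rw [hIg] at h2
    have hd := ((hgs.contDiffAt ⟨z, hz⟩).differentiableAt (by simp)).hasFDerivAt
    have e1 : fderiv ℝ (realPart g) z = Complex.reCLM.comp (fderiv ℝ (g ∘ ofComplex) z) := (Complex.reCLM.hasFDerivAt.comp z hd).fderiv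
    have e2 : fderiv ℝ (realPart (-Complex.I • g)) z =
        Complex.imCLM.comp (fderiv ℝ (g ∘ ofComplex) z) := by
      have e3 : realPart (-Complex.I • g) = Complex.imCLM ∘ (g ∘ ofComplex) := by
        funext w
        simp [realPart]
      rw [e3]
      exact (Complex.imCLM.hasFDerivAt.comp z hd).fderiv
    simp only at h1 h2
    rw [e1] at h1
    rw [e2] at h2
    ext v
    have h1 := congr_arg (fun L ↦ L v) h1
    have h2 := congr_arg (fun L ↦ L v) h2
    apply Complex.ext
    · simpa using h1
    · simpa using h2
  have hconv : Convex ℝ {z : ℂ | 0 < z.im} := convex_halfSpace_im_gt 0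
  refine ⟨g UpperHalfPlane.I, funext fun z ↦ ?_⟩
  have := hconv.is_const_of_fderivWithin_eq_zero (𝕜 := ℝ) (f := g ∘ ofComplex)
    (ContDiffOn.differentiableOn hgs (by simp)) (fun w hw ↦ by
      rw [fderivWithin_of_isOpen isOpen_upperHalfPlaneSet hw, hder w hw]) z.im_pos
      UpperHalfPlane.I.im_pos
  simpa only [Function.comp_apply, ofComplex_apply] using this

/-! ### The quadratic form `|mz+n|² / y` -/

/-- The nonzero integral vectors. -/
abbrev Lattice : Type := {p : ℤ × ℤ // p ≠ 0}

/-- The quadratic form `|mz+n|² / y` attached to `z = x + iy`. -/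
def quad (z : ℂ) (p : ℤ × ℤ) : ℝ := Complex.normSq (p.1 * z + p.2) / z.im

theorem linear_ne_zero_of_im_pos {z : ℂ} (hz : 0 < z.im) {p : ℤ × ℤ} (hp : p ≠ 0) :
    (p.1 * z + p.2 : ℂ) ≠ 0 := by
  intro h
  have h1 := congr_arg Complex.im h
  have h2 := congr_arg Complex.re h
  simp only [Complex.add_im, Complex.mul_im, Complex.intCast_re, Complex.intCast_im, zero_mul,
    add_zero, Complex.zero_im, mul_eq_zero, Int.cast_eq_zero, hz.ne', or_false] at h1
  simp only [h1, Int.cast_zero, zero_mul, zero_add, Complex.intCast_re, Complex.zero_re,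
    Int.cast_eq_zero] at h2
  exact hp (Prod.ext h1 h2)

theorem quad_pos {z : ℂ} (hz : 0 < z.im) {p : ℤ × ℤ} (hp : p ≠ 0) : 0 < quad z p :=
  div_pos (Complex.normSq_pos.2 (linear_ne_zero_of_im_pos hz hp)) hz

theorem quad_nonneg {z : ℂ} (hz : 0 < z.im) (p : ℤ × ℤ) : 0 ≤ quad z p :=
  div_nonneg (Complex.normSq_nonneg _) hz.le

theorem quad_zero (z : ℂ) : quad z 0 = 0 := by simp [quad]

/-- On the strip, `|mz+n|` is at least `r` times `max (|m|, |n|)`, and the norm on `ℤ × ℤ` is this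
maximum. -/
theorem quad_ge_of_mem_verticalStrip {A B : ℝ} (hB : 0 < B) {z : ℍ} (hz : z ∈ verticalStrip A B)
    {p : ℤ × ℤ} (hp : p ≠ 0) :
    EisensteinSeries.r ⟨⟨A, B⟩, hB⟩ ^ 2 * ‖p‖ ^ 2 / z.im ≤ quad z p := by
  have hx : ![p.1, p.2] ≠ 0 := by
    intro h
    exact hp (Prod.ext (congr_fun h 0) (congr_fun h 1))
  have h1 := EisensteinSeries.r_mul_max_le z hx
  have h2 := EisensteinSeries.r_lower_bound_on_verticalStrip z hB hz
  have h3 : ‖![p.1, p.2]‖ = ‖p‖ := by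
    rw [EisensteinSeries.norm_eq_max_natAbs, Prod.norm_def, Int.norm_eq_abs, Int.norm_eq_abs]
    simp
  rw [h3] at h1
  have h4 : EisensteinSeries.r ⟨⟨A, B⟩, hB⟩ * ‖p‖ ≤ ‖(p.1 * z + p.2 : ℂ)‖ :=
    (mul_le_mul_of_nonneg_right h2 (norm_nonneg _)).trans (by simpa using h1)
  rw [quad, ← Complex.sq_norm, ← mul_pow]
  exact div_le_div_of_nonneg_right
    (pow_le_pow_left₀ (mul_nonneg (EisensteinSeries.r_pos _).le (norm_nonneg _)) h4 2) z.im_pos.le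

theorem summable_norm_sq_rpow {k : ℝ} (hk : 1 < k) :
    Summable fun p : Lattice ↦ ((‖p.1‖ ^ 2) ^ k)⁻¹ := by
  have h1 := EisensteinSeries.summable_one_div_norm_rpow (k := 2 * k) (by linarith)
  have h2 : Summable fun p : ℤ × ℤ ↦ ‖p‖ ^ (-(2 * k)) := by
    refine ((finTwoArrowEquiv ℤ).summable_iff).1 (h1.congr fun x ↦ ?_)
    have h3 : ‖x‖ = ‖(finTwoArrowEquiv ℤ) x‖ := by
      rw [EisensteinSeries.norm_eq_max_natAbs, Prod.norm_def, Int.norm_eq_abs, Int.norm_eq_abs]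
      simp
    rw [h3, Function.comp_apply]
  refine (h2.subtype {p : ℤ × ℤ | p ≠ 0}).congr fun p ↦ ?_
  rw [Function.comp_apply, Real.rpow_neg (norm_nonneg _), Real.rpow_mul (norm_nonneg _),
    Real.rpow_two]

/-- Near a point of the upper half-plane the quadratic forms are uniformly positive. -/
theorem exists_quad_ge {z₀ : ℂ} (hz₀ : 0 < z₀.im) :
    ∃ c > 0, ∀ z ∈ Metric.ball z₀ (z₀.im / 2), z₀.im / 2 < z.im ∧
      ∀ p : ℤ × ℤ, p ≠ 0 → c * ‖p‖ ^ 2 ≤ quad z p := by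
  have hB : 0 < z₀.im / 2 := by linarith
  set r₀ := EisensteinSeries.r ⟨⟨|z₀.re| + z₀.im / 2, z₀.im / 2⟩, hB⟩ with hr
  have hr0 : 0 < r₀ := EisensteinSeries.r_pos _
  refine ⟨r₀ ^ 2 / (2 * z₀.im), by positivity, fun z hz ↦ ?_⟩
  rw [Metric.mem_ball, dist_eq_norm] at hz
  have h1 := abs_lt.1 ((Complex.abs_im_le_norm _).trans_lt hz)
  have h2 := (Complex.abs_re_le_norm _).trans_lt hz
  simp only [Complex.sub_im, Complex.sub_re] at h1 h2
  have hz1 : z₀.im / 2 < z.im := by linarith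
  refine ⟨hz1, fun p hp ↦ ?_⟩
  have hz0 : 0 < z.im := by linarith
  have h3 : (⟨z, hz0⟩ : ℍ) ∈ verticalStrip (|z₀.re| + z₀.im / 2) (z₀.im / 2) := by
    rw [mem_verticalStrip_iff]
    refine ⟨?_, hz1.le⟩
    change |z.re| ≤ _
    have := abs_sub_abs_le_abs_sub z.re z₀.re
    linarith
  refine le_trans ?_ (quad_ge_of_mem_verticalStrip hB h3 hp)
  rw [div_mul_eq_mul_div]
  refine div_le_div_of_nonneg_left (by positivity) hz0 ?_
  change z.im ≤ _
  linarith

theorem rpow_inv_le_of_ge {c : ℝ} (hc : 0 < c) {k q : ℝ} (hk : 1 < k) {p : ℤ × ℤ} (hp : p ≠ 0)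
    (h : c * ‖p‖ ^ 2 ≤ q) : (q ^ k)⁻¹ ≤ (c ^ k)⁻¹ * ((‖p‖ ^ 2) ^ k)⁻¹ := by
  have hp' : 0 < ‖p‖ ^ 2 := by positivity
  rw [← mul_inv, ← Real.mul_rpow hc.le hp'.le]
  exact inv_anti₀ (by positivity) (Real.rpow_le_rpow (by positivity) h (by linarith))

theorem summable_quad_rpow {z : ℂ} (hz : 0 < z.im) {k : ℝ} (hk : 1 < k) :
    Summable fun p : Lattice ↦ (quad z p ^ k)⁻¹ := by
  obtain ⟨c, hc, h⟩ := exists_quad_ge hz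
  refine Summable.of_nonneg_of_le (fun p ↦ ?_) (fun p ↦ rpow_inv_le_of_ge hc hk p.2
    ((h z (Metric.mem_ball_self (by linarith))).2 p p.2)) ((summable_norm_sq_rpow hk).mul_left _)
  exact inv_nonneg.2 (Real.rpow_nonneg (quad_nonneg hz _) _)

theorem summable_quad_pow {z : ℂ} (hz : 0 < z.im) {k : ℕ} (hk : 2 ≤ k) :
    Summable fun p : Lattice ↦ (quad z p ^ k)⁻¹ := by
  have : (1 : ℝ) < k := by exact_mod_cast hk
  simpa [Real.rpow_natCast] using summable_quad_rpow hz this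

/-! ### The theta series -/

theorem exp_neg_le {x : ℝ} (hx : 0 < x) (k : ℕ) : Real.exp (-x) ≤ k.factorial * (x ^ k)⁻¹ := by
  have h := Real.pow_div_factorial_le_exp x hx.le k
  rw [Real.exp_neg, inv_eq_one_div, div_le_iff₀ (Real.exp_pos x)]
  rw [div_le_iff₀ (by positivity)] at h
  calc (1 : ℝ) = (x ^ k)⁻¹ * x ^ k := by field_simp
    _ ≤ (x ^ k)⁻¹ * (Real.exp x * k.factorial) := by gcongr
    _ = _ := by ring

theorem summable_pow_mul_exp_lattice {z : ℂ} (hz : 0 < z.im) {t : ℝ} (ht : 0 < t) (k : ℕ) :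
    Summable fun p : Lattice ↦ quad z p ^ k * Real.exp (-(t * quad z p)) := by
  -- Trading the exponential for the power `k + 2` leaves `quad⁻²`, whose sum over the lattice
  -- converges.
  refine Summable.of_nonneg_of_le (fun p ↦ ?_) (fun p ↦ ?_)
    ((summable_quad_pow hz le_rfl).mul_left ((k + 2).factorial * (t ^ (k + 2))⁻¹))
  · exact mul_nonneg (pow_nonneg (quad_nonneg hz _) _) (Real.exp_pos _).le
  · have hq := quad_pos hz p.2
    refine (mul_le_mul_of_nonneg_left (exp_neg_le (mul_pos ht hq) (k + 2)) (by positivity)).trans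
      (le_of_eq ?_)
    field_simp
    ring

theorem summable_exp_lattice {z : ℂ} (hz : 0 < z.im) {t : ℝ} (ht : 0 < t) :
    Summable fun p : Lattice ↦ Real.exp (-(t * quad z p)) := by
  simpa using summable_pow_mul_exp_lattice hz ht 0

theorem summable_of_summable_lattice {f : ℤ × ℤ → ℝ} (h : Summable fun p : Lattice ↦ f p) :
    Summable f := by
  have h1 : Summable fun p : {p : ℤ × ℤ // p ∉ ({0} : Finset (ℤ × ℤ))} ↦ f p := by
    refine (Equiv.summable_iff (Equiv.subtypeEquivRight fun p ↦ ?_)).1 h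
    simp
  exact (Finset.summable_compl_iff {0}).1 h1

theorem tsum_eq_add_tsum_lattice {f : ℤ × ℤ → ℝ} (h : Summable f) :
    ∑' p, f p = f 0 + ∑' p : Lattice, f p := by
  rw [← h.sum_add_tsum_compl (s := {0})]
  simp only [Finset.sum_singleton]
  congr 1
  have hs : {p : ℤ × ℤ | p ≠ 0} = (((({0} : Finset (ℤ × ℤ))) : Set (ℤ × ℤ))ᶜ) := by
    ext p
    simp
  exact (tsum_congr_set_coe f hs).symm

theorem summable_exp_quad {z : ℂ} (hz : 0 < z.im) {t : ℝ} (ht : 0 < t) :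
    Summable fun p : ℤ × ℤ ↦ Real.exp (-(t * quad z p)) :=
  summable_of_summable_lattice (summable_exp_lattice hz ht)

/-- The theta series `∑ exp(-π t |mz+n|²/y)` over all integral vectors. -/
def theta (z : ℂ) (t : ℝ) : ℝ := ∑' p : ℤ × ℤ, Real.exp (-(Real.pi * t * quad z p))

theorem theta_eq_one_add {z : ℂ} (hz : 0 < z.im) {t : ℝ} (ht : 0 < t) :
    theta z t = 1 + ∑' p : Lattice, Real.exp (-(Real.pi * t * quad z p)) := by
  rw [theta, tsum_eq_add_tsum_lattice (summable_exp_quad hz (by positivity)), quad_zero]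
  simp

/-- The terms of the theta series after Poisson summation in the second variable. -/
def dualTerm (z : ℂ) (t : ℝ) (p : ℤ × ℤ) : ℂ :=
  Complex.exp (-(Real.pi * z.im * (t * p.1 ^ 2 + t⁻¹ * p.2 ^ 2) : ℝ) -
    2 * Real.pi * Complex.I * z.re * p.1 * p.2)

/-- After Poisson summation in one variable only, the symmetry `t ↦ 1/t` becomes the exchange of the
two lattice coordinates. -/
theorem dualTerm_swap (z : ℂ) (t : ℝ) (p : ℤ × ℤ) : dualTerm z t⁻¹ p.swap = dualTerm z t p := by
  simp only [dualTerm, Prod.fst_swap, Prod.snd_swap, inv_inv]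
  congr 1
  push_cast
  ring

theorem summable_dualTerm {z : ℂ} (hz : 0 < z.im) {t : ℝ} (ht : 0 < t) :
    Summable (dualTerm z t) := by
  -- The absolute values of the dual terms are the terms of the theta series at the point `it` with
  -- parameter `y`.
  have h := summable_exp_quad (z := ⟨0, t⟩) ht (t := Real.pi * z.im) (by positivity)
  refine Summable.of_norm (h.congr fun p ↦ ?_)
  have e : (2 * Real.pi * Complex.I * z.re * p.1 * p.2 : ℂ) =
      ((2 * Real.pi * z.re * p.1 * p.2 : ℝ) : ℂ) * Complex.I := by
    push_cast
    ring
  rw [dualTerm, Complex.norm_exp, e, ← Complex.ofReal_neg, Complex.sub_re, Complex.ofReal_re,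
    Complex.re_ofReal_mul, Complex.I_re, mul_zero, sub_zero]
  congr 1
  simp only [quad, Complex.normSq_apply, Complex.add_re, Complex.mul_re, Complex.intCast_re,
    Complex.intCast_im, Complex.add_im, Complex.mul_im]
  field_simp
  ring

theorem theta_eq_tsum_dualTerm {z : ℂ} (hz : 0 < z.im) {t : ℝ} (ht : 0 < t) :
    (theta z t : ℂ) = ((z.im / t : ℝ) : ℂ) ^ (1 / 2 : ℂ) * ∑' p, dualTerm z t p := by
  have hsum := summable_exp_quad hz (t := Real.pi * t) (by positivity)
  have hsum' : Summable fun p : ℤ × ℤ ↦ (Real.exp (-(Real.pi * t * quad z p)) : ℂ) :=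
    Complex.summable_ofReal.2 hsum
  rw [theta, Complex.ofReal_tsum, hsum'.tsum_prod, (summable_dualTerm hz ht).tsum_prod,
    ← tsum_mul_left]
  refine tsum_congr fun m ↦ ?_
  have ha : 0 < ((z.im / t : ℝ) : ℂ).re := by
    rw [Complex.ofReal_re]; positivity
  have ha' : (((z.im / t : ℝ) : ℂ)) ≠ 0 := by
    intro h; rw [h] at ha; simp at ha
  -- Poisson summation in `n` for fixed `m`: the linear coefficient `b = -(i m x)` is chosen so that
  -- `n + i b = n + m x`.
  have hP := Complex.tsum_exp_neg_quadratic ha (-(Complex.I * m * z.re))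
  have ht' : (t : ℂ) ≠ 0 := by exact_mod_cast ht.ne'
  have hy' : (z.im : ℂ) ≠ 0 := by exact_mod_cast hz.ne'
  have e1 (n : ℤ) : (Real.exp (-(Real.pi * t * quad z (m, n))) : ℂ) =
      Complex.exp (-(Real.pi * z.im * t * m ^ 2)) * Complex.exp (-Real.pi / ((z.im / t : ℝ) : ℂ) *
        (n + Complex.I * (-(Complex.I * m * z.re))) ^ 2) := by
    rw [Complex.ofReal_exp, ← Complex.exp_add]
    congr 1
    have : (n + Complex.I * (-(Complex.I * m * z.re)) : ℂ) = m * z.re + n := by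
      linear_combination (-(m * z.re) : ℂ) * Complex.I_mul_I
    rw [this, quad, Complex.normSq_apply]
    simp
    field_simp
    ring
  have e2 (n : ℤ) : dualTerm z t (m, n) = Complex.exp (-(Real.pi * z.im * t * m ^ 2)) *
      Complex.exp (-Real.pi * ((z.im / t : ℝ) : ℂ) * n ^ 2 +
        2 * Real.pi * (-(Complex.I * m * z.re)) * n) := by
    rw [dualTerm, ← Complex.exp_add]
    congr 1
    push_cast
    field_simp
    ring
  simp_rw [e1, e2]
  rw [tsum_mul_left, tsum_mul_left, hP]
  have : ((z.im / t : ℝ) : ℂ) ^ (1 / 2 : ℂ) ≠ 0 := by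
    rw [Ne, Complex.cpow_eq_zero_iff]
    tauto
  field_simp

/-- The functional equation of the theta series. -/
theorem theta_inv {z : ℂ} (hz : 0 < z.im) {t : ℝ} (ht : 0 < t) : theta z t⁻¹ = t * theta z t := by
  have h1 := theta_eq_tsum_dualTerm hz ht
  have h2 := theta_eq_tsum_dualTerm hz (inv_pos.2 ht)
  have h3 : ∑' p, dualTerm z t⁻¹ p = ∑' p, dualTerm z t p := by
    rw [← (Equiv.prodComm ℤ ℤ).tsum_eq]
    exact tsum_congr fun p ↦ dualTerm_swap z t p
  have h4 : ((z.im / t⁻¹ : ℝ) : ℂ) ^ (1 / 2 : ℂ) = t * ((z.im / t : ℝ) : ℂ) ^ (1 / 2 : ℂ) := by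
    have e : (1 / 2 : ℂ) = ((1 / 2 : ℝ) : ℂ) := by push_cast; rfl
    rw [e, ← Complex.ofReal_cpow (by positivity), ← Complex.ofReal_cpow (by positivity),
      ← Complex.ofReal_mul, ← Real.sqrt_eq_rpow, ← Real.sqrt_eq_rpow]
    congr 1
    rw [show z.im / t⁻¹ = t ^ 2 * (z.im / t) by field_simp, Real.sqrt_mul (by positivity),
      Real.sqrt_sq ht.le]
  rw [h3, h4, mul_assoc, ← h1] at h2
  exact_mod_cast h2

theorem hasDerivAt_theta {z : ℂ} (hz : 0 < z.im) :
    HasDerivAt (theta z) (∑' p : ℤ × ℤ, -(Real.pi * quad z p) * Real.exp (-(Real.pi * quad z p)))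
      1 := by
  -- For `t > 1/2` each differentiated term is dominated by its form with `π t` replaced by `π / 2`
  -- in the exponent.
  have hu : Summable fun p : ℤ × ℤ ↦
      Real.pi * (quad z p ^ 1 * Real.exp (-(Real.pi / 2 * quad z p))) :=
    (summable_of_summable_lattice (f := fun p ↦ quad z p ^ 1 * Real.exp (-(Real.pi / 2 * quad z p)))
      (summable_pow_mul_exp_lattice hz (by positivity) 1)).mul_left _
  have := hasDerivAt_tsum_of_isPreconnected (t := Set.Ioi (1 / 2 : ℝ)) hu isOpen_Ioi
    isPreconnected_Ioi
    (g := fun (p : ℤ × ℤ) (t : ℝ) ↦ Real.exp (-(Real.pi * t * quad z p)))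
    (g' := fun (p : ℤ × ℤ) (t : ℝ) ↦ -(Real.pi * quad z p) * Real.exp (-(Real.pi * t * quad z p)))
    (y₀ := 1) (y := 1) (fun p t _ ↦ ?_) (fun p t ht ↦ ?_) (by norm_num [Set.mem_Ioi])
    (by simpa using summable_exp_quad hz Real.pi_pos) (by norm_num [Set.mem_Ioi])
  · simpa only [mul_one] using! this
  · have h1 : HasDerivAt (fun t : ℝ ↦ -(Real.pi * t * quad z p)) (-(Real.pi * quad z p)) t := by
      simpa using! (((hasDerivAt_id t).const_mul Real.pi).mul_const (quad z p)).neg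
    exact h1.exp.congr_deriv (by ring)
  · have hq := quad_nonneg hz p
    rw [Set.mem_Ioi] at ht
    rw [norm_mul, norm_neg, Real.norm_of_nonneg (by positivity),
      Real.norm_of_nonneg (Real.exp_pos _).le, pow_one, ← mul_assoc]
    refine mul_le_mul_of_nonneg_left (Real.exp_le_exp.2 ?_) (by positivity)
    have := mul_le_mul_of_nonneg_right ht.le (mul_nonneg Real.pi_pos.le hq)
    linarith

/-- Differentiating `θ(1/t) = t θ(t)` at `t = 1` gives `-2 θ'(1) - θ(1) = 0`, in which the zero
vector contributes `-1`. The sum is the boundary term of the differential equation for `n = 0`. -/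
theorem tsum_two_mul_sub_one_mul_exp {z : ℂ} (hz : 0 < z.im) :
    ∑' p : Lattice, (2 * (Real.pi * quad z p) - 1) * Real.exp (-(Real.pi * quad z p)) = 1 := by
  have hd := hasDerivAt_theta hz
  set D := ∑' p : ℤ × ℤ, -(Real.pi * quad z p) * Real.exp (-(Real.pi * quad z p)) with hD
  have h1 : HasDerivAt (fun t ↦ theta z t⁻¹) (-D) 1 := by
    have hi := hasDerivAt_inv (one_ne_zero (α := ℝ))
    have hd' : HasDerivAt (theta z) D (1 : ℝ)⁻¹ := by simpa using hd
    simpa using! hd'.comp 1 hi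
  have h2 : HasDerivAt (fun t ↦ t * theta z t) (theta z 1 + D) 1 := by
    simpa using! (hasDerivAt_id (1 : ℝ)).mul hd
  have h3 : (fun t ↦ theta z t⁻¹) =ᶠ[𝓝 1] fun t ↦ t * theta z t := by
    filter_upwards [lt_mem_nhds one_pos] with t ht using theta_inv hz ht
  have h4 := (h1.congr_of_eventuallyEq h3.symm).unique h2
  have s0 := summable_exp_quad hz Real.pi_pos
  have s1 : Summable fun p : ℤ × ℤ ↦ quad z p * Real.exp (-(Real.pi * quad z p)) :=
    summable_of_summable_lattice (f := fun p ↦ quad z p * Real.exp (-(Real.pi * quad z p)))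
      (by simpa using summable_pow_mul_exp_lattice hz Real.pi_pos 1)
  have s2 : Summable fun p : ℤ × ℤ ↦ -(Real.pi * quad z p) * Real.exp (-(Real.pi * quad z p)) :=
    (s1.mul_left (-Real.pi)).congr fun p ↦ by ring
  have e1 (p : ℤ × ℤ) : (2 * (Real.pi * quad z p) - 1) * Real.exp (-(Real.pi * quad z p)) =
      -2 * (-(Real.pi * quad z p) * Real.exp (-(Real.pi * quad z p))) -
        Real.exp (-(Real.pi * quad z p)) := by ring
  have s3 : Summable fun p : ℤ × ℤ ↦
      (2 * (Real.pi * quad z p) - 1) * Real.exp (-(Real.pi * quad z p)) := by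
    simp_rw [e1]
    exact (s2.mul_left _).sub s0
  have h5 := tsum_eq_add_tsum_lattice s3
  have h6 : ∑' p : ℤ × ℤ, (2 * (Real.pi * quad z p) - 1) * Real.exp (-(Real.pi * quad z p)) =
      -2 * D - theta z 1 := by
    simp_rw [e1]
    rw [(s2.mul_left _).tsum_sub s0, tsum_mul_left, theta, ← hD]
    simp
  rw [h6, quad_zero] at h5
  simp only [mul_zero, neg_zero, Real.exp_zero] at h5
  linarith

open scoped ComplexConjugate

/-! ### Wirtinger derivatives -/

/-- The real-linear map `v ↦ A v + B v̄`. -/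
def wirtinger (A B : ℂ) : ℂ →L[ℝ] ℂ :=
  A • ContinuousLinearMap.id ℝ ℂ + B • (Complex.conjCLE : ℂ →L[ℝ] ℂ)

theorem wirtinger_apply (A B v : ℂ) : wirtinger A B v = A * v + B * conj v := by
  simp [wirtinger]

theorem norm_wirtinger_le (A B : ℂ) : ‖wirtinger A B‖ ≤ ‖A‖ + ‖B‖ := by
  refine ContinuousLinearMap.opNorm_le_bound _ (by positivity) fun v ↦ ?_
  rw [wirtinger_apply, add_mul]
  refine (norm_add_le _ _).trans ?_
  rw [norm_mul, norm_mul, RCLike.norm_conj]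

/-- `f` is real differentiable at `z` with `∂f/∂z = A` and `∂f/∂z̄ = B`. -/
def HasWirtingerAt (f : ℂ → ℂ) (A B z : ℂ) : Prop := HasFDerivAt f (wirtinger A B) z

namespace HasWirtingerAt

variable {f g : ℂ → ℂ} {A B A' B' z : ℂ}

theorem congr_coeff (h : HasWirtingerAt f A B z) (hA : A = A') (hB : B = B') :
    HasWirtingerAt f A' B' z := by
  subst hA hB
  exact h

theorem mul (hf : HasWirtingerAt f A B z) (hg : HasWirtingerAt g A' B' z) :
    HasWirtingerAt (fun w ↦ f w * g w) (f z * A' + g z * A) (f z * B' + g z * B) z := by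
  refine (HasFDerivAt.mul hf hg).congr_fderiv ?_
  ext v
  simp only [add_apply, smul_apply, wirtinger_apply, smul_eq_mul]
  ring

theorem const_mul (c : ℂ) (hf : HasWirtingerAt f A B z) :
    HasWirtingerAt (fun w ↦ c * f w) (c * A) (c * B) z := by
  refine (HasFDerivAt.const_mul hf c).congr_fderiv ?_
  ext v
  simp only [smul_apply, wirtinger_apply, smul_eq_mul]
  ring

theorem comp_hasDerivAt {g' : ℂ} (hf : HasWirtingerAt f A B z) (hg : HasDerivAt g g' (f z)) :
    HasWirtingerAt (fun w ↦ g (f w)) (g' * A) (g' * B) z := by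
  refine ((hg.hasFDerivAt.restrictScalars ℝ).comp z hf).congr_fderiv ?_
  ext v
  simp only [ContinuousLinearMap.comp_apply, ContinuousLinearMap.coe_restrictScalars',
    ContinuousLinearMap.toSpanSingleton_apply, wirtinger_apply, smul_eq_mul]
  ring

end HasWirtingerAt

theorem hasWirtingerAt_im (z : ℂ) :
    HasWirtingerAt (fun w ↦ (w.im : ℂ)) (-Complex.I / 2) (Complex.I / 2) z := by
  refine ((Complex.ofRealCLM.comp Complex.imCLM).hasFDerivAt (x := z)).congr_fderiv ?_
  ext v
  simp only [ContinuousLinearMap.comp_apply, Complex.ofRealCLM_apply, Complex.imCLM_apply,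
    wirtinger_apply]
  rw [Complex.im_eq_sub_conj]
  field_simp
  ring_nf
  rw [Complex.I_sq]
  ring

theorem hasWirtingerAt_linear (m n : ℂ) (z : ℂ) : HasWirtingerAt (fun w ↦ m * w + n) m 0 z := by
  refine (((hasFDerivAt_id (𝕜 := ℝ) z).const_mul m).add_const n).congr_fderiv ?_
  ext v
  simp [wirtinger_apply]

theorem hasWirtingerAt_linear_conj (m n : ℂ) (z : ℂ) :
    HasWirtingerAt (fun w ↦ m * conj w + n) 0 m z := by
  refine (((Complex.conjCLE : ℂ →L[ℝ] ℂ).hasFDerivAt (x := z)).const_mul m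
    |>.add_const n).congr_fderiv ?_
  ext v
  simp [wirtinger_apply]

/-- The Laplacian in terms of Wirtinger derivatives. -/
theorem laplacian_eq_of_hasWirtingerAt {f A B : ℂ → ℂ} {z A₁ A₂ B₁ B₂ : ℂ}
    (hf : ∀ᶠ w in 𝓝 z, HasWirtingerAt f (A w) (B w) w) (hA : HasWirtingerAt A A₁ A₂ z)
    (hB : HasWirtingerAt B B₁ B₂ z) : Δ f z = 2 * (A₂ + B₁) := by
  have h1 : fderiv ℝ f =ᶠ[𝓝 z] fun w ↦ wirtinger (A w) (B w) := by
    filter_upwards [hf] with w hw using hw.fderiv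
  have h2 : HasFDerivAt (fun w ↦ wirtinger (A w) (B w)) _ z :=
    (HasFDerivAt.smul_const hA (ContinuousLinearMap.id ℝ ℂ)).add
      (HasFDerivAt.smul_const hB (Complex.conjCLE : ℂ →L[ℝ] ℂ))
  rw [laplacian_eq_fderiv_fderiv, h1.fderiv_eq, h2.fderiv]
  simp [wirtinger_apply]
  ring_nf
  rw [Complex.I_sq]
  ring

/-! ### Lattice sums -/

/-- The phase `(m z̄ + n) / (m z + n)`. -/
def phase (p : ℤ × ℤ) (z : ℂ) : ℂ := (p.1 * conj z + p.2) / (p.1 * z + p.2)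

theorem conj_linear (p : ℤ × ℤ) (z : ℂ) :
    conj (p.1 * z + p.2 : ℂ) = p.1 * conj z + p.2 := by simp

theorem conj_linear_ne_zero {z : ℂ} (hz : 0 < z.im) {p : ℤ × ℤ} (hp : p ≠ 0) :
    (p.1 * conj z + p.2 : ℂ) ≠ 0 := by
  rw [← conj_linear]
  exact (map_ne_zero _).2 (linear_ne_zero_of_im_pos hz hp)

theorem norm_phase {z : ℂ} (hz : 0 < z.im) {p : ℤ × ℤ} (hp : p ≠ 0) : ‖phase p z‖ = 1 := by
  rw [phase, norm_div, ← conj_linear, RCLike.norm_conj, div_self]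
  exact norm_ne_zero_iff.2 (linear_ne_zero_of_im_pos hz hp)

theorem phase_ne_zero {z : ℂ} (hz : 0 < z.im) {p : ℤ × ℤ} (hp : p ≠ 0) : phase p z ≠ 0 := by
  rw [← norm_ne_zero_iff, norm_phase hz hp]
  exact one_ne_zero

theorem coe_im_ne_zero {z : ℂ} (hz : 0 < z.im) : (z.im : ℂ) ≠ 0 := by exact_mod_cast hz.ne'

/-- This writes `m / (mz+n)` through `y` and the phase alone, so that the monomials `y⁻ʲ εᵏ` are
closed under differentiation. -/
theorem one_sub_phase {z : ℂ} (hz : 0 < z.im) {p : ℤ × ℤ} (hp : p ≠ 0) :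
    (p.1 : ℂ) / (p.1 * z + p.2) = -Complex.I / (2 * z.im) * (1 - phase p z) := by
  have hd := linear_ne_zero_of_im_pos hz hp
  have hy := coe_im_ne_zero hz
  have h1 : z - conj z = 2 * z.im * Complex.I := by rw [Complex.sub_conj]; push_cast; ring
  rw [phase]
  field_simp
  linear_combination (Complex.I * p.1) * h1 + 2 * z.im * (p.1 : ℂ) * Complex.I_sq

theorem hasWirtingerAt_phase {z : ℂ} (hz : 0 < z.im) {p : ℤ × ℤ} (hp : p ≠ 0) :
    HasWirtingerAt (phase p) (Complex.I / (2 * z.im) * (phase p z - phase p z ^ 2))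
      (-Complex.I / (2 * z.im) * (1 - phase p z)) z := by
  have hd := linear_ne_zero_of_im_pos hz hp
  have h := (hasWirtingerAt_linear_conj p.1 p.2 z).mul
    ((hasWirtingerAt_linear p.1 p.2 z).comp_hasDerivAt (hasDerivAt_inv hd))
  refine h.congr_coeff ?_ ?_
  · have h1 := one_sub_phase hz hp
    calc _ = -(phase p z * (p.1 / (p.1 * z + p.2))) := by rw [phase]; field_simp; ring
      _ = _ := by rw [h1]; ring
  · rw [← one_sub_phase hz hp]
    field_simp
    ring

theorem coe_quad (z : ℂ) (p : ℤ × ℤ) :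
    (quad z p : ℂ) = (p.1 * z + p.2) * (p.1 * conj z + p.2) * (z.im : ℂ)⁻¹ := by
  rw [quad, Complex.ofReal_div, Complex.normSq_eq_conj_mul_self, conj_linear]
  ring

theorem hasWirtingerAt_quad {z : ℂ} (hz : 0 < z.im) {p : ℤ × ℤ} (hp : p ≠ 0) :
    HasWirtingerAt (fun w ↦ (quad w p : ℂ)) (quad z p * (Complex.I / (2 * z.im)) * phase p z)
      (-(quad z p * (Complex.I / (2 * z.im)) * (phase p z)⁻¹)) z := by
  have hd := linear_ne_zero_of_im_pos hz hp
  have hdc := conj_linear_ne_zero hz hp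
  have hy := coe_im_ne_zero hz
  have h := ((hasWirtingerAt_linear p.1 p.2 z).mul (hasWirtingerAt_linear_conj p.1 p.2 z)).mul
    ((hasWirtingerAt_im z).comp_hasDerivAt (hasDerivAt_inv hy))
  have h1 : z = conj z + 2 * z.im * Complex.I := by
    have h0 := Complex.sub_conj z
    push_cast at h0
    linear_combination h0
  have h2 : (p.1 * z + p.2 : ℂ) = p.1 * conj z + p.2 + 2 * p.1 * z.im * Complex.I := by
    linear_combination (p.1 : ℂ) * h1
  have hf : (fun w ↦ (quad w p : ℂ)) = fun w : ℂ ↦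
      (p.1 * w + p.2) * (p.1 * conj w + p.2) * (w.im : ℂ)⁻¹ := funext fun w ↦ coe_quad w p
  rw [hf]
  refine h.congr_coeff ?_ ?_
  · rw [coe_quad, phase]
    field_simp
    linear_combination (p.1 * conj z + p.2 : ℂ) *
      (Complex.I * h2 + (2 * p.1 * z.im : ℂ) * Complex.I_sq)
  · rw [coe_quad, phase]
    field_simp
    linear_combination (p.1 * z + p.2 : ℂ) *
      (Complex.I * h2 + (2 * p.1 * z.im : ℂ) * Complex.I_sq)

/-- A sequence of functions with `x aₗ' = l aₗ - aₗ₊₁` that decay quadratically. -/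
structure IsSymbolSeq (a : ℕ → ℂ → ℂ) : Prop where
  hasDerivAt : ∀ (l : ℕ) (x : ℝ), 0 < x → HasDerivAt (a l) ((l * a l x - a (l + 1) x) / x) x
  bound : ∀ l : ℕ, ∃ C : ℝ, ∀ x : ℝ, 0 < x → ‖a l x‖ ≤ C * (x ^ 2)⁻¹

/-- The summand `y⁻ʲ εᵏ aₗ(π |mz+n|²/y)`. -/
def latticeTerm (a : ℕ → ℂ → ℂ) (j : ℕ) (k : ℤ) (l : ℕ) (p : ℤ × ℤ) (z : ℂ) : ℂ :=
  ((z.im : ℂ)⁻¹) ^ j * phase p z ^ k * a l (Real.pi * quad z p : ℝ)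

/-- The sum of `latticeTerm` over the nonzero integral vectors. -/
def latticeSum (a : ℕ → ℂ → ℂ) (j : ℕ) (k : ℤ) (l : ℕ) (z : ℂ) : ℂ :=
  ∑' p : Lattice, latticeTerm a j k l p z

/-- The holomorphic derivative of a family indexed like `latticeTerm`. -/
def dHol (T : ℕ → ℤ → ℕ → ℂ) (j : ℕ) (k : ℤ) (l : ℕ) : ℂ :=
  Complex.I / 2 * ((j + k) * T (j + 1) k l + (l - k) * T (j + 1) (k + 1) l -
    T (j + 1) (k + 1) (l + 1))

/-- The antiholomorphic derivative of a family indexed like `latticeTerm`. -/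
def dAnti (T : ℕ → ℤ → ℕ → ℂ) (j : ℕ) (k : ℤ) (l : ℕ) : ℂ :=
  Complex.I / 2 * ((k - j) * T (j + 1) k l - (k + l) * T (j + 1) (k - 1) l +
    T (j + 1) (k - 1) (l + 1))

section LatticeSum

variable {a : ℕ → ℂ → ℂ}

/-- Both derivatives of `quad` are `quad` times `± i/(2y)` times a power of the phase. The factor
`quad` cancels the `1/x` in the symbol relation, so the derivatives are again combinations of
lattice terms. -/
theorem hasWirtingerAt_latticeTerm (ha : IsSymbolSeq a) (j : ℕ) (k : ℤ) (l : ℕ) {p : ℤ × ℤ}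
    (hp : p ≠ 0) {z : ℂ} (hz : 0 < z.im) :
    HasWirtingerAt (latticeTerm a j k l p) (dHol (fun j k l ↦ latticeTerm a j k l p z) j k l)
      (dAnti (fun j k l ↦ latticeTerm a j k l p z) j k l) z := by
  have hy := coe_im_ne_zero hz
  have hε := phase_ne_zero hz hp
  have hq := quad_pos hz hp
  have hq' : (quad z p : ℂ) ≠ 0 := by exact_mod_cast hq.ne'
  have hπ : (Real.pi : ℂ) ≠ 0 := by exact_mod_cast Real.pi_ne_zero
  have h1 : HasWirtingerAt (fun w : ℂ ↦ ((w.im : ℂ)⁻¹) ^ j)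
      (j * ((z.im : ℂ)⁻¹) ^ (j + 1) * (Complex.I / 2))
      (-(j * ((z.im : ℂ)⁻¹) ^ (j + 1) * (Complex.I / 2))) z := by
    have hpow (i : ℕ) : ((z.im : ℂ)⁻¹) ^ (i + 1 + 1) = ((z.im : ℂ)⁻¹) ^ i * ((z.im : ℂ) ^ 2)⁻¹ := by
      rw [pow_succ, pow_succ]
      ring
    have := (hasWirtingerAt_im z).comp_hasDerivAt ((hasDerivAt_inv hy).pow j)
    refine this.congr_coeff ?_ ?_
    · rcases j with _ | j
      · simp
      · rw [Nat.add_sub_cancel, hpow]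
        ring
    · rcases j with _ | j
      · simp
      · rw [Nat.add_sub_cancel, hpow]
        ring
  have h2 := (hasWirtingerAt_phase hz hp).comp_hasDerivAt
    (hasDerivAt_zpow k (phase p z) (Or.inl hε))
  have hA := ha.hasDerivAt l (Real.pi * quad z p) (by positivity)
  rw [Complex.ofReal_mul] at hA
  have h3 := ((hasWirtingerAt_quad hz hp).const_mul Real.pi).comp_hasDerivAt hA
  have e : (fun w ↦ a l (Real.pi * (quad w p : ℂ))) = fun w ↦ a l (Real.pi * quad w p : ℝ) := by
    funext w
    push_cast
    rfl
  rw [e] at h3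
  refine ((h1.mul h2).mul h3).congr_coeff ?_ ?_
  · simp only [dHol, latticeTerm, zpow_add₀ hε, zpow_sub₀ hε, zpow_one, pow_succ _ j]
    push_cast
    generalize ((z.im : ℂ)⁻¹) ^ j = Y
    field_simp
    ring
  · simp only [dAnti, latticeTerm, zpow_sub₀ hε, zpow_one, pow_succ _ j]
    push_cast
    generalize ((z.im : ℂ)⁻¹) ^ j = Y
    field_simp
    ring

/-- The phase has modulus one and `y` is bounded below on the ball, so the quadratic decay of `a l`
gives the uniform majorant `‖p‖⁻⁴`, which is summable in rank two. -/
theorem exists_norm_latticeTerm_le (ha : IsSymbolSeq a) (j : ℕ) (k : ℤ) (l : ℕ) {z₀ : ℂ}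
    (hz₀ : 0 < z₀.im) :
    ∃ C : ℝ, ∀ p : Lattice, ∀ z ∈ Metric.ball z₀ (z₀.im / 2),
      ‖latticeTerm a j k l p z‖ ≤ C * ((‖p.1‖ ^ 2) ^ (2 : ℝ))⁻¹ := by
  obtain ⟨C, hC⟩ := ha.bound l
  obtain ⟨c, hc, h⟩ := exists_quad_ge hz₀
  have hC0 : 0 ≤ C := by simpa using (norm_nonneg _).trans (hC 1 one_pos)
  refine ⟨((z₀.im / 2)⁻¹) ^ j * (C * ((c * Real.pi) ^ (2 : ℝ))⁻¹), fun p z hz ↦ ?_⟩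
  obtain ⟨hz1, hz2⟩ := h z hz
  have hz0 : 0 < z.im := by linarith
  have hq := quad_pos hz0 p.2
  have hb := hC (Real.pi * quad z p) (by positivity)
  rw [latticeTerm, norm_mul, norm_mul, norm_zpow, norm_phase hz0 p.2, one_zpow, mul_one, norm_pow,
    norm_inv, Complex.norm_real, Real.norm_of_nonneg hz0.le, mul_assoc]
  refine mul_le_mul ?_ (hb.trans ?_) (norm_nonneg _) (by positivity)
  · exact pow_le_pow_left₀ (by positivity) (inv_anti₀ (by linarith) hz1.le) j
  · rw [mul_assoc]
    refine mul_le_mul_of_nonneg_left ?_ hC0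
    rw [← Real.rpow_two]
    refine rpow_inv_le_of_ge (by positivity) one_lt_two p.2 ?_
    rw [mul_comm c, mul_assoc]
    exact mul_le_mul_of_nonneg_left (hz2 p p.2) Real.pi_pos.le

theorem summable_latticeTerm (ha : IsSymbolSeq a) (j : ℕ) (k : ℤ) (l : ℕ) {z : ℂ}
    (hz : 0 < z.im) : Summable fun p : Lattice ↦ latticeTerm a j k l p z := by
  obtain ⟨C, hC⟩ := exists_norm_latticeTerm_le ha j k l hz
  exact Summable.of_norm_bounded ((summable_norm_sq_rpow one_lt_two).mul_left C)
    fun p ↦ hC p z (Metric.mem_ball_self (by linarith))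

theorem tsum_dHol {ι : Type*} {T : ℕ → ℤ → ℕ → ι → ℂ} (hT : ∀ j k l, Summable (T j k l))
    (j : ℕ) (k : ℤ) (l : ℕ) : HasSum (fun i ↦ dHol (fun j k l ↦ T j k l i) j k l)
      (dHol (fun j k l ↦ ∑' i, T j k l i) j k l) :=
  ((((hT _ _ _).hasSum.mul_left _).add ((hT _ _ _).hasSum.mul_left _)).sub
    (hT _ _ _).hasSum).mul_left _

theorem tsum_dAnti {ι : Type*} {T : ℕ → ℤ → ℕ → ι → ℂ} (hT : ∀ j k l, Summable (T j k l))
    (j : ℕ) (k : ℤ) (l : ℕ) : HasSum (fun i ↦ dAnti (fun j k l ↦ T j k l i) j k l)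
      (dAnti (fun j k l ↦ ∑' i, T j k l i) j k l) :=
  ((((hT _ _ _).hasSum.mul_left _).sub ((hT _ _ _).hasSum.mul_left _)).add
    (hT _ _ _).hasSum).mul_left _

theorem norm_combination_le {α β x y z : ℂ} {X Y Z u : ℝ} (hx : ‖x‖ ≤ X * u) (hy : ‖y‖ ≤ Y * u)
    (hz : ‖z‖ ≤ Z * u) : ‖α * x + β * y + z‖ ≤ (‖α‖ * X + ‖β‖ * Y + Z) * u := by
  calc ‖α * x + β * y + z‖ ≤ ‖α‖ * ‖x‖ + ‖β‖ * ‖y‖ + ‖z‖ := by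
        rw [← norm_mul, ← norm_mul]
        exact norm_add₃_le
    _ ≤ ‖α‖ * (X * u) + ‖β‖ * (Y * u) + Z * u := by gcongr
    _ = _ := by ring

theorem hasWirtingerAt_latticeSum (ha : IsSymbolSeq a) (j : ℕ) (k : ℤ) (l : ℕ) {z : ℂ}
    (hz : 0 < z.im) :
    HasWirtingerAt (latticeSum a j k l) (dHol (fun j k l ↦ latticeSum a j k l z) j k l)
      (dAnti (fun j k l ↦ latticeSum a j k l z) j k l) z := by
  have hzs : z ∈ Metric.ball z (z.im / 2) := Metric.mem_ball_self (by linarith)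
  have hpos : ∀ w ∈ Metric.ball z (z.im / 2), 0 < w.im := by
    obtain ⟨c, hc, h⟩ := exists_quad_ge hz
    intro w hw
    linarith [(h w hw).1]
  choose C hC using fun j k l ↦ exists_norm_latticeTerm_le ha j k l hz
  set u : Lattice → ℝ := fun p ↦ ((‖p.1‖ ^ 2) ^ (2 : ℝ))⁻¹ with hu
  have hus : Summable u := summable_norm_sq_rpow one_lt_two
  set D : ℝ := ‖Complex.I / 2‖ * (‖(j + k : ℂ)‖ * C (j + 1) k l + ‖(l - k : ℂ)‖ * C (j + 1) (k + 1) l +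
    C (j + 1) (k + 1) (l + 1)) + ‖Complex.I / 2‖ * (‖(k - j : ℂ)‖ * C (j + 1) k l +
    ‖(k + l : ℂ)‖ * C (j + 1) (k - 1) l + C (j + 1) (k - 1) (l + 1)) with hD
  have hmain := hasFDerivAt_tsum_of_isPreconnected (𝕜 := ℝ) (u := fun p ↦ D * u p)
    (f := fun (p : Lattice) w ↦ latticeTerm a j k l p w)
    (f' := fun (p : Lattice) w ↦ wirtinger (dHol (fun j k l ↦ latticeTerm a j k l p w) j k l)
      (dAnti (fun j k l ↦ latticeTerm a j k l p w) j k l))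
    (hus.mul_left D) Metric.isOpen_ball (convex_ball z (z.im / 2)).isPreconnected
    (fun p w hw ↦ hasWirtingerAt_latticeTerm ha j k l p.2 (hpos w hw)) (fun p w hw ↦ ?_) hzs
    (summable_latticeTerm ha j k l hz) hzs
  · refine hmain.congr_fderiv ?_
    have s1 := tsum_dHol (fun j k l ↦ summable_latticeTerm ha j k l hz) j k l
    have s2 := tsum_dAnti (fun j k l ↦ summable_latticeTerm ha j k l hz) j k l
    exact ((s1.smul_const (ContinuousLinearMap.id ℝ ℂ)).add
      (s2.smul_const (Complex.conjCLE : ℂ →L[ℝ] ℂ))).tsum_eq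
  · refine (norm_wirtinger_le _ _).trans ?_
    rw [hD, add_mul]
    refine add_le_add ?_ ?_
    · rw [dHol, norm_mul, mul_assoc, sub_eq_add_neg]
      refine mul_le_mul_of_nonneg_left ?_ (norm_nonneg _)
      exact norm_combination_le (hC _ _ _ p w hw) (hC _ _ _ p w hw)
        ((norm_neg _).trans_le (hC _ _ _ p w hw))
    · rw [dAnti, norm_mul, mul_assoc, sub_eq_add_neg (_ * _), ← neg_mul, ← norm_neg (k + l : ℂ)]
      refine mul_le_mul_of_nonneg_left ?_ (norm_nonneg _)
      exact norm_combination_le (hC _ _ _ p w hw) (hC _ _ _ p w hw) (hC _ _ _ p w hw)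

/-- The derivative of a lattice sum is a combination of lattice sums, so the induction on the order
of smoothness runs over all indices at once. -/
theorem contDiffOn_latticeSum (ha : IsSymbolSeq a) (j : ℕ) (k : ℤ) (l : ℕ) :
    ContDiffOn ℝ ∞ (latticeSum a j k l) {z : ℂ | 0 < z.im} := by
  have ho : IsOpen {z : ℂ | 0 < z.im} := isOpen_upperHalfPlaneSet
  refine contDiffOn_infty.2 fun n ↦ ?_
  induction n generalizing j k l with
  | zero =>
    rw [Nat.cast_zero, contDiffOn_zero]
    exact fun z hz ↦
      (hasWirtingerAt_latticeSum ha j k l hz).continuousAt.continuousWithinAt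
  | succ n ih =>
    rw [Nat.cast_succ, contDiffOn_succ_iff_fderiv_of_isOpen ho]
    refine ⟨fun z hz ↦ (hasWirtingerAt_latticeSum ha j k
      l hz).differentiableAt.differentiableWithinAt, by simp, ?_⟩
    have h1 : ContDiffOn ℝ n (fun z ↦ wirtinger (dHol (fun j k l ↦ latticeSum a j k l z) j k l)
        (dAnti (fun j k l ↦ latticeSum a j k l z) j k l)) {z : ℂ | 0 < z.im} := by
      have hA : ContDiffOn ℝ n (fun z ↦ dHol (fun j k l ↦ latticeSum a j k l z) j k l)
          {z : ℂ | 0 < z.im} :=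
        contDiffOn_const.mul (((contDiffOn_const.mul (ih _ _ _)).add
          (contDiffOn_const.mul (ih _ _ _))).sub (ih _ _ _))
      have hB : ContDiffOn ℝ n (fun z ↦ dAnti (fun j k l ↦ latticeSum a j k l z) j k l)
          {z : ℂ | 0 < z.im} :=
        contDiffOn_const.mul (((contDiffOn_const.mul (ih _ _ _)).sub
          (contDiffOn_const.mul (ih _ _ _))).add (ih _ _ _))
      exact (hA.smul contDiffOn_const).add (hB.smul contDiffOn_const)
    exact h1.congr fun z hz ↦ (hasWirtingerAt_latticeSum ha j k l hz).fderiv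

/-- If `a 0 = f`, the symbol relation gives `a 1 = -x f'` and `a 2 = x² f''`. This is the formula
`x² f'' + 2 x f'` for the hyperbolic Laplacian of a function of the quadratic form; the two phases
cancel. -/
theorem sq_im_mul_laplacian_latticeSum (ha : IsSymbolSeq a) {z : ℂ} (hz : 0 < z.im) :
    (z.im : ℂ) ^ 2 * Δ (latticeSum a 0 0 0) z =
      ∑' p : Lattice, (a 2 (Real.pi * quad z p : ℝ) - 2 * a 1 (Real.pi * quad z p : ℝ)) := by
  have hf : ∀ᶠ w in 𝓝 z, HasWirtingerAt (latticeSum a 0 0 0)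
      (-Complex.I / 2 * latticeSum a 1 1 1 w) (Complex.I / 2 * latticeSum a 1 (-1) 1 w) w := by
    filter_upwards [isOpen_upperHalfPlaneSet.mem_nhds hz] with w hw
    refine (hasWirtingerAt_latticeSum ha 0 0 0 hw).congr_coeff ?_ ?_
    · simp [dHol]
      ring
    · simp [dAnti]
  have hA := (hasWirtingerAt_latticeSum ha 1 1 1 hz).const_mul (-Complex.I / 2)
  have hB := (hasWirtingerAt_latticeSum ha 1 (-1) 1 hz).const_mul (Complex.I / 2)
  have hy := coe_im_ne_zero hz
  have e (l : ℕ) : (z.im : ℂ) ^ 2 * latticeSum a 2 0 l z =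
      ∑' p : Lattice, a l (Real.pi * quad z p : ℝ) := by
    rw [latticeSum, ← tsum_mul_left]
    refine tsum_congr fun p ↦ ?_
    rw [latticeTerm, zpow_zero]
    field_simp
  have s (l : ℕ) : Summable fun p : Lattice ↦ a l (Real.pi * quad z p : ℝ) := by
    simpa [latticeTerm] using summable_latticeTerm ha 0 0 l hz
  rw [laplacian_eq_of_hasWirtingerAt hf hA hB, (s 2).tsum_sub ((s 1).mul_left 2), tsum_mul_left,
    ← e, ← e]
  simp [dHol, dAnti]
  ring_nf
  rw [Complex.I_sq]
  ring

end LatticeSum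

/-! ### Laplace transforms over `(1, ∞)` -/

theorem integrableOn_pow_mul_exp {x : ℝ} (hx : 0 < x) (N : ℕ) :
    IntegrableOn (fun t : ℝ ↦ t ^ N * Real.exp (-(x * t))) (Set.Ioi 0) := by
  have h := integrableOn_rpow_mul_exp_neg_mul_rpow (p := 1) (s := N) (b := x)
    (by linarith [(Nat.cast_nonneg N : (0 : ℝ) ≤ N)]) one_pos hx
  simpa [Real.rpow_natCast] using h

theorem setIntegral_pow_mul_exp_le {x : ℝ} (hx : 0 < x) (N : ℕ) :
    ∫ t in Set.Ioi (1 : ℝ), t ^ N * Real.exp (-(x * t)) ≤ N.factorial * (x ^ (N + 1))⁻¹ := by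
  have h := Real.integral_rpow_mul_exp_neg_mul_Ioi (a := N + 1) (r := x) (by positivity) hx
  simp only [add_sub_cancel_right, Real.rpow_natCast] at h
  refine (setIntegral_mono_set (integrableOn_pow_mul_exp hx N) ?_
    (Set.Ioi_subset_Ioi zero_le_one).eventuallyLE).trans (le_of_eq ?_)
  · filter_upwards [ae_restrict_mem measurableSet_Ioi] with t ht
    have : (0 : ℝ) < t := ht
    simp only [Pi.zero_apply]
    positivity
  · rw [h, Real.Gamma_nat_eq_factorial, ← Nat.cast_succ, Real.rpow_natCast, one_div, inv_pow,
      mul_comm]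

/-- A weight on `(1, ∞)` of polynomial growth. -/
structure IsWeight (w : ℝ → ℝ) (M : ℝ) (K : ℕ) : Prop where
  continuousOn : ContinuousOn w (Set.Ioi 1)
  bound : ∀ t, 1 < t → |w t| ≤ M * t ^ K

/-- The integral `∫₁^∞ e^{-xt} tˡ w(t) dt`. -/
def laplace (w : ℝ → ℝ) (l : ℕ) (x : ℂ) : ℂ :=
  ∫ t in Set.Ioi (1 : ℝ), Complex.exp (-(x * t)) * (t ^ l * w t : ℝ)

/-- The function `xˡ ∫₁^∞ e^{-xt} tˡ w(t) dt`. -/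
def laplaceSymbol (w : ℝ → ℝ) (l : ℕ) (x : ℂ) : ℂ := x ^ l * laplace w l x

namespace IsWeight

variable {w : ℝ → ℝ} {M : ℝ} {K : ℕ}

theorem aestronglyMeasurable (hw : IsWeight w M K) (l : ℕ) (x : ℂ) :
    AEStronglyMeasurable (fun t : ℝ ↦ Complex.exp (-(x * t)) * (t ^ l * w t : ℝ))
      (volume.restrict (Set.Ioi 1)) := by
  refine ContinuousOn.aestronglyMeasurable ?_ measurableSet_Ioi
  refine ContinuousOn.mul (by fun_prop) (Complex.continuous_ofReal.comp_continuousOn ?_)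
  exact (continuousOn_pow l).mul hw.continuousOn

theorem norm_integrand_le (hw : IsWeight w M K) (l : ℕ) {x : ℂ} {r : ℝ} (hr : r ≤ x.re) {t : ℝ}
    (ht : 1 < t) : ‖Complex.exp (-(x * t)) * (t ^ l * w t : ℝ)‖ ≤
      M * (t ^ (K + l) * Real.exp (-(r * t))) := by
  have ht0 : 0 < t := by linarith
  rw [norm_mul, Complex.norm_exp, Complex.norm_real, Real.norm_eq_abs, abs_mul,
    abs_of_pos (pow_pos ht0 l), Complex.neg_re, Complex.re_mul_ofReal]
  calc Real.exp (-(x.re * t)) * (t ^ l * |w t|)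
      ≤ Real.exp (-(r * t)) * (t ^ l * (M * t ^ K)) := by
        refine mul_le_mul (Real.exp_le_exp.2 (neg_le_neg (mul_le_mul_of_nonneg_right hr ht0.le)))
          (mul_le_mul_of_nonneg_left (hw.bound t ht) (by positivity)) (by positivity)
          (Real.exp_pos _).le
    _ = _ := by rw [pow_add]; ring

theorem integrableOn (hw : IsWeight w M K) (l : ℕ) {x : ℂ} (hx : 0 < x.re) :
    IntegrableOn (fun t : ℝ ↦ Complex.exp (-(x * t)) * (t ^ l * w t : ℝ)) (Set.Ioi 1) := by
  refine Integrable.mono' (((integrableOn_pow_mul_exp hx (K + l)).mono_set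
    (Set.Ioi_subset_Ioi zero_le_one)).const_mul M) (hw.aestronglyMeasurable l x) ?_
  filter_upwards [ae_restrict_mem measurableSet_Ioi] with t ht
  exact hw.norm_integrand_le l le_rfl ht

theorem nonneg (hw : IsWeight w M K) : 0 ≤ M := by
  have h := (abs_nonneg _).trans (hw.bound 2 one_lt_two)
  exact nonneg_of_mul_nonneg_left h (by positivity)

theorem integral_norm_le (hw : IsWeight w M K) (l : ℕ) {x : ℝ} (hx : 0 < x) :
    ∫ t in Set.Ioi (1 : ℝ), ‖Complex.exp (-((x : ℂ) * t)) * (t ^ l * w t : ℝ)‖ ≤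
      M * ((K + l).factorial * (x ^ (K + l + 1))⁻¹) := by
  have h1 : ∫ t in Set.Ioi (1 : ℝ), ‖Complex.exp (-((x : ℂ) * t)) * (t ^ l * w t : ℝ)‖ ≤
      ∫ t in Set.Ioi (1 : ℝ), M * (t ^ (K + l) * Real.exp (-(x * t))) := by
    refine setIntegral_mono_on (hw.integrableOn l (by simpa using hx)).norm
      (((integrableOn_pow_mul_exp hx (K + l)).mono_set
        (Set.Ioi_subset_Ioi zero_le_one)).const_mul M) measurableSet_Ioi fun t ht ↦ ?_
    exact hw.norm_integrand_le l (x := (x : ℂ)) (by simp) ht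
  refine h1.trans ?_
  rw [integral_const_mul]
  exact mul_le_mul_of_nonneg_left (setIntegral_pow_mul_exp_le hx _) hw.nonneg

theorem norm_laplace_le (hw : IsWeight w M K) (l : ℕ) {x : ℝ} (hx : 0 < x) :
    ‖laplace w l x‖ ≤ M * ((K + l).factorial * (x ^ (K + l + 1))⁻¹) :=
  (norm_integral_le_integral_norm _).trans (hw.integral_norm_le l hx)

theorem hasDerivAt_laplace (hw : IsWeight w M K) (l : ℕ) {x : ℝ} (hx : 0 < x) :
    HasDerivAt (laplace w l) (-laplace w (l + 1) x) x := by
  have h := hasDerivAt_integral_of_dominated_loc_of_deriv_le (𝕜 := ℂ) (x₀ := (x : ℂ))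
    (μ := volume.restrict (Set.Ioi (1 : ℝ))) (s := Metric.ball (x : ℂ) (x / 2))
    (F := fun ξ t ↦ Complex.exp (-(ξ * t)) * (t ^ l * w t : ℝ))
    (F' := fun ξ t ↦ -(Complex.exp (-(ξ * t)) * (t ^ (l + 1) * w t : ℝ)))
    (bound := fun t ↦ M * (t ^ (K + (l + 1)) * Real.exp (-(x / 2 * t))))
    (Metric.ball_mem_nhds _ (by linarith))
    (Eventually.of_forall fun ξ ↦ hw.aestronglyMeasurable l ξ)
    (hw.integrableOn l (by simpa using hx)) (hw.aestronglyMeasurable (l + 1) x).neg ?_ ?_ ?_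
  · refine HasDerivAt.congr_deriv h.2 ?_
    rw [integral_neg]
    rfl
  · filter_upwards [ae_restrict_mem measurableSet_Ioi] with t ht ξ hξ
    rw [norm_neg]
    refine hw.norm_integrand_le (l + 1) ?_ ht
    rw [Metric.mem_ball, dist_eq_norm] at hξ
    have := (abs_lt.1 ((Complex.abs_re_le_norm _).trans_lt hξ)).1
    simp only [Complex.sub_re, Complex.ofReal_re] at this
    linarith
  · exact ((integrableOn_pow_mul_exp (by linarith) _).mono_set
      (Set.Ioi_subset_Ioi zero_le_one)).const_mul M
  · refine ae_of_all _ fun t ξ _ ↦ ?_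
    have h1 : HasDerivAt (fun ξ : ℂ ↦ -(ξ * t)) (-(t : ℂ)) ξ := by
      simpa using! ((hasDerivAt_id ξ).mul_const (t : ℂ)).neg
    refine (h1.cexp.mul_const _).congr_deriv ?_
    push_cast
    ring

/-- Linear growth of the weight (`K = 1`) bounds the transform by a multiple of `x^{-(l+2)}`; the
factor `xˡ` leaves the required `x⁻²` for every `l`. -/
theorem isSymbolSeq (hw : IsWeight w M 1) : IsSymbolSeq (laplaceSymbol w) where
  hasDerivAt l x hx := by
    have hx' : (x : ℂ) ≠ 0 := by exact_mod_cast hx.ne'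
    refine ((hasDerivAt_pow l (x : ℂ)).mul (hw.hasDerivAt_laplace l hx)).congr_deriv ?_
    rw [laplaceSymbol, laplaceSymbol, eq_div_iff hx']
    rcases l with _ | l
    · simp
      ring
    · simp only [Nat.add_sub_cancel]
      ring
  bound l := by
    refine ⟨M * (1 + l).factorial, fun x hx ↦ ?_⟩
    rw [laplaceSymbol, norm_mul, norm_pow, Complex.norm_real, Real.norm_of_nonneg hx.le]
    refine (mul_le_mul_of_nonneg_left (hw.norm_laplace_le l hx) (by positivity)).trans
      (le_of_eq ?_)
    rw [show 1 + l + 1 = l + 2 by ring, pow_add]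
    field_simp

end IsWeight

/-! ### The logarithmic weights -/

/-- The function `(log t)ⁿ / n!`. -/
def logPow (n : ℕ) (t : ℝ) : ℝ := Real.log t ^ n / n.factorial

/-- The coefficient of `sⁿ` in `t^{s-1} + t^{-s}`. -/
def logWeight (n : ℕ) (t : ℝ) : ℝ := logPow n t * (t⁻¹ + (-1) ^ n)

theorem logPow_nonneg (n : ℕ) {t : ℝ} (ht : 1 < t) : 0 ≤ logPow n t := by
  have := Real.log_pos ht
  unfold logPow
  positivity

/-- This is `(K log t)ⁿ / n! ≤ t^K`. The factor `K⁻ⁿ` makes the expansion in powers of `s` converge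
when `|s| < K`. -/
theorem logPow_le (n : ℕ) {K : ℕ} (hK : K ≠ 0) {t : ℝ} (ht : 1 < t) :
    logPow n t ≤ ((K : ℝ) ^ n)⁻¹ * t ^ K := by
  have hK' : 0 < (K : ℝ) := by exact_mod_cast Nat.pos_of_ne_zero hK
  have ht0 : 0 < t := by linarith
  have h := Real.pow_div_factorial_le_exp (K * Real.log t)
    (mul_nonneg hK'.le (Real.log_pos ht).le) n
  rw [mul_comm, Real.exp_mul, Real.exp_log ht0, Real.rpow_natCast, mul_pow] at h
  rw [logPow, inv_mul_eq_div, le_div_iff₀ (by positivity)]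
  calc _ = _ := by ring
    _ ≤ _ := h

theorem isWeight_logWeight (n : ℕ) {K : ℕ} (hK : K ≠ 0) :
    IsWeight (logWeight n) (2 * ((K : ℝ) ^ n)⁻¹) K where
  continuousOn := by
    have h1 : ContinuousOn Real.log (Set.Ioi 1) :=
      Real.continuousOn_log.mono fun t (ht : 1 < t) ↦ by simp; linarith
    have h2 : ContinuousOn (fun t : ℝ ↦ t⁻¹) (Set.Ioi 1) :=
      continuousOn_inv₀.mono fun t (ht : 1 < t) ↦ by simp; linarith
    unfold logWeight logPow
    exact ((h1.pow n).div_const _).mul (h2.add continuousOn_const)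
  bound t ht := by
    have ht0 : 0 < t := by linarith
    rw [logWeight, abs_mul, abs_of_nonneg (logPow_nonneg n ht)]
    have h1 : |t⁻¹ + (-1) ^ n| ≤ 2 := by
      refine (abs_add_le _ _).trans ?_
      rw [abs_pow, abs_neg, abs_one, one_pow, abs_of_pos (inv_pos.2 ht0)]
      have := inv_le_one_of_one_le₀ ht.le
      linarith
    calc _ ≤ ((K : ℝ) ^ n)⁻¹ * t ^ K * 2 :=
          mul_le_mul (logPow_le n hK ht) h1 (abs_nonneg _) (by positivity)
      _ = _ := by ring

theorem isSymbolSeq_logWeight (n : ℕ) : IsSymbolSeq (laplaceSymbol (logWeight n)) :=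
  (isWeight_logWeight n one_ne_zero).isSymbolSeq

/-- The sequence `c` with a zero put in front. -/
def shift {R : Type*} [Zero R] (c : ℕ → R) : ℕ → R
  | 0 => 0
  | n + 1 => c n

theorem hasDerivAt_logPow (n : ℕ) {t : ℝ} (ht : 0 < t) :
    HasDerivAt (logPow n) (shift (fun n ↦ logPow n t) n / t) t := by
  have h := ((Real.hasDerivAt_log ht.ne').pow n).div_const (n.factorial : ℝ)
  refine HasDerivAt.congr_deriv h ?_
  rcases n with _ | n
  · simp [shift]
  · simp only [shift, logPow, Nat.add_sub_cancel, Nat.factorial_succ]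
    push_cast
    field_simp

/-- The derivative of `logWeight`, times `t²`. -/
def logWeightDeriv (n : ℕ) (t : ℝ) : ℝ :=
  shift (fun n ↦ logPow n t) n - logPow n t + (-1) ^ n * (t * shift (fun n ↦ logPow n t) n)

theorem hasDerivAt_logWeight (n : ℕ) {t : ℝ} (ht : 0 < t) :
    HasDerivAt (logWeight n) (logWeightDeriv n t / t ^ 2) t := by
  have h := (hasDerivAt_logPow n ht).mul ((hasDerivAt_inv ht.ne').add_const ((-1) ^ n))
  refine HasDerivAt.congr_deriv h ?_
  rw [logWeightDeriv]
  field_simp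
  ring

theorem hasDerivAt_shift_logPow (n : ℕ) {t : ℝ} (ht : 0 < t) :
    HasDerivAt (fun t ↦ shift (fun n ↦ logPow n t) n) (shift (shift fun n ↦ logPow n t) n / t)
      t := by
  rcases n with _ | n
  · simpa [shift] using! hasDerivAt_const t (0 : ℝ)
  · exact hasDerivAt_logPow n ht

/-- For `w = t^{s-1} + t^{-s}` one has `(t² w')' = s(s-1) w`; this is the coefficient of `sⁿ`, where
multiplication by `s` is `shift`. -/
theorem hasDerivAt_logWeightDeriv (n : ℕ) {t : ℝ} (ht : 0 < t) :
    HasDerivAt (logWeightDeriv n) (shift (shift fun n ↦ logWeight n t) n -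
      shift (fun n ↦ logWeight n t) n) t := by
  have h1 := hasDerivAt_shift_logPow n ht
  have h := (h1.sub (hasDerivAt_logPow n ht)).add
    (((hasDerivAt_id t).mul h1).const_mul ((-1 : ℝ) ^ n))
  refine HasDerivAt.congr_deriv h ?_
  rcases n with _ | _ | n
  · simp [shift]
  · simp [shift, logWeight]
    field_simp
    ring
  · simp only [shift, logWeight, id]
    field_simp
    ring

/-! ### The differential equation for the lattice sums -/

theorem shift_logPow_le (n : ℕ) {t : ℝ} (ht : 1 < t) :
    |shift (fun n ↦ logPow n t) n| ≤ t := by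
  rcases n with _ | n
  · simpa [shift] using by linarith
  · rw [shift, abs_of_nonneg (logPow_nonneg n ht)]
    simpa using logPow_le n one_ne_zero ht

theorem abs_logWeightDeriv_le (n : ℕ) {t : ℝ} (ht : 1 < t) : |logWeightDeriv n t| ≤ 3 * t ^ 2 := by
  have h1 := shift_logPow_le n ht
  have h2 : |logPow n t| ≤ t := by
    rw [abs_of_nonneg (logPow_nonneg n ht)]
    simpa using logPow_le n one_ne_zero ht
  have h3 : |(-1) ^ n * (t * shift (fun n ↦ logPow n t) n)| ≤ t * t := by
    rw [abs_mul, abs_pow, abs_neg, abs_one, one_pow, one_mul, abs_mul, abs_of_pos (by linarith)]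
    exact mul_le_mul_of_nonneg_left h1 (by linarith)
  have h4 := abs_add_le (shift (fun n ↦ logPow n t) n - logPow n t)
    ((-1) ^ n * (t * shift (fun n ↦ logPow n t) n))
  have h5 := abs_sub (shift (fun n ↦ logPow n t) n) (logPow n t)
  rw [logWeightDeriv]
  nlinarith

theorem integral_exp_mul_shift {x : ℝ} (n : ℕ) :
    ∫ t in Set.Ioi (1 : ℝ), Complex.exp (-((x : ℂ) * t)) * (shift (fun n ↦ logWeight n t) n : ℝ) =
      shift (fun n ↦ laplaceSymbol (logWeight n) 0 x) n := by
  rcases n with _ | n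
  · simp [shift]
  · simp [shift, laplaceSymbol, laplace]

theorem integrableOn_exp_mul_shift {x : ℝ} (hx : 0 < x) (n : ℕ) :
    IntegrableOn (fun t : ℝ ↦ Complex.exp (-((x : ℂ) * t)) *
      (shift (fun n ↦ logWeight n t) n : ℝ)) (Set.Ioi 1) := by
  rcases n with _ | n
  · simp [shift]
  · simpa [shift] using (isWeight_logWeight n one_ne_zero).integrableOn 0 (x := (x : ℂ))
      (by simpa using hx)

theorem integral_exp_mul_shift_shift {x : ℝ} (n : ℕ) :
    ∫ t in Set.Ioi (1 : ℝ), Complex.exp (-((x : ℂ) * t)) *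
        (shift (shift fun n ↦ logWeight n t) n : ℝ) =
      shift (shift fun n ↦ laplaceSymbol (logWeight n) 0 x) n := by
  rcases n with _ | n
  · simp [shift]
  · exact integral_exp_mul_shift n

theorem integrableOn_exp_mul_shift_shift {x : ℝ} (hx : 0 < x) (n : ℕ) :
    IntegrableOn (fun t : ℝ ↦ Complex.exp (-((x : ℂ) * t)) *
      (shift (shift fun n ↦ logWeight n t) n : ℝ)) (Set.Ioi 1) := by
  rcases n with _ | n
  · simp [shift]
  · exact integrableOn_exp_mul_shift hx n

/-- The left side integrates `(x²t² - 2xt) e^{-xt}`, the `t`-derivative of `-x t² e^{-xt}`, against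
the weight `w`. Two integrations by parts leave `(t² w')'` under the integral and the boundary terms
at `t = 1`. -/
theorem laplaceSymbol_two_sub {x : ℝ} (hx : 0 < x) (n : ℕ) :
    laplaceSymbol (logWeight n) 2 x - 2 * laplaceSymbol (logWeight n) 1 x =
      (((x * logWeight n 1 + logWeightDeriv n 1) * Real.exp (-x) : ℝ) : ℂ) +
      (shift (shift fun n ↦ laplaceSymbol (logWeight n) 0 x) n -
        shift (fun n ↦ laplaceSymbol (logWeight n) 0 x) n) := by
  have hw := isWeight_logWeight n one_ne_zero
  have hxr : 0 < (x : ℂ).re := by simpa using hx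
  set H : ℝ → ℂ := fun t ↦ Complex.exp (-((x : ℂ) * t)) *
    ((-(x * (t ^ 2 * logWeight n t)) - logWeightDeriv n t : ℝ) : ℂ) with hH
  set H' : ℝ → ℂ := fun t ↦
    ((x : ℂ) ^ 2 * (Complex.exp (-((x : ℂ) * t)) * (t ^ 2 * logWeight n t : ℝ)) -
      2 * (x : ℂ) * (Complex.exp (-((x : ℂ) * t)) * (t ^ 1 * logWeight n t : ℝ))) -
    (Complex.exp (-((x : ℂ) * t)) * (shift (shift fun n ↦ logWeight n t) n : ℝ) -
      Complex.exp (-((x : ℂ) * t)) * (shift (fun n ↦ logWeight n t) n : ℝ)) with hH'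
  have hd (t : ℝ) (ht : 0 < t) : HasDerivAt H (H' t) t := by
    have e1 : HasDerivAt (fun t : ℝ ↦ Complex.exp (-((x : ℂ) * t)))
        (Complex.exp (-((x : ℂ) * t)) * -(x : ℂ)) t := by
      have : HasDerivAt (fun t : ℝ ↦ -((x : ℂ) * t)) (-(x : ℂ)) t := by
        simpa using! ((hasDerivAt_id t).ofReal_comp.const_mul (x : ℂ)).neg
      exact this.cexp
    have e2 : HasDerivAt (fun t ↦ -(x * (t ^ 2 * logWeight n t)) - logWeightDeriv n t) _ t :=
      ((((hasDerivAt_pow 2 t).mul (hasDerivAt_logWeight n ht)).const_mul x).neg.sub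
        (hasDerivAt_logWeightDeriv n ht))
    refine HasDerivAt.congr_deriv (e1.mul e2.ofReal_comp) ?_
    have ht' : (t : ℂ) ≠ 0 := by exact_mod_cast ht.ne'
    simp only [hH']
    push_cast
    field_simp
    ring
  have i2 := hw.integrableOn 2 hxr
  have i1 := hw.integrableOn 1 hxr
  have j1 := integrableOn_exp_mul_shift hx n
  have j2 := integrableOn_exp_mul_shift_shift hx n
  have hlim : Tendsto H atTop (𝓝 0) := by
    have h1 := (tendsto_rpow_mul_exp_neg_mul_atTop_nhds_zero 3 x hx).const_mul (2 * x + 3)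
    rw [mul_zero] at h1
    refine squeeze_zero_norm' ?_ h1
    filter_upwards [eventually_gt_atTop 1] with t ht
    have ht0 : 0 < t := by linarith
    have hb := hw.bound t ht
    have hv := abs_logWeightDeriv_le n ht
    rw [hH, norm_mul, Complex.norm_exp, Complex.norm_real, Real.norm_eq_abs, Complex.neg_re,
      Complex.re_mul_ofReal, Complex.ofReal_re, show (3 : ℝ) = (3 : ℕ) by norm_num,
      Real.rpow_natCast, neg_mul, mul_comm (Real.exp _), ← mul_assoc (2 * x + _)]
    refine mul_le_mul_of_nonneg_right ?_ (Real.exp_pos _).le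
    have h2 := abs_sub (-(x * (t ^ 2 * logWeight n t))) (logWeightDeriv n t)
    rw [abs_neg, abs_mul, abs_mul, abs_of_pos hx, abs_of_pos (by positivity : 0 < t ^ 2)] at h2
    simp only [Nat.cast_one, one_pow, inv_one, mul_one, pow_one] at hb
    have h3 : x * (t ^ 2 * |logWeight n t|) ≤ x * (t ^ 2 * (2 * t)) := by gcongr
    have h4 : t ^ 2 ≤ t ^ 3 := pow_le_pow_right₀ ht.le (by norm_num)
    push_cast
    nlinarith
  have key := integral_Ioi_of_hasDerivAt_of_tendsto (a := 1) (f := H) (f' := H')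
    (hd 1 one_pos).continuousAt.continuousWithinAt
    (fun t ht ↦ hd t (zero_lt_one.trans ht))
    (((i2.const_mul _).sub (i1.const_mul _)).sub (j2.sub j1)) hlim
  have e1 := integral_sub (i2.const_mul ((x : ℂ) ^ 2)) (i1.const_mul (2 * (x : ℂ)))
  rw [integral_const_mul, integral_const_mul] at e1
  have e2 := integral_sub j2 j1
  rw [integral_exp_mul_shift_shift, integral_exp_mul_shift] at e2
  have e3 := (integral_sub ((i2.const_mul ((x : ℂ) ^ 2)).sub (i1.const_mul (2 * (x : ℂ))))
    (j2.sub j1)).trans (congrArg₂ (· - ·) e1 e2)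
  have e4 := e3.symm.trans key
  rw [laplaceSymbol, laplaceSymbol, laplace, laplace, pow_one, ← mul_assoc, ← sub_eq_iff_eq_add,
    e4, hH]
  push_cast
  simp
  ring

/-- Since `log 1 = 0`, boundary terms survive only for `n = 0`; in `logWeightDeriv` at `n = 1` the
two shifted contributions cancel. -/
theorem logWeight_one (n : ℕ) : logWeight n 1 = if n = 0 then 2 else 0 := by
  rcases n with _ | n <;> simp [logWeight, logPow]
  norm_num

theorem logWeightDeriv_one (n : ℕ) : logWeightDeriv n 1 = if n = 0 then -1 else 0 := by
  rcases n with _ | _ | n <;> simp [logWeightDeriv, logPow, shift]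

/-- The Taylor coefficients at `s = 0` of the completed Eisenstein series stripped of its poles. -/
def eisensteinCoeff (n : ℕ) (z : ℂ) : ℂ := latticeSum (laplaceSymbol (logWeight n)) 0 0 0 z

theorem eisensteinCoeff_eq_tsum (n : ℕ) (z : ℂ) : eisensteinCoeff n z =
    ∑' p : Lattice, laplaceSymbol (logWeight n) 0 (Real.pi * quad z p : ℝ) := by
  simp [eisensteinCoeff, latticeSum, latticeTerm]

theorem summable_laplaceSymbol (n l : ℕ) {z : ℂ} (hz : 0 < z.im) :
    Summable fun p : Lattice ↦ laplaceSymbol (logWeight n) l (Real.pi * quad z p : ℝ) := by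
  simpa [latticeTerm] using summable_latticeTerm (isSymbolSeq_logWeight n) 0 0 l hz

theorem summable_shift {ι : Type*} {f : ℕ → ι → ℂ} (hf : ∀ n, Summable (f n)) (n : ℕ) :
    Summable fun i ↦ shift (fun n ↦ f n i) n := by
  rcases n with _ | n
  · exact summable_zero
  · exact hf n

theorem tsum_shift {ι : Type*} (f : ℕ → ι → ℂ) (n : ℕ) :
    ∑' i, shift (fun n ↦ f n i) n = shift (fun n ↦ ∑' i, f n i) n := by
  rcases n with _ | n
  · exact tsum_zero
  · rfl

/-- The coefficientwise form of the eigenvalue equation with eigenvalue `s(s-1)`. The inhomogeneous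
term is the lattice sum of the boundary terms, evaluated by the theta identity. -/
theorem sq_im_mul_laplacian_eisensteinCoeff (n : ℕ) {z : ℂ} (hz : 0 < z.im) :
    (z.im : ℂ) ^ 2 * Δ (eisensteinCoeff n) z = (if n = 0 then 1 else 0) +
      (shift (shift fun n ↦ eisensteinCoeff n z) n - shift (fun n ↦ eisensteinCoeff n z) n) := by
  have hs (n : ℕ) := summable_laplaceSymbol n 0 hz
  have hs1 := summable_shift hs
  have hs2 := summable_shift hs1
  have h1 := tsum_two_mul_sub_one_mul_exp hz
  have hE : Summable fun p : Lattice ↦ (((Real.pi * quad z p * logWeight n 1 + logWeightDeriv n 1) *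
      Real.exp (-(Real.pi * quad z p)) : ℝ) : ℂ) := by
    have e := ((summable_laplaceSymbol n 2 hz).sub
      ((summable_laplaceSymbol n 1 hz).mul_left 2)).sub ((hs2 n).sub (hs1 n))
    refine e.congr fun p ↦ ?_
    rw [laplaceSymbol_two_sub (mul_pos Real.pi_pos (quad_pos hz p.2)) n, add_sub_cancel_right]
  have hE' : ∑' p : Lattice, (((Real.pi * quad z p * logWeight n 1 + logWeightDeriv n 1) *
      Real.exp (-(Real.pi * quad z p)) : ℝ) : ℂ) = if n = 0 then 1 else 0 := by
    rw [← Complex.ofReal_tsum]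
    simp only [logWeight_one, logWeightDeriv_one]
    split_ifs with h
    · rw [← Complex.ofReal_one]
      refine congrArg _ (Eq.trans ?_ h1)
      exact tsum_congr fun p ↦ by ring
    · simp
  change (z.im : ℂ) ^ 2 * Δ (latticeSum (laplaceSymbol (logWeight n)) 0 0 0) z = _
  rw [sq_im_mul_laplacian_latticeSum (isSymbolSeq_logWeight n) hz, ← hE']
  simp only [eisensteinCoeff_eq_tsum]
  have h2 := (tsum_shift (fun n (p : Lattice) ↦ shift (fun n ↦ laplaceSymbol (logWeight n) 0
    (Real.pi * quad z p : ℝ)) n) n).trans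
    (congrArg (fun c ↦ shift c n) (funext fun n ↦ tsum_shift _ n))
  rw [← h2, ← tsum_shift, ← (hs2 n).tsum_sub (hs1 n),
    ← hE.tsum_add ((hs2 n).sub (hs1 n))]
  exact tsum_congr fun p ↦ laplaceSymbol_two_sub (mul_pos Real.pi_pos (quad_pos hz p.2)) n

/-! ### Analytic continuation of the Eisenstein series -/

/-- The theta series without its constant term. -/
def cuspTheta (z : ℂ) (t : ℝ) : ℝ := ∑' p : Lattice, Real.exp (-(Real.pi * t * quad z p))

theorem cuspTheta_inv {z : ℂ} (hz : 0 < z.im) {t : ℝ} (ht : 0 < t) :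
    cuspTheta z t⁻¹ = t * cuspTheta z t + t - 1 := by
  have h := theta_inv hz ht
  rw [theta_eq_one_add hz (inv_pos.2 ht), theta_eq_one_add hz ht] at h
  unfold cuspTheta
  linarith

theorem continuousOn_cuspTheta {z : ℂ} (hz : 0 < z.im) : ContinuousOn (cuspTheta z) (Set.Ioi 1) := by
  refine continuousOn_tsum (fun p ↦ by fun_prop) (summable_exp_lattice hz Real.pi_pos)
    fun p t ht ↦ ?_
  rw [Real.norm_of_nonneg (Real.exp_pos _).le]
  refine Real.exp_le_exp.2 (neg_le_neg (mul_le_mul_of_nonneg_right ?_ (quad_nonneg hz _)))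
  exact le_mul_of_one_le_right Real.pi_pos.le (le_of_lt ht)

theorem exists_cuspTheta_le {z : ℂ} (hz : 0 < z.im) {k : ℕ} (hk : 2 ≤ k) :
    ∃ C, ∀ t, 0 < t → ‖cuspTheta z t‖ ≤ C * (t ^ k)⁻¹ := by
  refine ⟨(k.factorial * (Real.pi ^ k)⁻¹) * ∑' p : Lattice, (quad z p ^ k)⁻¹, fun t ht ↦ ?_⟩
  have hs : HasSum (fun p : Lattice ↦ k.factorial * (Real.pi ^ k)⁻¹ * (t ^ k)⁻¹ * (quad z p ^ k)⁻¹)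
      _ := (summable_quad_pow hz hk).hasSum.mul_left _
  have h := tsum_of_norm_bounded (f := fun p : Lattice ↦ Real.exp (-(Real.pi * t * quad z p))) hs
    fun p ↦ ?_
  · refine h.trans (le_of_eq ?_)
    ring
  · have hq := quad_pos hz p.2
    rw [Real.norm_of_nonneg (Real.exp_pos _).le]
    refine (exp_neg_le (by positivity) k).trans (le_of_eq ?_)
    rw [mul_pow, mul_pow, mul_inv, mul_inv]
    ring

theorem integrableOn_cpow_mul_cuspTheta {z : ℂ} (hz : 0 < z.im) (s : ℂ) :
    IntegrableOn (fun t : ℝ ↦ (t : ℂ) ^ s * (cuspTheta z t : ℂ)) (Set.Ioi 1) := by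
  obtain ⟨k, hk⟩ := exists_nat_gt (s.re + 2)
  obtain ⟨C, hC⟩ := exists_cuspTheta_le hz (k := k + 2) (by omega)
  have hi : IntegrableOn (fun t : ℝ ↦ C * t ^ (s.re - (k + 2 : ℕ))) (Set.Ioi 1) :=
    (integrableOn_Ioi_rpow_of_lt (by push_cast; linarith) one_pos).const_mul C
  refine Integrable.mono' hi ?_ ?_
  · refine ContinuousOn.aestronglyMeasurable (ContinuousOn.mul (fun t ht ↦ ?_)
      (Complex.continuous_ofReal.comp_continuousOn (continuousOn_cuspTheta hz))) measurableSet_Ioi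
    exact (Complex.continuousAt_ofReal_cpow_const _ _
      (Or.inr (zero_lt_one.trans ht).ne')).continuousWithinAt
  · filter_upwards [ae_restrict_mem measurableSet_Ioi] with t ht
    have ht0 : 0 < t := zero_lt_one.trans ht
    rw [norm_mul, Complex.norm_cpow_eq_rpow_re_of_pos ht0, Complex.norm_real,
      Real.rpow_sub ht0, Real.rpow_natCast]
    calc _ ≤ t ^ s.re * (C * (t ^ (k + 2))⁻¹) :=
          mul_le_mul_of_nonneg_left (hC t ht0) (by positivity)
      _ = _ := by ring

theorem hasMellin_indicator_Ioi {g : ℝ → ℂ} {s : ℂ}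
    (hg : IntegrableOn (fun t : ℝ ↦ (t : ℂ) ^ (s - 1) * g t) (Set.Ioi 1)) :
    HasMellin ((Set.Ioi 1).indicator g) s (∫ t in Set.Ioi (1 : ℝ), (t : ℂ) ^ (s - 1) * g t) := by
  have h1 : (fun t : ℝ ↦ (t : ℂ) ^ (s - 1) • (Set.Ioi 1).indicator g t) =
      (Set.Ioi 1).indicator fun t : ℝ ↦ (t : ℂ) ^ (s - 1) * g t := by
    funext t
    by_cases ht : t ∈ Set.Ioi 1 <;> simp [ht]
  have h2 : Set.Ioi (1 : ℝ) ∩ Set.Ioi 0 = Set.Ioi 1 :=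
    Set.inter_eq_left.2 (Set.Ioi_subset_Ioi zero_le_one)
  constructor
  · rw [MellinConvergent, h1]
    exact ((integrable_indicator_iff measurableSet_Ioi).2 hg).integrableOn
  · rw [mellin, h1, setIntegral_indicator measurableSet_Ioi, Set.inter_comm, h2]

/-- Riemann's splitting at `t = 1`: inversion folds `(0, 1)` onto `(1, ∞)`, and the elementary part
`t - 1` of the functional equation integrates to the polar terms. -/
theorem mellin_cuspTheta {z : ℂ} (hz : 0 < z.im) {s : ℂ} (hs : 1 < s.re) :
    mellin (fun t ↦ (cuspTheta z t : ℂ)) s =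
      (∫ t in Set.Ioi (1 : ℝ), ((t : ℂ) ^ (s - 1) + (t : ℂ) ^ (-s)) * (cuspTheta z t : ℂ)) +
        (1 / (s - 1) - 1 / s) := by
  set Φ : ℝ → ℂ := fun t ↦ (cuspTheta z t : ℂ) with hΦ
  -- By the functional equation, `g t = Φ t⁻¹` for positive `t`.
  set g : ℝ → ℂ := fun t ↦ t * Φ t + (t - 1) with hg
  have i1 := integrableOn_cpow_mul_cuspTheta hz (s - 1)
  have i2 := integrableOn_cpow_mul_cuspTheta hz (-s)
  have i3 := integrableOn_Ioi_cpow_of_lt (a := -s) (by simpa using hs) one_pos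
  have i4 := integrableOn_Ioi_cpow_of_lt (a := -s - 1) (by simp; linarith) one_pos
  have hs0 : s ≠ 0 := by rintro rfl; norm_num at hs
  have hs1 : s - 1 ≠ 0 := by
    intro h
    rw [sub_eq_zero.1 h] at hs
    simp at hs
  have hgeq (t : ℝ) (ht : t ∈ Set.Ioi 1) : (t : ℂ) ^ (-s) * Φ t + ((t : ℂ) ^ (-s) -
      (t : ℂ) ^ (-s - 1)) = (t : ℂ) ^ (-s - 1) * g t := by
    have ht0 : (t : ℂ) ≠ 0 := by exact_mod_cast (zero_lt_one.trans ht).ne'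
    have : (t : ℂ) ^ (-s) = (t : ℂ) ^ (-s - 1) * t := by
      rw [Complex.cpow_sub _ _ ht0, Complex.cpow_one]
      field_simp
    rw [this, hg]
    ring
  have m1 := hasMellin_indicator_Ioi (g := Φ) i1
  have m2 := hasMellin_indicator_Ioi (g := g) (s := -s)
    (IntegrableOn.congr_fun (i2.add (i3.sub i4)) hgeq measurableSet_Ioi)
  have m3 : MellinConvergent (fun t ↦ (Set.Ioi 1).indicator g t⁻¹) s := by
    have := (MellinConvergent.comp_rpow (f := (Set.Ioi 1).indicator g) (s := s) (a := -1)
      (by norm_num)).2 (by simpa [div_neg] using m2.1)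
    simpa only [Real.rpow_neg_one] using this
  have e1 : mellin Φ s = mellin (fun t ↦ (Set.Ioi 1).indicator Φ t +
      (Set.Ioi 1).indicator g t⁻¹) s := by
    refine integral_congr_ae ?_
    -- The point `t = 1` belongs to neither indicator and has measure zero.
    have hne : ∀ᵐ t ∂volume.restrict (Set.Ioi (0 : ℝ)), t ≠ 1 :=
      ae_restrict_of_ae (by simp [ae_iff])
    filter_upwards [ae_restrict_mem measurableSet_Ioi, hne] with t ht ht1
    have ht0 : 0 < t := ht
    congr 1
    rcases lt_or_gt_of_ne ht1 with h | h
    · have h' : 1 < t⁻¹ := (one_lt_inv₀ ht0).2 h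
      rw [Set.indicator_of_notMem (by simpa using h.le), Set.indicator_of_mem (by exact h'),
        zero_add, hg]
      have := cuspTheta_inv hz (inv_pos.2 ht0)
      rw [inv_inv] at this
      simp only [hΦ, this]
      push_cast
      ring
    · have h' : t⁻¹ ≤ 1 := inv_le_one_of_one_le₀ h.le
      rw [Set.indicator_of_mem (by exact h), Set.indicator_of_notMem (by simpa using h'), add_zero]
  rw [e1, (hasMellin_add m1.1 m3).2, m1.2, mellin_comp_inv, m2.2,
    ← setIntegral_congr_fun measurableSet_Ioi hgeq]
  have e2 := (integral_add i2 (i3.sub i4)).trans (congrArg _ (integral_sub i3 i4))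
  have e3 := integral_add i1 i2
  rw [integral_Ioi_cpow_of_lt (by simpa using hs) one_pos,
    integral_Ioi_cpow_of_lt (by simp; linarith) one_pos] at e2
  refine (congrArg _ e2).trans ?_
  simp only [add_mul]
  rw [e3]
  have h5 : -s + 1 ≠ 0 := by rwa [neg_add_eq_sub, ← neg_sub, neg_ne_zero]
  simp only [Complex.ofReal_one, Complex.one_cpow, sub_add_cancel]
  rw [show -s + 1 = -(s - 1) by ring]
  field_simp
  ring

theorem hasSum_cpow_logPow {t : ℝ} (ht : 0 < t) (s : ℂ) :
    HasSum (fun n ↦ s ^ n * (logPow n t : ℂ)) ((t : ℂ) ^ s) := by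
  have h := NormedSpace.expSeries_div_hasSum_exp (𝔸 := ℂ) (Real.log t * s)
  rw [← Complex.exp_eq_exp_ℂ, Complex.ofReal_log ht.le,
    ← Complex.cpow_def_of_ne_zero (by exact_mod_cast ht.ne'), ← Complex.ofReal_log ht.le] at h
  refine h.congr_fun fun n ↦ ?_
  rw [logPow]
  push_cast
  ring

theorem hasSum_logWeight {t : ℝ} (ht : 0 < t) (s : ℂ) :
    HasSum (fun n ↦ s ^ n * (logWeight n t : ℂ)) ((t : ℂ) ^ (s - 1) + (t : ℂ) ^ (-s)) := by
  have ht0 : (t : ℂ) ≠ 0 := by exact_mod_cast ht.ne'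
  rw [Complex.cpow_sub _ _ ht0, Complex.cpow_one]
  refine HasSum.congr_fun (((hasSum_cpow_logPow ht s).div_const (t : ℂ)).add
    (hasSum_cpow_logPow ht (-s))) fun n ↦ ?_
  rw [logWeight, neg_pow s n]
  push_cast
  field_simp

/-- The weight is expanded in powers of `s` and the theta series over the lattice; both sums are
exchanged with the integral at once, as one sum over `ℕ × Lattice`. -/
theorem hasSum_eisensteinCoeff {z : ℂ} (hz : 0 < z.im) (s : ℂ) :
    HasSum (fun n ↦ s ^ n * eisensteinCoeff n z)
      (∫ t in Set.Ioi (1 : ℝ), ((t : ℂ) ^ (s - 1) + (t : ℂ) ^ (-s)) * (cuspTheta z t : ℂ)) := by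
  -- With `K > ‖s‖` the sum over `n` is dominated by the geometric series of ratio `‖s‖ / K`; the
  -- cost is the harmless power `quad^{-(K+1)}`.
  obtain ⟨K, hK⟩ := exists_nat_gt ‖s‖
  have hK0 : K ≠ 0 := by
    rintro rfl
    exact absurd hK (by simp)
  have hKpos : (0 : ℝ) < K := by exact_mod_cast Nat.pos_of_ne_zero hK0
  have hq (p : Lattice) : 0 < Real.pi * quad z p := mul_pos Real.pi_pos (quad_pos hz p.2)
  set T : ℕ × Lattice → ℝ → ℂ := fun q t ↦ s ^ q.1 *
    (Complex.exp (-(((Real.pi * quad z q.2 : ℝ) : ℂ) * t)) * (t ^ 0 * logWeight q.1 t : ℝ)) with hT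
  have hInt (q : ℕ × Lattice) : Integrable (T q) (volume.restrict (Set.Ioi 1)) :=
    ((isWeight_logWeight q.1 hK0).integrableOn 0 (by simpa using hq q.2)).const_mul _
  have hsumb : Summable fun q : ℕ × Lattice ↦ (‖s‖ / K) ^ q.1 *
      (2 * (K.factorial * (Real.pi ^ (K + 1))⁻¹) * (quad z q.2 ^ (K + 1))⁻¹) := by
    refine Summable.mul_of_nonneg (summable_geometric_of_lt_one (by positivity) ?_)
      ((summable_quad_pow hz (k := K + 1) (by omega)).mul_left _) (fun n ↦ by positivity) fun p ↦ ?_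
    · rwa [div_lt_one hKpos]
    · have := quad_pos hz p.2
      positivity
  have hsum : Summable fun q : ℕ × Lattice ↦ ∫ t in Set.Ioi (1 : ℝ), ‖T q t‖ := by
    refine Summable.of_nonneg_of_le (fun q ↦ integral_nonneg fun _ ↦ norm_nonneg _) (fun q ↦ ?_)
      hsumb
    have h := (isWeight_logWeight q.1 hK0).integral_norm_le 0 (hq q.2)
    simp only [hT, norm_mul (s ^ q.1)]
    rw [integral_const_mul]
    refine (mul_le_mul_of_nonneg_left h (norm_nonneg _)).trans (le_of_eq ?_)
    rw [norm_pow, div_pow, add_zero, mul_pow, mul_inv]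
    field_simp
  have hS := hasSum_integral_of_summable_integral_norm hInt hsum
  have hv : ∫ t in Set.Ioi (1 : ℝ), ∑' q, T q t = ∫ t in Set.Ioi (1 : ℝ),
      ((t : ℂ) ^ (s - 1) + (t : ℂ) ^ (-s)) * (cuspTheta z t : ℂ) := by
    refine setIntegral_congr_fun measurableSet_Ioi fun t ht ↦ ?_
    have ht0 : 0 < t := zero_lt_one.trans ht
    have h1 := hasSum_logWeight ht0 s
    have h2 : Summable fun p : Lattice ↦ (Real.exp (-(Real.pi * t * quad z p)) : ℂ) :=
      Complex.summable_ofReal.2 (summable_exp_lattice hz (by positivity))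
    have h3 := tsum_mul_tsum_of_summable_norm h1.summable.norm h2.norm
    rw [h1.tsum_eq, ← Complex.ofReal_tsum] at h3
    refine Eq.trans (tsum_congr fun q ↦ ?_) h3.symm
    simp only [hT, pow_zero, one_mul]
    push_cast
    ring_nf
  rw [hv] at hS
  refine hS.prod_fiberwise fun n ↦ ?_
  rw [eisensteinCoeff_eq_tsum]
  refine HasSum.congr_fun ((summable_laplaceSymbol n 0 hz).hasSum.mul_left _) fun p ↦ ?_
  simp only [hT]
  rw [integral_const_mul, laplaceSymbol, pow_zero, one_mul, laplace]

theorem cpow_im_div_norm (z : ℍ) (p : Lattice) (s : ℂ) :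
    (z.im : ℂ) ^ s / ((‖(p.1.1 : ℂ) * z + p.1.2‖ : ℝ) : ℂ) ^ (2 * s) =
      ((quad z p : ℝ) : ℂ) ^ (-s) := by
  have hN : 0 < ‖(p.1.1 : ℂ) * z + p.1.2‖ :=
    norm_pos_iff.2 (linear_ne_zero_of_im_pos (z := z) z.im_pos p.2)
  set N := ‖(p.1.1 : ℂ) * z + p.1.2‖ with hNdef
  have h1 : quad z p = N ^ 2 * (z.im)⁻¹ := by
    rw [quad, hNdef, Complex.sq_norm]
    rfl
  have hy : (0 : ℝ) < z.im := z.im_pos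
  have hNc : (N : ℂ) ≠ 0 := by exact_mod_cast hN.ne'
  have hyc : (z.im : ℂ) ≠ 0 := by exact_mod_cast hy.ne'
  rw [h1, Complex.ofReal_mul, Complex.mul_cpow_ofReal_nonneg (by positivity) (by positivity),
    Complex.cpow_neg, Complex.cpow_neg, Complex.ofReal_inv, Complex.inv_cpow, inv_inv,
    two_mul, Complex.cpow_add _ _ hNc, sq, Complex.ofReal_mul,
    Complex.mul_cpow_ofReal_nonneg hN.le hN.le]
  · field_simp
  · rw [Complex.arg_ofReal_of_nonneg hy.le]
    exact Real.pi_pos.ne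

/-- The Mellin transform of `e^{-π Q t}` is `Γ(s) (π Q)^{-s}`; summing over the lattice gives the
series without its factor `1/2`. -/
theorem completed_eisenstein_eq (z : ℍ) {s : ℂ} (hs : 1 < s.re) :
    (Real.pi : ℂ) ^ (-s) * Complex.Gamma s * eisenstein z s =
      1 / 2 * mellin (fun t ↦ (cuspTheta z t : ℂ)) s := by
  have hq (p : Lattice) : 0 < quad z p := quad_pos z.im_pos p.2
  have h := hasSum_mellin (ι := Lattice) (a := fun _ ↦ 1) (p := fun p ↦ Real.pi * quad z p)
    (F := fun t ↦ (cuspTheta z t : ℂ)) (s := s)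
    (fun p ↦ Or.inr (mul_pos Real.pi_pos (hq p))) (by linarith) (fun t ht ↦ ?_) ?_
  · rw [← h.tsum_eq, eisenstein, mul_left_comm, ← tsum_mul_left]
    congr 1
    refine tsum_congr fun p ↦ ?_
    rw [cpow_im_div_norm, Complex.ofReal_mul,
      Complex.mul_cpow_ofReal_nonneg Real.pi_pos.le (hq p).le, Complex.cpow_neg, Complex.cpow_neg]
    have h1 : (Real.pi : ℂ) ^ s ≠ 0 := by simp [Complex.cpow_eq_zero_iff, Real.pi_ne_zero]
    have h2 : (quad z p : ℂ) ^ s ≠ 0 := by simp [Complex.cpow_eq_zero_iff, (hq p).ne']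
    field_simp
  · have h2 : Summable fun p : Lattice ↦ (Real.exp (-(Real.pi * t * quad z p)) : ℂ) :=
      Complex.summable_ofReal.2 (summable_exp_lattice z.im_pos (mul_pos Real.pi_pos ht))
    simp only [cuspTheta, Complex.ofReal_tsum]
    refine HasSum.congr_fun h2.hasSum fun p ↦ ?_
    rw [one_mul]
    congr 2
    ring
  · refine ((summable_quad_rpow z.im_pos hs).mul_left (Real.pi ^ s.re)⁻¹).congr fun p ↦ ?_
    rw [Real.mul_rpow Real.pi_pos.le (hq p).le, norm_one, one_div, mul_inv]

/-! ### Taylor coefficients of an everywhere convergent power series. -/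

theorem hasFPowerSeriesOnBall_of_hasSum {d : ℕ → ℂ} {G : ℂ → ℂ}
    (h : ∀ s, HasSum (fun n ↦ s ^ n * d n) (G s)) :
    HasFPowerSeriesOnBall G (FormalMultilinearSeries.ofScalars ℂ d) 0 ⊤ where
  r_le := by
    refine le_of_eq (Eq.symm ?_)
    refine FormalMultilinearSeries.radius_eq_top_of_summable_norm _ fun r ↦ ?_
    have := (h (r : ℝ)).summable.norm
    refine this.congr fun n ↦ ?_
    rw [FormalMultilinearSeries.ofScalars_norm, norm_mul, norm_pow, mul_comm]
    simp
  r_pos := by simp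
  hasSum {y} _ := by
    rw [zero_add]
    refine HasSum.congr_fun (h y) fun n ↦ ?_
    rw [FormalMultilinearSeries.ofScalars_apply_eq, smul_eq_mul, mul_comm]

theorem iteratedDeriv_zero_div_factorial_of_hasSum {d : ℕ → ℂ} {G : ℂ → ℂ}
    (h : ∀ s, HasSum (fun n ↦ s ^ n * d n) (G s)) (n : ℕ) :
    iteratedDeriv n G 0 / n.factorial = d n := by
  have h1 := (hasFPowerSeriesOnBall_of_hasSum h).factorial_smul (y := 1) n
  rw [FormalMultilinearSeries.ofScalars_apply_eq, one_pow, smul_eq_mul, mul_one,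
    nsmul_eq_mul] at h1
  rw [iteratedDeriv_eq_iteratedFDeriv, ← h1,
    mul_div_cancel_left₀ _ (Nat.cast_ne_zero.2 n.factorial_ne_zero)]

theorem differentiable_of_hasSum {d : ℕ → ℂ} {G : ℂ → ℂ}
    (h : ∀ s, HasSum (fun n ↦ s ^ n * d n) (G s)) : Differentiable ℂ G := fun s ↦
  ((hasFPowerSeriesOnBall_of_hasSum h).analyticOnNhd s (by simp)).differentiableAt

theorem hasSum_shift {d : ℕ → ℂ} {s g : ℂ} (h : HasSum (fun n ↦ s ^ n * d n) g) :
    HasSum (fun n ↦ s ^ n * shift d n) (s * g) := by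
  rw [← hasSum_nat_add_iff' 1]
  simp only [Finset.range_one, Finset.sum_singleton, shift, mul_zero, sub_zero]
  refine HasSum.congr_fun (h.mul_left s) fun n ↦ ?_
  ring

/-- The Taylor coefficients at `s = 0` of the doubly completed Eisenstein series. -/
def doublyCompletedCoeff (n : ℕ) (z : ℂ) : ℂ :=
  1 / 2 * ((if n = 0 then 1 else 0) +
    (shift (shift fun n ↦ eisensteinCoeff n z) n - shift (fun n ↦ eisensteinCoeff n z) n))

/-- The constant `1` is `s(s-1) (1/(s-1) - 1/s)`, the contribution of the two poles; the factor
`s(s-1)` acts on coefficients as a double shift minus a single one. -/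
theorem hasSum_doublyCompletedCoeff {z : ℂ} (hz : 0 < z.im) (s : ℂ) :
    HasSum (fun n ↦ s ^ n * doublyCompletedCoeff n z) (1 / 2 * (1 + s * (s - 1) *
      ∫ t in Set.Ioi (1 : ℝ), ((t : ℂ) ^ (s - 1) + (t : ℂ) ^ (-s)) * (cuspTheta z t : ℂ))) := by
  have h0 : HasSum (fun n : ℕ ↦ s ^ n * (if n = 0 then (1 : ℂ) else 0)) 1 := by
    have := hasSum_single (f := fun n : ℕ ↦ s ^ n * (if n = 0 then (1 : ℂ) else 0)) 0
      fun n hn ↦ by simp [hn]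
    simpa using this
  have h1 := hasSum_shift (hasSum_eisensteinCoeff hz s)
  have h2 := hasSum_shift h1
  have h3 := (h0.add (h2.sub h1)).mul_left (1 / 2)
  have e : s * (s - 1) *
      (∫ t in Set.Ioi (1 : ℝ), ((t : ℂ) ^ (s - 1) + (t : ℂ) ^ (-s)) * (cuspTheta z t : ℂ)) = _ :=
    show _ = s * (s * ∫ t in Set.Ioi (1 : ℝ), ((t : ℂ) ^ (s - 1) + (t : ℂ) ^ (-s)) *
      (cuspTheta z t : ℂ)) - s * ∫ t in Set.Ioi (1 : ℝ), ((t : ℂ) ^ (s - 1) + (t : ℂ) ^ (-s)) *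
      (cuspTheta z t : ℂ) by ring
  rw [e]
  refine HasSum.congr_fun h3 fun n ↦ ?_
  rw [doublyCompletedCoeff]
  ring

theorem exists_isDoublyCompleted (z : ℍ) : ∃ G, IsDoublyCompleted z G ∧
    ∀ s, HasSum (fun n ↦ s ^ n * doublyCompletedCoeff n z) (G s) := by
  refine ⟨_, ⟨?_, fun s hs ↦ ?_⟩, fun s ↦ hasSum_doublyCompletedCoeff z.im_pos s⟩
  · exact differentiable_of_hasSum fun s ↦ hasSum_doublyCompletedCoeff z.im_pos s
  · have hs0 : s ≠ 0 := by rintro rfl; norm_num at hs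
    have hs1 : s - 1 ≠ 0 := by
      intro h
      rw [sub_eq_zero.1 h] at hs
      simp at hs
    rw [mul_assoc (s * (s - 1)), mul_assoc (s * (s - 1)),
      completed_eisenstein_eq z hs, mellin_cuspTheta z.im_pos hs]
    field_simp
    ring

theorem isDoublyCompleted_doublyCompletedEisenstein (z : ℍ) :
    IsDoublyCompleted z (doublyCompletedEisenstein z) :=
  Classical.epsilon_spec ((exists_isDoublyCompleted z).imp fun _ h ↦ h.1)

theorem F_eq_doublyCompletedCoeff (n : ℕ) (z : ℍ) : F n z = doublyCompletedCoeff n z := by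
  obtain ⟨G, hG, hsum⟩ := exists_isDoublyCompleted z
  rw [F, (isDoublyCompleted_doublyCompletedEisenstein z).unique hG]
  exact iteratedDeriv_zero_div_factorial_of_hasSum hsum n

/-! ### The Taylor coefficients as automorphic functions -/

/-- Right multiplication of integral row vectors by a matrix in `SL(2, ℤ)`. -/
def rowMul (γ : SL(2, ℤ)) : ℤ × ℤ ≃+ ℤ × ℤ where
  toFun p := (p.1 * γ 0 0 + p.2 * γ 1 0, p.1 * γ 0 1 + p.2 * γ 1 1)
  invFun p := (p.1 * γ 1 1 - p.2 * γ 1 0, p.2 * γ 0 0 - p.1 * γ 0 1)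
  left_inv p := by
    have h := γ.det_coe
    rw [Matrix.det_fin_two] at h
    ext
    · linear_combination p.1 * h
    · linear_combination p.2 * h
  right_inv p := by
    have h := γ.det_coe
    rw [Matrix.det_fin_two] at h
    ext
    · linear_combination p.1 * h
    · linear_combination p.2 * h
  map_add' p q := by
    ext <;> simp <;> ring

/-- Both `|m γz + n|²` and `Im γz` acquire the factor `|cz+d|⁻²`, which cancels and leaves the row
vector `(m, n)` multiplied by `γ`. -/
theorem quad_smul (γ : SL(2, ℤ)) (z : ℍ) (p : ℤ × ℤ) :
    quad (γ • z : ℍ) p = quad z (rowMul γ p) := by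
  have hd : (γ 1 0 * z + γ 1 1 : ℂ) ≠ 0 := by
    have := denom_ne_zero γ z
    rwa [ModularGroup.denom_apply] at this
  have h1 : (γ • z : ℍ).im = z.im / Complex.normSq (γ 1 0 * z + γ 1 1) := by
    rw [ModularGroup.im_smul_eq_div_normSq, ModularGroup.denom_apply]
  have h2 : ((γ • z : ℍ) : ℂ) = (γ 0 0 * z + γ 0 1) / (γ 1 0 * z + γ 1 1) := by
    rw [coe_specialLinearGroup_apply]
    simp
  have h3 : (p.1 * ((γ • z : ℍ) : ℂ) + p.2) =
      ((rowMul γ p).1 * z + (rowMul γ p).2) / (γ 1 0 * z + γ 1 1) := by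
    rw [h2, eq_div_iff hd, add_mul, mul_assoc, div_mul_cancel₀ _ hd]
    simp only [rowMul, AddEquiv.coe_mk, Equiv.coe_fn_mk]
    push_cast
    ring
  have h4 : Complex.normSq (γ 1 0 * z + γ 1 1) ≠ 0 := by simpa using hd
  rw [quad, quad, h3, Complex.normSq_div, coe_im, h1, coe_im,
    div_div_div_cancel_right₀ h4]

theorem eisensteinCoeff_smul (n : ℕ) (γ : SL(2, ℤ)) (z : ℍ) :
    eisensteinCoeff n (γ • z : ℍ) = eisensteinCoeff n z := by
  rw [eisensteinCoeff_eq_tsum, eisensteinCoeff_eq_tsum]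
  have h (p : ℤ × ℤ) : p ≠ 0 ↔ (rowMul γ).toEquiv p ≠ 0 :=
    (EmbeddingLike.map_ne_zero_iff (f := rowMul γ)).symm
  let e : Lattice ≃ Lattice := (rowMul γ).toEquiv.subtypeEquiv h
  rw [← e.tsum_eq fun p : Lattice ↦ laplaceSymbol (logWeight n) 0 (Real.pi * quad z p : ℝ)]
  exact tsum_congr fun p ↦ by rw [quad_smul]; rfl

theorem isSmooth_eisensteinCoeff (n : ℕ) : IsSmooth fun z : ℍ ↦ eisensteinCoeff n z := by
  refine (contDiffOn_latticeSum (isSymbolSeq_logWeight n) 0 0 0).congr fun z hz ↦ ?_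
  rw [Function.comp_apply, ofComplex_apply_of_im_pos hz]
  rfl

/-- The right side of the differential equation is, up to the factor 2, the formula for the Taylor
coefficient itself. -/
theorem hypLaplacian_eisensteinCoeff (n : ℕ) :
    hypLaplacian (fun z : ℍ ↦ eisensteinCoeff n z) = (2 : ℂ) • F n := by
  funext z
  have h : (fun z : ℍ ↦ eisensteinCoeff n z) ∘ ofComplex =ᶠ[𝓝 (z : ℂ)] eisensteinCoeff n := by
    filter_upwards [isOpen_upperHalfPlaneSet.mem_nhds z.im_pos] with w hw
    rw [Function.comp_apply, ofComplex_apply_of_im_pos hw]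
  rw [hypLaplacian, (InnerProductSpace.laplacian_congr_nhds h).eq_of_nhds]
  refine (sq_im_mul_laplacian_eisensteinCoeff n z.im_pos).trans ?_
  rw [Pi.smul_apply, F_eq_doublyCompletedCoeff, doublyCompletedCoeff, smul_eq_mul]
  ring

theorem exists_norm_eisensteinCoeff_le (n : ℕ) :
    ∃ C, ∀ z : ℍ, 1 ≤ z.im → ‖eisensteinCoeff n z‖ ≤ C * z.im ^ 2 := by
  obtain ⟨C, hC⟩ := (isSymbolSeq_logWeight n).bound 0
  have hC0 : 0 ≤ C := by simpa using (norm_nonneg _).trans (hC 1 one_pos)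
  set r := EisensteinSeries.r ⟨⟨1, 1⟩, one_pos⟩ with hr
  have hr0 : 0 < r := EisensteinSeries.r_pos _
  have hsum : Summable fun p : Lattice ↦ ((‖p.1‖ ^ 2) ^ 2)⁻¹ := by
    simpa using summable_norm_sq_rpow one_lt_two
  refine ⟨C * ((Real.pi * r ^ 2) ^ 2)⁻¹ * ∑' p : Lattice, ((‖p.1‖ ^ 2) ^ 2)⁻¹, fun z hz ↦ ?_⟩
  -- Translation invariance reduces to the strip `|x| ≤ 1`, making the bound uniform in `x`. There
  -- the decay `x⁻²` of the symbol and `quad ≥ r² ‖p‖² / y` produce `y²`.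
  obtain ⟨k, hk⟩ := ModularGroup_T_zpow_mem_verticalStrip z one_pos
  set γ := ModularGroup.T ^ (((1 : ℕ) : ℤ) * k) with hγ
  have him : (γ • z).im = z.im := by
    rw [hγ, modular_T_zpow_smul, vadd_im]
  have hstrip : γ • z ∈ verticalStrip 1 1 := ⟨by simpa using hk.1, by rw [him]; exact hz⟩
  rw [← eisensteinCoeff_smul n γ z, eisensteinCoeff_eq_tsum]
  have hs : HasSum (fun p : Lattice ↦ C * ((Real.pi * r ^ 2) ^ 2)⁻¹ * z.im ^ 2 *
      ((‖p.1‖ ^ 2) ^ 2)⁻¹) _ := hsum.hasSum.mul_left _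
  refine (tsum_of_norm_bounded hs fun p ↦ ?_).trans (le_of_eq (by ring))
  have hq := quad_ge_of_mem_verticalStrip one_pos hstrip p.2
  rw [him] at hq
  have hq0 := quad_pos (γ • z).im_pos p.2
  have hp : 0 < ‖p.1‖ := norm_pos_iff.2 p.2
  have hy := z.im_pos
  refine (hC _ (mul_pos Real.pi_pos hq0)).trans ?_
  calc C * ((Real.pi * quad (γ • z : ℍ) p) ^ 2)⁻¹
      ≤ C * ((Real.pi * (r ^ 2 * ‖p.1‖ ^ 2 / z.im)) ^ 2)⁻¹ := by
        have := Real.pi_pos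
        gcongr
    _ = _ := by field_simp

theorem eisensteinCoeff_mem (n : ℕ) :
    (fun z : ℍ ↦ eisensteinCoeff n z) ∈ automorphicFunctions := by
  refine ⟨isSmooth_eisensteinCoeff n, eisensteinCoeff_smul n, 2, ?_⟩
  obtain ⟨C, hC⟩ := exists_norm_eisensteinCoeff_le n
  refine IsBigO.of_bound C ?_
  filter_upwards [(atImInfty_mem {z | 1 ≤ z.im}).2 ⟨1, fun _ h ↦ h⟩] with z hz
  rw [Real.rpow_two, Real.norm_of_nonneg (by positivity)]
  exact hC z hz

/-! ### Constants, and the recursion satisfied by the Taylor coefficients. -/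

theorem const_mem_automorphicFunctions (c : ℂ) : (fun _ : ℍ ↦ c) ∈ automorphicFunctions :=
  ⟨contDiffOn_const, fun _ _ ↦ rfl, 0, by simpa using isBigO_const_const c (one_ne_zero (α := ℝ)) atImInfty⟩

theorem hypLaplacian_const (c : ℂ) : hypLaplacian (fun _ ↦ c) = 0 := by
  funext z
  have : (fun _ : ℍ ↦ c) ∘ ofComplex = fun _ : ℂ ↦ c := rfl
  simp [hypLaplacian, this]

theorem F_zero : F 0 = fun _ ↦ 1 / 2 := by
  funext z
  simp [F_eq_doublyCompletedCoeff, doublyCompletedCoeff, shift]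

theorem F_one : F 1 = (-1 / 2 : ℂ) • fun z : ℍ ↦ eisensteinCoeff 0 z := by
  funext z
  simp [F_eq_doublyCompletedCoeff, doublyCompletedCoeff, shift]
  ring

theorem F_add_two (n : ℕ) : F (n + 2) = (1 / 2 : ℂ) • (fun z : ℍ ↦ eisensteinCoeff n z) +
    (-1 / 2 : ℂ) • fun z : ℍ ↦ eisensteinCoeff (n + 1) z := by
  funext z
  simp [F_eq_doublyCompletedCoeff, doublyCompletedCoeff, shift]
  ring

theorem F_mem_automorphicFunctions : ∀ n, F n ∈ automorphicFunctions
  | 0 => by rw [F_zero]; exact const_mem_automorphicFunctions _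
  | 1 => by rw [F_one]; exact Submodule.smul_mem _ _ (eisensteinCoeff_mem 0)
  | n + 2 => by
    rw [F_add_two]
    exact add_mem (Submodule.smul_mem _ _ (eisensteinCoeff_mem n))
      (Submodule.smul_mem _ _ (eisensteinCoeff_mem (n + 1)))

theorem hypLaplacian_F_one : hypLaplacian (F 1) = (-1 : ℂ) • F 0 := by
  rw [F_one, hypLaplacian_smul _ (isSmooth_eisensteinCoeff 0), hypLaplacian_eisensteinCoeff,
    smul_smul]
  norm_num

/-- Again the eigenvalue `s² - s`, read off on coefficients. -/
theorem hypLaplacian_F_add_two (n : ℕ) :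
    hypLaplacian (F (n + 2)) = F n + (-1 : ℂ) • F (n + 1) := by
  rw [F_add_two, hypLaplacian_add ((isSmooth_eisensteinCoeff n).smul _)
    ((isSmooth_eisensteinCoeff (n + 1)).smul _), hypLaplacian_smul _ (isSmooth_eisensteinCoeff n),
    hypLaplacian_smul _ (isSmooth_eisensteinCoeff (n + 1)), hypLaplacian_eisensteinCoeff,
    hypLaplacian_eisensteinCoeff, smul_smul, smul_smul]
  norm_num

theorem iterate_hypLaplacian_F (n : ℕ) : hypLaplacian^[n] (F n) = fun _ ↦ (-1) ^ n / 2 := by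
  induction n using Nat.twoStepInduction with
  | zero => simp [F_zero]
  | one =>
    rw [Function.iterate_one, hypLaplacian_F_one, F_zero]
    funext z
    simp
    ring
  | more n h0 h1 =>
    -- In `Δ₀^{n+1} (F_n - F_{n+1})` the first term vanishes, being the Laplacian of a constant;
    -- only the sign changes.
    rw [Function.iterate_succ_apply, hypLaplacian_F_add_two,
      iterate_hypLaplacian_add _ (F_mem_automorphicFunctions n).1
        ((F_mem_automorphicFunctions (n + 1)).1.smul _),
      iterate_hypLaplacian_smul _ _ (F_mem_automorphicFunctions (n + 1)).1, h1,
      Function.iterate_succ_apply', h0, hypLaplacian_const]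
    funext z
    simp
    ring

/-! ### The spaces of polyharmonic Maass forms -/

theorem V_mono : Monotone V := by
  refine monotone_nat_of_le_succ fun m f hf ↦ ⟨hf.1, ?_⟩
  rw [Function.iterate_succ_apply', hf.2]
  exact hypLaplacian_const 0

theorem F_mem_V (n : ℕ) : F n ∈ V (n + 1) := by
  refine ⟨F_mem_automorphicFunctions n, ?_⟩
  rw [Function.iterate_succ_apply', iterate_hypLaplacian_F, hypLaplacian_const]

theorem F_notMem_V (n : ℕ) : F n ∉ V n := by
  intro h
  have h1 := congr_fun ((iterate_hypLaplacian_F n).symm.trans h.2) UpperHalfPlane.I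
  simp at h1

theorem exists_sub_smul_F_mem_V {m : ℕ} {f : ℍ → ℂ} (hf : f ∈ V (m + 1)) :
    ∃ c : ℂ, f - c • F m ∈ V m := by
  obtain ⟨c, hc⟩ := exists_iterate_hypLaplacian_eq_const hf.1 m hf.2
  have hF := F_mem_automorphicFunctions m
  -- The coefficient is `c` divided by the constant `(-1)^m / 2` of `iterate_hypLaplacian_F`.
  refine ⟨2 * (-1) ^ m * c, Submodule.sub_mem _ hf.1 (Submodule.smul_mem _ _ hF), ?_⟩
  rw [sub_eq_add_neg, ← neg_one_smul ℂ (_ • F m), smul_smul, iterate_hypLaplacian_add m hf.1.1 (hF.1.smul _),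
    iterate_hypLaplacian_smul m _ hF.1, hc, iterate_hypLaplacian_F]
  funext z
  have : ((-1 : ℂ) ^ m) * (-1) ^ m = 1 := by rw [← mul_pow]; simp
  simp only [Pi.add_apply, Pi.smul_apply, smul_eq_mul, Pi.zero_apply]
  linear_combination (-c) * this

theorem V_eq_span (m : ℕ) : V m = Submodule.span ℂ (Set.range fun i : Fin m ↦ F i) := by
  refine le_antisymm ?_ (Submodule.span_le.2 ?_)
  · induction m with
    | zero =>
      intro f hf
      rw [show f = 0 from hf.2]
      exact zero_mem _
    | succ m ih =>
      intro f hf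
      obtain ⟨c, hc⟩ := exists_sub_smul_F_mem_V hf
      have hsub : Submodule.span ℂ (Set.range fun i : Fin m ↦ F i) ≤
          Submodule.span ℂ (Set.range fun i : Fin (m + 1) ↦ F i) := by
        refine Submodule.span_mono ?_
        rintro _ ⟨i, rfl⟩
        exact ⟨i.castSucc, rfl⟩
      rw [← sub_add_cancel f (c • F m)]
      exact add_mem (hsub (ih hc))
        (Submodule.smul_mem _ _ (Submodule.subset_span ⟨Fin.last m, rfl⟩))
  · rintro _ ⟨i, rfl⟩
    exact V_mono i.2 (F_mem_V i)

/-- Each `F m` lies outside `V m`, which is the span of its predecessors. -/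
theorem linearIndependent_F (m : ℕ) : LinearIndependent ℂ fun i : Fin m ↦ F i := by
  induction m with
  | zero => exact linearIndependent_empty_type
  | succ m ih =>
    refine linearIndependent_finSucc'.2 ⟨ih, fun h ↦ F_notMem_V m ?_⟩
    rw [V_eq_span]
    exact h

/-- Constants are exactly the level one forms of weight 0, and `Δ₀^m f` is constant on either side.
-/
theorem V_succ_eq_VHalf (m : ℕ) : V (m + 1) = VHalf m := by
  apply le_antisymm
  · intro f hf
    refine ⟨hf.1, ?_⟩
    obtain ⟨c, hc⟩ := exists_iterate_hypLaplacian_eq_const hf.1 m hf.2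
    exact ⟨ModularForm.const c, hc⟩
  · intro f hf
    refine ⟨hf.1, ?_⟩
    obtain ⟨g, hg⟩ := hf.2
    obtain ⟨c, hc⟩ := ModularFormClass.levelOne_weight_zero_const g
    rw [Function.iterate_succ_apply', hg, hc]
    exact hypLaplacian_const c

end PolyharmonicMaass

end

/-! ### The main theorem. -/

theorem theorem1p1 :
    (∀ z : ℍ, PolyharmonicMaass.IsDoublyCompleted z
      (PolyharmonicMaass.doublyCompletedEisenstein z)) ∧
    ∀ m : ℕ, 1 ≤ m →
      PolyharmonicMaass.V m = PolyharmonicMaass.VHalf (m - 1) ∧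
      Module.finrank ℂ (PolyharmonicMaass.V m) = m ∧
      ∃ b : Module.Basis (Fin m) ℂ (PolyharmonicMaass.V m),
        ∀ i : Fin m, (b i : ℍ → ℂ) = PolyharmonicMaass.F i := by
  refine ⟨PolyharmonicMaass.isDoublyCompleted_doublyCompletedEisenstein, fun m hm ↦ ?_⟩
  let b := (Module.Basis.span (PolyharmonicMaass.linearIndependent_F m)).map
    (LinearEquiv.ofEq _ _ (PolyharmonicMaass.V_eq_span m).symm)
  refine ⟨?_, ?_, b, fun i ↦ ?_⟩
  · obtain ⟨k, rfl⟩ := Nat.exists_eq_add_of_le' hm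
    exact PolyharmonicMaass.V_succ_eq_VHalf k
  · rw [Module.finrank_eq_card_basis b, Fintype.card_fin]
  · simp [b, Module.Basis.span_apply]
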